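/- All normed spaces are real and $p$ always denotes a norm on $X$ equivalent to the given norm $\|\cdot\|$. Definitions. Let $X$ be a reflexive Banach space and $f\colon X\to\mathbb R$. - $f$ is a *U-function* if it is continuous, strictly convex, bounded on bounded sets and coercive (every sublevel set $\{f\le C\}$, $C\in\mathbb R$, is bounded). - $f$ has the *small diameter property* (SDP) if, for every $x\in X$ and $x^*\in\partial f(x)$, every sequence $(x_n)$ in $X$ with $x^*(x_n)-f(x_n)\to x^*(x)-f(x)$ is norm convergent. - A finite family $f_1,\dots,f_N\colon X\to\mathbb R$ *satisfies condition (b)* of the Enflo–Beauzamy theorem if for every bounded convex set $D\subset X$ there are $C_D>0$ and $q\ge 2$ with $$f_i\Big(\frac{x_1+x_2}{2}\Big)\le\frac{f_i(x_1)+f_i(x_2)}{2}-C_D\|x_1-x_2\|^q\qquad(x_1,x_2\in D,\ 1\le i\le N).$$ A single function is regarded as a family with $N=1$. - $p$ is *Gâteaux differentiable* if it is so at every point of $X\setminus\{0\}$. It is *locally uniformly rotund* (LUR) if $p(x)=p(x_n)=1$ and $p(x+x_n)\to2$ imply $p(x_n-x)\to0$. It is *average locally uniformly rotund* (ALUR)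 if every $x$ with $p(x)=1$ is a denting point of $B=\{p\le1\}$, i.e. $x\notin\overline{\mathrm{conv}}\{y\in B: p(y-x)\ge\varepsilon\}$ for every $\varepsilon>0$. Statement. 1. If $X$ is a reflexive Banach space and $p$ is an equivalent norm on $X$ that is Gâteaux differentiable and ALUR but not LUR, then $p^2$ is a U-function, is Gâteaux differentiable at every point of $X$, has the SDP, and does not satisfy condition (b). 2. Every infinite-dimensional reflexive Banach space admits an equivalent norm $p$ that is Gâteaux differentiable and ALUR but not LUR. In particular, Gâteaux differentiable U-functions with the SDP that fail condition (b) exist on it. 3. There are a uniformly convex (hence reflexive) Banach space $X$ and a norm $p$ on it as in part 2 such that, for every $N\ge1$, there are pairwise distinct Gâteaux differentiable U-functions $f_1,\dots,f_N\colon X\to\mathbb R$ with the SDP, one of which is $p^2$, that do not satisfy condition (b). Thus all hypotheses of the approximation theorem for finite families of Gâteaux differentiable U-functions with the SDP on a uniformly convex Banach space hold, while those of the Enflo–Beauzamy theorem (a uniformly convex Banach space, Gâteaux differentiable U-functions, condition (b)) do not. -/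

import Mathlib

open Set Filter Topology

universe u

namespace UFun

/-- A real normed space is reflexive if the canonical embedding into its bidual is onto. -/
def IsReflexiveSpace (X : Type*) [NormedAddCommGroup X] [NormedSpace ℝ X] : Prop :=
  Function.Surjective (NormedSpace.inclusionInDoubleDual ℝ X)

section Functions

variable {X : Type*} [NormedAddCommGroup X] [NormedSpace ℝ X]

/-- Gâteaux differentiability of a real function at a point: all directional derivatives exist and
they are given by a continuous linear functional. -/
def GateauxDifferentiableAt (f : X → ℝ) (x : X) : Prop :=
  ∃ g : X →L[ℝ] ℝ, ∀ v : X, HasLineDerivAt ℝ f (g v) x v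

/-- U-functions (the ambient space is meant to be a reflexive Banach space). -/
structure IsUFunction (f : X → ℝ) : Prop where
  continuous : Continuous f
  strictConvex : StrictConvexOn ℝ univ f
  bounded_on_bounded : ∀ s : Set X, Bornology.IsBounded s → Bornology.IsBounded (f '' s)
  coercive : ∀ C : ℝ, Bornology.IsBounded {x : X | f x ≤ C}

/-- The subdifferential of `f` at `x`. -/
def subdiff (f : X → ℝ) (x : X) : Set (X →L[ℝ] ℝ) :=
  {g | ∀ y : X, f x + g (y - x) ≤ f y}

/-- The small diameter property: for every `x`, every `g ∈ ∂f(x)` and every sequence `(xₙ)` with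
`g xₙ - f xₙ → g x - f x`, the sequence `(xₙ)` is norm convergent. -/
def HasSDP (f : X → ℝ) : Prop :=
  ∀ x : X, ∀ g ∈ subdiff f x, ∀ u : ℕ → X,
    Tendsto (fun n => g (u n) - f (u n)) atTop (𝓝 (g x - f x)) →
      ∃ z : X, Tendsto u atTop (𝓝 z)

/-- The Enflo–Beauzamy convexity condition (b) for a family of functions: on each bounded convex
set, midpoint convexity holds with a common power-type gain `C ‖x - y‖ ^ q`, `C > 0`, `q ≥ 2`. -/
def ConditionB {ι : Type*} (f : ι → X → ℝ) : Prop :=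
  ∀ D : Set X, Convex ℝ D → Bornology.IsBounded D →
    ∃ C > (0 : ℝ), ∃ q ≥ (2 : ℝ), ∀ x ∈ D, ∀ y ∈ D, ∀ i : ι,
      f i ((2⁻¹ : ℝ) • (x + y)) ≤ 2⁻¹ * (f i x + f i y) - C * ‖x - y‖ ^ q

/-- The hypotheses of the theorem of Enflo and Beauzamy on a space and a finite family. -/
structure EnfloBeauzamyHypotheses {N : ℕ} (f : Fin N → X → ℝ) : Prop where
  complete : CompleteSpace X
  uniformConvex : UniformConvexSpace X
  uFunction : ∀ i, IsUFunction (f i)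
  gateaux : ∀ i, ∀ x, GateauxDifferentiableAt (f i) x
  conditionB : ConditionB f

/-- The hypotheses of the approximation theorem in which condition (b) is replaced by the SDP. -/
structure SDPHypotheses {N : ℕ} (f : Fin N → X → ℝ) : Prop where
  complete : CompleteSpace X
  uniformConvex : UniformConvexSpace X
  uFunction : ∀ i, IsUFunction (f i)
  gateaux : ∀ i, ∀ x, GateauxDifferentiableAt (f i) x
  sdp : ∀ i, HasSDP (f i)

end Functions

section Norms

variable {X : Type*} [NormedAddCommGroup X] [NormedSpace ℝ X]

/-- `p` is an equivalent norm on `X`. -/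
def IsEquivalentNorm (p : Seminorm ℝ X) : Prop :=
  ∃ c > (0 : ℝ), ∃ C > (0 : ℝ), ∀ x : X, c * ‖x‖ ≤ p x ∧ p x ≤ C * ‖x‖

/-- A Gâteaux differentiable norm is one that is Gâteaux differentiable off the origin. -/
def IsGateauxNorm (p : Seminorm ℝ X) : Prop :=
  ∀ x : X, x ≠ 0 → GateauxDifferentiableAt p x

/-- Local uniform rotundity (LUR) of the (equivalent) norm `p`. -/
def IsLUR (p : Seminorm ℝ X) : Prop :=
  ∀ x : X, p x = 1 → ∀ u : ℕ → X, (∀ n, p (u n) = 1) →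
    Tendsto (fun n => p (x + u n)) atTop (𝓝 2) →
      Tendsto (fun n => p (u n - x)) atTop (𝓝 0)

/-- Average local uniform rotundity (ALUR) of the (equivalent) norm `p`: every point `x` of the unit
sphere is a denting point of the unit ball `B`, that is, for each `ε > 0` the point `x` does not
belong to the closed convex hull of the points of `B` at distance at least `ε` from `x`. -/
def IsALUR (p : Seminorm ℝ X) : Prop :=
  ∀ x : X, p x = 1 → ∀ ε > (0 : ℝ),
    x ∉ closure (convexHull ℝ {y : X | p y ≤ 1 ∧ ε ≤ p (y - x)})

end Norms

end UFun

/-!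
# Squares of Gâteaux differentiable ALUR norms that are not LUR

*Squares of norms.* If `p` is ALUR, then `p ^ 2` is strictly convex (`IsALUR.strictConvexOn_sq`)
and `p` has the Kadec–Klee property (`IsALUR.tendsto_of_weak`). In a reflexive space a sequence as
in the small diameter property is bounded, strict convexity identifies all its weak cluster points
with `x`, and the norms converge as well; so it converges (`IsALUR.hasSDP_sq`). Condition (b) would make
`p` locally uniformly rotund (`ConditionB.isLUR`).

*The norm.* On an infinite-dimensional reflexive space `X`, the norm is defined through its dual
ball, `p x = sup {φ x | Φ φ ≤ 1}`, where `Φ` is an even continuous convex function on the dual. If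
`Φ` is strictly convex, then `p` is Gâteaux differentiable (`IsDualBody.isGateauxNorm`). If `Φ` is
Fréchet differentiable, then every point of the unit sphere of `p` is strongly exposed by a
functional, hence denting (`IsDualBody.isALUR`). Thus it suffices to find a strictly convex and
smooth `Φ` for which `p` fails to be LUR. Smoothness enters only through second-order differences
(`SecondDiffSmooth`), so that derivatives are never needed.

No separability is assumed, so both properties rest on a total family `x : Γ → X` along which every
functional is in `c₀(Γ)` (`IsReflexiveSpace.exists_isC0Family`, a theorem of Lindenstrauss). It is
obtained by induction on the cardinality of a total set: a well-ordered increasing chain of subsets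
generates pairs of subspaces of `X` and `X*` that norm each other, each such pair splits `X` by a
norm-one projection, and the families found in the smaller increments are put together.

* A Day-type function `dayFun` on the dual, built from the largest coordinates of `φ ∘ x`, is
  strictly convex. It is small when `φ ∘ x` is uniformly small.
* The operator `ℓ₁(Γ) → X` given by `x` has dense range. The least cost of approximating `u` from
  `ℓ₁(Γ)`, measured with a locally uniformly rotund norm of `ℓ₁(Γ)`, yields a locally uniformly
  convex function on `X`; its Fenchel conjugate `J` on the dual is smooth
  (`IsReflexiveSpace.exists_smooth_dual`).
* The infimal convolutions of `dayFun` with large multiples of `J` are smooth, and a weighted sum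
  `F` of them is still strictly convex (`exists_smooth_strictMidpoint`).

Finally, take weakly null sequences `f n` in `X` and `e n` in the dual that are almost biorthogonal
(`IsReflexiveSpace.exists_isNullSystem`); after rescaling the family `x`, the values of `dayFun` at
`e n` tend to zero. Let `Φ` be the sum of a multiple of `F`, normalized to be one at a small
functional `a`, of a term making the body bounded, and of steep smooth penalties for `|φ (f n)|`
exceeding one. Then `p (f n)` tends to one, and the functionals `a + t n • e n` with suitable
`t n ≤ 1` are asymptotically in the dual ball and take values close to one both at `f n` and at a
point `x` where `a` attains its norm. Hence `p (x + f n / p (f n))` tends to two, although `f n` is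
weakly null (`IsReflexiveSpace.exists_norm`).

For the last part, `X` is a Hilbert space, and the functions are the multiples `(i + 1) * p ^ 2`.
-/

namespace UFun

/-! ### Weak compactness in reflexive spaces -/

section Reflexive

variable {E : Type*} [NormedAddCommGroup E] [NormedSpace ℝ E]

theorem IsReflexiveSpace.exists_eval (hE : IsReflexiveSpace E)
    (Λ : StrongDual ℝ (StrongDual ℝ E)) : ∃ x : E, ∀ φ : StrongDual ℝ E, Λ φ = φ x := by
  obtain ⟨x, rfl⟩ := hE Λ
  exact ⟨x, fun φ => rfl⟩

theorem IsReflexiveSpace.dual (hE : IsReflexiveSpace E) : IsReflexiveSpace (StrongDual ℝ E) := by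
  intro Λ
  refine ⟨Λ.comp (NormedSpace.inclusionInDoubleDual ℝ E), ?_⟩
  ext θ
  obtain ⟨x, rfl⟩ := hE θ
  rfl

theorem IsReflexiveSpace.submodule (hE : IsReflexiveSpace E) (V : Submodule ℝ E)
    (hV : IsClosed (V : Set E)) : IsReflexiveSpace V := by
  intro Λ
  -- the restriction map of functionals
  let r : StrongDual ℝ E →L[ℝ] StrongDual ℝ V := ContinuousLinearMap.precomp ℝ V.subtypeL
  obtain ⟨x, hx⟩ := hE.exists_eval (Λ.comp r)
  have hxV : x ∈ V := by
    by_contra hn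
    obtain ⟨f, u, hf, hu⟩ := geometric_hahn_banach_closed_point V.convex hV hn
    have hf0 : ∀ v ∈ V, f v = 0 := by
      intro v hv
      by_contra hne
      have h1 := hf _ (V.smul_mem ((u + 1) / f v) hv)
      rw [map_smul, smul_eq_mul, div_mul_cancel₀ _ hne] at h1
      linarith
    have h0 : r f = 0 := by
      ext v
      exact hf0 v v.2
    have h1 := hx f
    have h2 := hf 0 V.zero_mem
    simp only [ContinuousLinearMap.comp_apply, h0, map_zero] at h1 h2
    linarith
  refine ⟨⟨x, hxV⟩, ?_⟩
  ext φ
  obtain ⟨ψ, hψ, -⟩ := exists_extension_norm_eq V φ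
  have : r ψ = φ := by
    ext v
    exact hψ v
  rw [NormedSpace.dual_def, ← hψ, ← this]
  exact (hx ψ).symm

/-- Bounded ultrafilters converge weakly in a reflexive space. -/
theorem IsReflexiveSpace.exists_weak_limit (hE : IsReflexiveSpace E) {ι : Type*}
    (U : Ultrafilter ι) (u : ι → E) {R : ℝ} (hu : ∀ᶠ i in (U : Filter ι), ‖u i‖ ≤ R) :
    ∃ x : E, ∀ φ : StrongDual ℝ E, Tendsto (fun i => φ (u i)) U (𝓝 (φ x)) := by
  have hc := WeakDual.isCompact_closedBall (𝕜 := ℝ) (E := StrongDual ℝ E) 0 R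
  let w : ι → WeakDual ℝ (StrongDual ℝ E) := fun i =>
    StrongDual.toWeakDual (NormedSpace.inclusionInDoubleDual ℝ E (u i))
  have hw : ∀ᶠ i in (U : Filter ι), w i ∈ WeakDual.toStrongDual ⁻¹'
      Metric.closedBall (0 : StrongDual ℝ (StrongDual ℝ E)) R := by
    filter_upwards [hu] with i hi
    have := NormedSpace.double_dual_bound ℝ E (u i)
    exact (mem_closedBall_zero_iff (a := NormedSpace.inclusionInDoubleDual ℝ E (u i))).2
      (this.trans hi)
  obtain ⟨Λ, -, hΛ⟩ := hc.ultrafilter_le_nhds (U.map w) (by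
    rw [le_principal_iff]; exact hw)
  obtain ⟨x, hx⟩ := hE.exists_eval (WeakDual.toStrongDual Λ)
  refine ⟨x, fun φ => ?_⟩
  have h1 : Tendsto w U (𝓝 Λ) := hΛ
  have h2 := ((WeakDual.eval_continuous φ).tendsto Λ).comp h1
  rw [← hx φ]
  exact h2

/-- Closed convex sets are weakly closed (along ultrafilters, or any other filters). -/
theorem mem_of_weak_limit {ι : Type*} {l : Filter ι} [l.NeBot] {u : ι → E} {x : E}
    (hx : ∀ φ : StrongDual ℝ E, Tendsto (fun i => φ (u i)) l (𝓝 (φ x)))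
    {K : Set E} (hK : Convex ℝ K) (hKc : IsClosed K) (hu : ∃ᶠ i in l, u i ∈ K) : x ∈ K := by
  by_contra hn
  obtain ⟨f, s, hf, hs⟩ := geometric_hahn_banach_closed_point hK hKc hn
  have h1 := (hx f).eventually (lt_mem_nhds hs)
  obtain ⟨i, hi, hi'⟩ := (hu.and_eventually h1).exists
  exact absurd (hf _ hi) (not_lt.2 hi'.le)

/-- Continuous convex functions are weakly lower semicontinuous. -/
theorem le_of_weak_limit {ι : Type*} {l : Filter ι} [l.NeBot] {u : ι → E} {x : E}
    (hx : ∀ φ : StrongDual ℝ E, Tendsto (fun i => φ (u i)) l (𝓝 (φ x)))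
    {f : E → ℝ} (hf : ConvexOn ℝ univ f) (hfc : Continuous f) {c : ℝ}
    (hu : ∃ᶠ i in l, f (u i) ≤ c) : f x ≤ c := by
  have hc : Convex ℝ {x | f x ≤ c} := by simpa using hf.convex_le c
  exact mem_of_weak_limit hx hc (isClosed_le hfc continuous_const) hu

/-- The direct method: a coercive continuous convex function on a reflexive space has a minimum. -/
theorem IsReflexiveSpace.exists_forall_le (hE : IsReflexiveSpace E) {f : E → ℝ}
    (hf : ConvexOn ℝ univ f) (hfc : Continuous f)
    (hco : ∀ C : ℝ, Bornology.IsBounded {x : E | f x ≤ C}) : ∃ x, ∀ y, f x ≤ f y := by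
  have hne : (⨅ y : E, 𝓟 {x | f x ≤ f y}).NeBot := by
    refine iInf_neBot_of_directed' ?_ fun y => principal_neBot_iff.2 ⟨y, le_refl (f y)⟩
    intro y z
    rcases le_total (f y) (f z) with h | h
    · exact ⟨y, le_rfl, principal_mono.2 fun x hx => le_trans hx h⟩
    · exact ⟨z, principal_mono.2 fun x hx => le_trans hx h, le_rfl⟩
  let U := Ultrafilter.of (⨅ y : E, 𝓟 {x | f x ≤ f y})
  have hU : ∀ y, ∀ᶠ x in (U : Filter E), f x ≤ f y := fun y =>
    (Ultrafilter.of_le _).trans (iInf_le _ y) (mem_principal_self _)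
  obtain ⟨R, hR⟩ := (hco (f 0)).exists_norm_le
  obtain ⟨x, hx⟩ := hE.exists_weak_limit U id (R := R) (by
    filter_upwards [hU 0] with x hx using hR x hx)
  exact ⟨x, fun y => le_of_weak_limit hx hf hfc (hU y).frequently⟩

theorem continuous_of_convexOn_of_le {f : E → ℝ} (hf : ConvexOn ℝ univ f) {C : ℝ}
    (hb : ∀ x, f x ≤ C * (1 + ‖x‖ ^ 2)) : Continuous f := by
  have h := (hf.continuousOn_tfae isOpen_univ univ_nonempty).out 3 1
  rw [← continuousOn_univ]
  refine h.1 ⟨0, mem_univ _, ?_⟩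
  have hc : ContinuousAt (fun x : E => C * (1 + ‖x‖ ^ 2)) 0 := by fun_prop
  have := hc.eventually (gt_mem_nhds (lt_add_one _))
  exact ⟨_, by
    rw [eventually_map]
    filter_upwards [this] with x hx using (hb x).trans hx.le⟩

theorem norm_eq_of_support (x : E) : ∃ φ : StrongDual ℝ E, ‖φ‖ ≤ 1 ∧ φ x = ‖x‖ := by
  obtain ⟨g, h1, h2⟩ := exists_dual_vector'' ℝ x
  exact ⟨g, h1, by simpa using h2⟩

theorem IsReflexiveSpace.exists_norm_attaining (hE : IsReflexiveSpace E) (φ : StrongDual ℝ E) :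
    ∃ x : E, ‖x‖ ≤ 1 ∧ φ x = ‖φ‖ := by
  obtain ⟨Λ, h1, h2⟩ := norm_eq_of_support φ
  obtain ⟨x, rfl⟩ := hE Λ
  refine ⟨x, ?_, h2⟩
  have := (NormedSpace.inclusionInDoubleDualLi ℝ (E := E)).norm_map x
  rw [← this]
  exact h1

end Reflexive

/-! ### Decompositions of a reflexive space -/

section Decomposition

variable {E : Type*} [NormedAddCommGroup E] [NormedSpace ℝ E]

/-- If `V ⊆ E` and `W ⊆ E*` are closed subspaces norming each other, then `E = V ⊕ W^⊥`, and the
projection onto `V` has norm one: density is the bipolar theorem, closedness comes from `h₁`. -/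
theorem IsReflexiveSpace.exists_decomposition [CompleteSpace E] (hE : IsReflexiveSpace E)
    (V : Submodule ℝ E) (W : Submodule ℝ (StrongDual ℝ E))
    (hV : IsClosed (V : Set E)) (hW : IsClosed (W : Set (StrongDual ℝ E)))
    (h₁ : ∀ v ∈ V, ∀ z, (∀ w ∈ W, w z = 0) → ‖v‖ ≤ ‖v + z‖)
    (h₂ : ∀ w ∈ W, (∀ v ∈ V, w v = 0) → w = 0) (x : E) :
    ∃ v ∈ V, ∀ w ∈ W, w (x - v) = 0 := by
  let Z : Submodule ℝ E := ⨅ w ∈ W, LinearMap.ker (w : E →ₗ[ℝ] ℝ)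
  have hZ : ∀ z, z ∈ Z ↔ ∀ w ∈ W, w z = 0 := fun z => by simp [Z]
  have hZc : IsClosed (Z : Set E) := by
    have : (Z : Set E) = ⋂ w ∈ W, {z | w z = 0} := by
      ext z
      simp [hZ]
    rw [this]
    exact isClosed_biInter fun w _ => isClosed_eq w.continuous continuous_const
  have : CompleteSpace V := hV.completeSpace_coe
  have : CompleteSpace Z := hZc.completeSpace_coe
  let T : V × Z →L[ℝ] E := V.subtypeL.coprod Z.subtypeL
  have hT : ∀ v z, T (v, z) = v + z := fun v z => rfl
  have hb : ∀ p : V × Z, ‖p‖ ≤ (2 : NNReal) * ‖T p‖ := by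
    rintro ⟨v, z⟩
    have hv : ‖(v : E)‖ ≤ ‖(v : E) + z‖ := h₁ v v.2 z ((hZ z).1 z.2)
    have hz : ‖(z : E)‖ ≤ ‖(v : E) + z‖ + ‖(v : E)‖ := by
      have := norm_sub_le ((v : E) + z) v
      rwa [add_sub_cancel_left] at this
    rw [hT, Prod.norm_def]
    simp only [Submodule.coe_norm, NNReal.coe_ofNat]
    exact max_le (by linarith [norm_nonneg (v : E)]) (by linarith)
  have hcl : IsClosed (range T) :=
    (AddMonoidHomClass.antilipschitz_of_bound T hb).isClosed_range T.uniformContinuous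
  have hx : x ∈ range T := by
    by_contra hn
    have hconv : Convex ℝ (range T) := (LinearMap.range (T : V × Z →ₗ[ℝ] E)).convex
    obtain ⟨φ, u, hφ, hu⟩ := geometric_hahn_banach_closed_point hconv hcl hn
    have h0 : ∀ p, φ (T p) = 0 := by
      intro p
      by_contra hne
      have h1 := hφ _ ⟨((u + 1) / φ (T p)) • p, rfl⟩
      rw [map_smul, map_smul, smul_eq_mul, div_mul_cancel₀ _ hne] at h1
      linarith
    have hu0 : 0 < u := by simpa using hφ _ ⟨0, rfl⟩
    -- the bipolar theorem: a functional vanishing on `W^⊥` belongs to `W`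
    have hφW : φ ∈ W := by
      by_contra hnW
      obtain ⟨Λ, s, hΛ, hs⟩ := geometric_hahn_banach_closed_point W.convex hW hnW
      obtain ⟨y, hy⟩ := hE.exists_eval Λ
      have hyZ : y ∈ Z := by
        rw [hZ]
        intro w hw
        by_contra hne
        have h1 := hΛ _ (W.smul_mem ((s + 1) / w y) hw)
        rw [hy, smul_apply, smul_eq_mul, div_mul_cancel₀ _ hne] at h1
        linarith
      have h1 := h0 (0, ⟨y, hyZ⟩)
      rw [hT] at h1
      have h2 := hΛ 0 W.zero_mem
      rw [hy] at hs
      simp only [Submodule.coe_zero, zero_add, map_zero] at h1 h2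
      linarith
    have : φ = 0 := h₂ φ hφW fun v hv => by
      have := h0 (⟨v, hv⟩, 0)
      simpa [hT] using this
    simp [this] at hu
    linarith
  obtain ⟨⟨v, z⟩, rfl⟩ := hx
  refine ⟨v, v.2, fun w hw => ?_⟩
  rw [hT, add_sub_cancel_left]
  exact (hZ z).1 z.2 w hw

/-- The closure of a set that is stable under sums and rational multiples. -/
noncomputable def closureOfRatSpan {F : Type*} [NormedAddCommGroup F] [NormedSpace ℝ F] (A : Set F)
    (h0 : (0 : F) ∈ A) (hadd : ∀ x ∈ A, ∀ y ∈ A, x + y ∈ A)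
    (hsmul : ∀ q : ℚ, ∀ x ∈ A, (q : ℝ) • x ∈ A) : Submodule ℝ F where
  carrier := closure A
  zero_mem' := subset_closure h0
  add_mem' := fun {_ _} hx hy =>
    map_mem_closure₂ continuous_add hx hy fun a ha b hb => hadd a ha b hb
  smul_mem' := fun c x hx =>
    map_mem_closure₂ (f := fun (c : ℝ) (x : F) => c • x) continuous_smul
      (Rat.denseRange_cast (𝕜 := ℝ) c) hx (by
        rintro _ ⟨q, rfl⟩ b hb
        exact hsmul q b hb)

end Decomposition

section Good

variable {E : Type*} [NormedAddCommGroup E] [NormedSpace ℝ E]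

/-- A support map: to each vector, a norm-one functional attaining its norm (and `0` to `0`). -/
def IsSupportMap (s : E → StrongDual ℝ E) : Prop :=
  ∀ x, ‖s x‖ ≤ 1 ∧ s x x = ‖x‖ ∧ (x = 0 → s x = 0)

/-- A support map on the dual whose values are evaluations at vectors. -/
def IsDualSupportMap (s' : StrongDual ℝ E → E) : Prop :=
  ∀ φ, ‖s' φ‖ ≤ 1 ∧ φ (s' φ) = ‖φ‖ ∧ (φ = 0 → s' φ = 0)

theorem exists_isSupportMap : ∃ s : E → StrongDual ℝ E, IsSupportMap s := by
  have : ∀ x : E, ∃ φ : StrongDual ℝ E, ‖φ‖ ≤ 1 ∧ φ x = ‖x‖ ∧ (x = 0 → φ = 0) := by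
    intro x
    by_cases hx : x = 0
    · exact ⟨0, by simp, by simp [hx], fun _ => rfl⟩
    · obtain ⟨φ, h1, h2⟩ := norm_eq_of_support x
      exact ⟨φ, h1, h2, fun h => absurd h hx⟩
  choose s hs using this
  exact ⟨s, hs⟩

theorem IsReflexiveSpace.exists_isDualSupportMap (hE : IsReflexiveSpace E) :
    ∃ s' : StrongDual ℝ E → E, IsDualSupportMap s' := by
  have : ∀ φ : StrongDual ℝ E, ∃ x : E, ‖x‖ ≤ 1 ∧ φ x = ‖φ‖ ∧ (φ = 0 → x = 0) := by
    intro φ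
    by_cases hφ : φ = 0
    · exact ⟨0, by simp, by simp [hφ], fun _ => rfl⟩
    · obtain ⟨x, h1, h2⟩ := hE.exists_norm_attaining φ
      exact ⟨x, h1, h2, fun h => absurd h hφ⟩
  choose s hs using this
  exact ⟨s, hs⟩

/-- Sets of pairs stable under rational linear combinations and under the support maps. The two
projections of such a set have closures that norm each other. -/
structure IsGood (s : E → StrongDual ℝ E) (s' : StrongDual ℝ E → E)
    (M : Set (E × StrongDual ℝ E)) : Prop where
  zero : 0 ∈ M
  add : ∀ a ∈ M, ∀ b ∈ M, a + b ∈ M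
  smul : ∀ q : ℚ, ∀ a ∈ M, (q : ℝ) • a ∈ M
  support : ∀ a ∈ M, (s' a.2, s a.1) ∈ M

variable {s : E → StrongDual ℝ E} {s' : StrongDual ℝ E → E} {M : Set (E × StrongDual ℝ E)}

/-- The closed subspace of `E` carried by a good set. -/
noncomputable def IsGood.space (hM : IsGood s s' M) : Submodule ℝ E :=
  closureOfRatSpan (Prod.fst '' M) ⟨0, hM.zero, rfl⟩
    (by rintro _ ⟨a, ha, rfl⟩ _ ⟨b, hb, rfl⟩; exact ⟨a + b, hM.add a ha b hb, rfl⟩)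
    (by rintro q _ ⟨a, ha, rfl⟩; exact ⟨_, hM.smul q a ha, rfl⟩)

/-- The closed subspace of the dual carried by a good set. -/
noncomputable def IsGood.dualSpace (hM : IsGood s s' M) : Submodule ℝ (StrongDual ℝ E) :=
  closureOfRatSpan (Prod.snd '' M) ⟨0, hM.zero, rfl⟩
    (by rintro _ ⟨a, ha, rfl⟩ _ ⟨b, hb, rfl⟩; exact ⟨a + b, hM.add a ha b hb, rfl⟩)
    (by rintro q _ ⟨a, ha, rfl⟩; exact ⟨_, hM.smul q a ha, rfl⟩)

theorem IsGood.isClosed_space (hM : IsGood s s' M) : IsClosed (hM.space : Set E) :=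
  isClosed_closure

theorem IsGood.isClosed_dualSpace (hM : IsGood s s' M) :
    IsClosed (hM.dualSpace : Set (StrongDual ℝ E)) :=
  isClosed_closure

theorem IsGood.fst_mem_space (hM : IsGood s s' M) {a : E × StrongDual ℝ E} (ha : a ∈ M) :
    a.1 ∈ hM.space :=
  subset_closure ⟨a, ha, rfl⟩

/-- The dual space of a good set norms its space, even modulo the annihilator of the former. -/
theorem IsGood.norm_le_add (hM : IsGood s s' M) (hs : IsSupportMap s) {v : E}
    (hv : v ∈ hM.space) {z : E} (hz : ∀ a ∈ M, a.2 z = 0) : ‖v‖ ≤ ‖v + z‖ := by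
  have hc : IsClosed {v : E | ‖v‖ ≤ ‖v + z‖} := isClosed_le (by fun_prop) (by fun_prop)
  refine closure_minimal ?_ hc hv
  rintro _ ⟨a, ha, rfl⟩
  obtain ⟨h1, h2, -⟩ := hs a.1
  have h3 : s a.1 z = 0 := hz _ (hM.support a ha)
  calc ‖a.1‖ = s a.1 (a.1 + z) := by rw [map_add, h2, h3, add_zero]
    _ ≤ ‖s a.1‖ * ‖a.1 + z‖ := (le_abs_self _).trans ((s a.1).le_opNorm _)
    _ ≤ ‖a.1 + z‖ := mul_le_of_le_one_left (norm_nonneg _) h1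

theorem IsGood.dual_norm_le_add (hM : IsGood s s' M) (hs : IsDualSupportMap s')
    {w : StrongDual ℝ E} (hw : w ∈ hM.dualSpace) {θ : StrongDual ℝ E}
    (hθ : ∀ a ∈ M, θ a.1 = 0) : ‖w‖ ≤ ‖w + θ‖ := by
  have hc : IsClosed {v : StrongDual ℝ E | ‖v‖ ≤ ‖v + θ‖} :=
    isClosed_le (by fun_prop) (by fun_prop)
  refine closure_minimal ?_ hc hw
  rintro _ ⟨a, ha, rfl⟩
  obtain ⟨h1, h2, -⟩ := hs a.2
  have h3 : θ (s' a.2) = 0 := hθ _ (hM.support a ha)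
  calc ‖a.2‖ = (a.2 + θ) (s' a.2) := by rw [add_apply, h2, h3, add_zero]
    _ ≤ ‖a.2 + θ‖ * ‖s' a.2‖ := (le_abs_self _).trans ((a.2 + θ).le_opNorm _)
    _ ≤ ‖a.2 + θ‖ := mul_le_of_le_one_right (norm_nonneg _) h1

variable [CompleteSpace E]

/-- The norm-one projection onto the space of a good set along the annihilator of its dual space. -/
theorem IsGood.exists_decomposition (hE : IsReflexiveSpace E) (hs : IsSupportMap s)
    (hs' : IsDualSupportMap s') (hM : IsGood s s' M) (x : E) :
    ∃ v ∈ hM.space, ‖v‖ ≤ ‖x‖ ∧ ∀ a ∈ M, a.2 (x - v) = 0 := by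
  obtain ⟨v, hv, h⟩ := hE.exists_decomposition hM.space hM.dualSpace hM.isClosed_space
    hM.isClosed_dualSpace
    (fun v hv z hz => hM.norm_le_add hs hv fun a ha => hz _ (subset_closure ⟨a, ha, rfl⟩))
    (fun w hw h => by
      have := hM.dual_norm_le_add hs' hw (θ := -w) (fun a ha => by
        simp [h a.1 (hM.fst_mem_space ha)])
      simpa using this) x
  have hz : ∀ a ∈ M, a.2 (x - v) = 0 := fun a ha => h _ (subset_closure ⟨a, ha, rfl⟩)
  refine ⟨v, hv, ?_, hz⟩
  have := hM.norm_le_add hs hv hz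
  rwa [add_sub_cancel] at this

/-- Every functional agrees on the space of a good set with an element of its dual space. -/
theorem IsGood.exists_dual_decomposition (hE : IsReflexiveSpace E) (hs : IsSupportMap s)
    (hs' : IsDualSupportMap s') (hM : IsGood s s' M) (φ : StrongDual ℝ E) :
    ∃ w ∈ hM.dualSpace, ∀ v ∈ hM.space, φ v = w v := by
  let J := NormedSpace.inclusionInDoubleDualLi ℝ (E := E)
  have hJ : ∀ (x : E) (ψ : StrongDual ℝ E), J x ψ = ψ x := fun _ _ => rfl
  have : CompleteSpace hM.space := hM.isClosed_space.completeSpace_coe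
  have hcl : IsClosed ((hM.space.map J.toLinearMap : Submodule ℝ _) :
      Set (StrongDual ℝ (StrongDual ℝ E))) :=
    ((J.isComplete_map_iff).2 hM.isClosed_space.isComplete).isClosed
  obtain ⟨w, hw, h⟩ := hE.dual.exists_decomposition hM.dualSpace (hM.space.map J.toLinearMap)
    hM.isClosed_dualSpace hcl
    (fun w hw θ hθ => hM.dual_norm_le_add hs' hw fun a ha =>
      hθ _ ⟨a.1, hM.fst_mem_space ha, rfl⟩)
    (by
      rintro _ ⟨v, hv, rfl⟩ h
      have := hM.norm_le_add hs hv (z := -v) (fun a ha => by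
        have := h a.2 (subset_closure ⟨a, ha, rfl⟩)
        rw [map_neg, neg_eq_zero]
        exact this)
      have hv0 : v = 0 := by simpa using this
      rw [hv0, map_zero]) φ
  refine ⟨w, hw, fun v hv => ?_⟩
  have := h _ ⟨v, hv, rfl⟩
  exact sub_eq_zero.1 this

end Good

/-! ### Generated good sets and families of `c₀` type -/

section GoodClosure

open Cardinal

/-- Closing a set under countably many binary operations does not increase an infinite bound on its
cardinality. -/
theorem exists_closed_under_mk_le {Z ι : Type u} [Countable ι] (g : ι → Z → Z → Z) (S : Set Z)
    {c : Cardinal.{u}} (hc : ℵ₀ ≤ c) (hS : #S ≤ c) :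
    ∃ N : Set Z, S ⊆ N ∧ (∀ i, ∀ a ∈ N, ∀ b ∈ N, g i a b ∈ N) ∧ #N ≤ c := by
  let T : ℕ → Set Z := fun n =>
    Nat.rec S (fun _ A => A ∪ ⋃ i, image2 (g i) A A) n
  have hT : ∀ n, T (n + 1) = T n ∪ ⋃ i, image2 (g i) (T n) (T n) := fun n => rfl
  have hmono : Monotone T := monotone_nat_of_le_succ fun n => by
    rw [hT]
    exact subset_union_left
  have hcard : ∀ n, #↥(T n) ≤ c := by
    intro n
    induction n with
    | zero => exact hS
    | succ n ih =>
      rw [hT]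
      have h1 : #(⋃ i, image2 (g i) (T n) (T n)) ≤ c := by
        refine (mk_iUnion_le _).trans ?_
        have h2 : ∀ i, #(image2 (g i) (T n) (T n)) ≤ c := fun i =>
          mk_image2_le.trans ((mul_le_mul' ih ih).trans (mul_eq_self hc).le)
        refine (mul_le_mul' (mk_le_aleph0.trans hc) (ciSup_le' h2)).trans (mul_eq_self hc).le
      exact (mk_union_le _ _).trans ((add_le_add ih h1).trans (add_eq_self hc).le)
  refine ⟨⋃ n, T n, subset_iUnion T 0, ?_, ?_⟩
  · intro i a ha b hb
    obtain ⟨m, hm⟩ := mem_iUnion.1 ha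
    obtain ⟨n, hn⟩ := mem_iUnion.1 hb
    refine mem_iUnion.2 ⟨max m n + 1, ?_⟩
    rw [hT]
    exact Or.inr (mem_iUnion.2 ⟨i, mem_image2_of_mem (hmono (le_max_left m n) hm)
      (hmono (le_max_right m n) hn)⟩)
  · have h := mk_iUnion_le_lift T
    rw [lift_id', mk_nat, lift_aleph0] at h
    refine h.trans ((mul_le_mul' hc (ciSup_le' fun n => ?_)).trans (mul_eq_self hc).le)
    rw [lift_id']
    exact hcard n

variable {E : Type u} [NormedAddCommGroup E] [NormedSpace ℝ E]
  {s : E → StrongDual ℝ E} {s' : StrongDual ℝ E → E}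

/-- The smallest good set whose projection to `E` contains `S`. -/
def goodClosure (s : E → StrongDual ℝ E) (s' : StrongDual ℝ E → E) (S : Set E) :
    Set (E × StrongDual ℝ E) :=
  ⋂₀ {M | IsGood s s' M ∧ ∀ x ∈ S, (x, 0) ∈ M}

theorem isGood_goodClosure (S : Set E) : IsGood s s' (goodClosure s s' S) where
  zero := fun _ hM => hM.1.zero
  add := fun a ha b hb M hM => hM.1.add a (ha M hM) b (hb M hM)
  smul := fun q a ha M hM => hM.1.smul q a (ha M hM)
  support := fun a ha M hM => hM.1.support a (ha M hM)

theorem subset_goodClosure {S : Set E} {x : E} (hx : x ∈ S) : (x, 0) ∈ goodClosure s s' S :=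
  fun _ hM => hM.2 x hx

theorem goodClosure_subset {S : Set E} {M : Set (E × StrongDual ℝ E)} (hM : IsGood s s' M)
    (h : ∀ x ∈ S, (x, 0) ∈ M) : goodClosure s s' S ⊆ M :=
  fun _ ha => ha M ⟨hM, h⟩

theorem goodClosure_mono {S T : Set E} (h : S ⊆ T) : goodClosure s s' S ⊆ goodClosure s s' T :=
  goodClosure_subset (isGood_goodClosure T) fun _ hx => subset_goodClosure (h hx)

theorem mk_goodClosure_le (S : Set E) {c : Cardinal.{u}} (hc : ℵ₀ ≤ c) (hS : #S ≤ c) :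
    #(goodClosure s s' S) ≤ c := by
  -- addition, the support maps, and the rational multiplications, as binary operations
  let g : ULift.{u} (Option (Option ℚ)) → (E × StrongDual ℝ E) → (E × StrongDual ℝ E) →
      (E × StrongDual ℝ E) := fun i a b =>
    match i.down with
    | none => a + b
    | some none => (s' a.2, s a.1)
    | some (some q) => (q : ℝ) • a
  have h0 : #(insert (0 : E × StrongDual ℝ E) ((fun x => (x, 0)) '' S) : Set _) ≤ c :=
    mk_insert_le.trans ((add_le_add (mk_image_le.trans hS) (one_le_aleph0.trans hc)).trans
      (add_eq_self hc).le)
  obtain ⟨N, hSN, hN, hNc⟩ := exists_closed_under_mk_le g _ hc h0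
  have hgood : IsGood s s' N :=
    { zero := hSN (mem_insert _ _)
      add := fun a ha b hb => hN ⟨none⟩ a ha b hb
      smul := fun q a ha => hN ⟨some (some q)⟩ a ha a ha
      support := fun a ha => hN ⟨some none⟩ a ha a ha }
  exact (mk_le_mk_of_subset (goodClosure_subset hgood fun x hx =>
    hSN (mem_insert_of_mem _ ⟨x, hx, rfl⟩))).trans hNc

/-- The good closure of a union of a chain is the union of the good closures (and it is `{0}` for an
empty chain). -/
theorem exists_of_mem_goodClosure_Iio (hs : IsSupportMap s) (hs' : IsDualSupportMap s')
    {I : Type*} [LinearOrder I] (b : I → E) (i : I) {a : E × StrongDual ℝ E}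
    (ha : a ∈ goodClosure s s' (b '' Iio i)) :
    a = 0 ∨ ∃ j < i, a ∈ goodClosure s s' (b '' Iic j) := by
  have hmono : ∀ {j k : I}, j ≤ k →
      goodClosure s s' (b '' Iic j) ⊆ goodClosure s s' (b '' Iic k) := fun h =>
    goodClosure_mono (image_mono (Iic_subset_Iic.2 h))
  have hgood : IsGood s s' {a | a = 0 ∨ ∃ j < i, a ∈ goodClosure s s' (b '' Iic j)} := by
    refine ⟨Or.inl rfl, ?_, ?_, ?_⟩
    · rintro a (rfl | ⟨j, hj, ha⟩) c (rfl | ⟨k, hk, hc⟩)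
      · exact Or.inl (add_zero 0)
      · right; exact ⟨k, hk, by rwa [zero_add]⟩
      · right; exact ⟨j, hj, by rwa [add_zero]⟩
      · exact Or.inr ⟨max j k, max_lt hj hk, (isGood_goodClosure _).add _
          (hmono (le_max_left j k) ha) _ (hmono (le_max_right j k) hc)⟩
    · rintro q a (rfl | ⟨j, hj, ha⟩)
      · exact Or.inl (smul_zero _)
      · exact Or.inr ⟨j, hj, (isGood_goodClosure _).smul q a ha⟩
    · rintro a (rfl | ⟨j, hj, ha⟩)
      · left
        exact Prod.ext ((hs' 0).2.2 rfl) ((hs 0).2.2 rfl)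
      · exact Or.inr ⟨j, hj, (isGood_goodClosure _).support a ha⟩
  refine goodClosure_subset hgood ?_ ha
  rintro _ ⟨j, hj, rfl⟩
  exact Or.inr ⟨j, hj, subset_goodClosure ⟨j, mem_Iic.2 le_rfl, rfl⟩⟩

end GoodClosure

section C0Family

/-- A set of vectors is total if only the zero functional vanishes on it. -/
def IsTotal {E : Type*} [NormedAddCommGroup E] [NormedSpace ℝ E] (S : Set E) : Prop :=
  ∀ φ : StrongDual ℝ E, (∀ x ∈ S, φ x = 0) → φ = 0

/-- A total family in the unit ball along which every functional is a `c₀` family: equivalently,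
a bounded injective operator from the dual into some `c₀(Γ)`, given by evaluations. -/
structure IsC0Family {E : Type*} [NormedAddCommGroup E] [NormedSpace ℝ E] {Γ : Type*}
    (x : Γ → E) : Prop where
  norm_le : ∀ γ, ‖x γ‖ ≤ 1
  total : IsTotal (range x)
  finite : ∀ φ : StrongDual ℝ E, ∀ ε > 0, {γ | ε < |φ (x γ)|}.Finite

theorem exists_isC0Family_of_countable {E : Type u} [NormedAddCommGroup E] [NormedSpace ℝ E]
    {S : Set E} (hS : S.Countable) (htot : IsTotal S) :
    ∃ (Γ : Type u) (x : Γ → E), IsC0Family x := by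
  have : Countable S := hS
  obtain ⟨e, he⟩ := exists_injective_nat S
  let x : S → E := fun y => ((1 / 2 : ℝ) ^ e y * (1 + ‖(y : E)‖)⁻¹) • (y : E)
  have hpos : ∀ y : S, 0 < (1 / 2 : ℝ) ^ e y * (1 + ‖(y : E)‖)⁻¹ := fun y => by positivity
  have hnorm : ∀ y : S, ‖x y‖ ≤ (1 / 2 : ℝ) ^ e y := by
    intro y
    rw [norm_smul, Real.norm_of_nonneg (hpos y).le, mul_assoc]
    refine mul_le_of_le_one_right (by positivity) ?_
    rw [inv_mul_le_one₀ (by positivity)]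
    linarith
  refine ⟨S, x, fun y => (hnorm y).trans (pow_le_one₀ (by norm_num) (by norm_num)), ?_, ?_⟩
  · intro φ hφ
    refine htot φ fun y hy => ?_
    have h := hφ (x ⟨y, hy⟩) ⟨_, rfl⟩
    rw [map_smul, smul_eq_mul] at h
    exact (mul_eq_zero.1 h).resolve_left (hpos ⟨y, hy⟩).ne'
  · intro φ ε hε
    have hlim : Tendsto (fun n : ℕ => ‖φ‖ * (1 / 2 : ℝ) ^ n) atTop (𝓝 0) := by
      simpa using (tendsto_pow_atTop_nhds_zero_of_lt_one (r := (1 / 2 : ℝ)) (by norm_num)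
        (by norm_num)).const_mul ‖φ‖
    obtain ⟨N, hN⟩ := eventually_atTop.1 (hlim.eventually (gt_mem_nhds hε))
    refine Set.Finite.subset ((finite_lt_nat N).preimage he.injOn) fun y hy => ?_
    by_contra hn
    have h1 := hN (e y) (not_lt.1 hn)
    have h2 := (φ.le_opNorm (x y)).trans (mul_le_mul_of_nonneg_left (hnorm y) (norm_nonneg φ))
    exact absurd (lt_of_lt_of_le hy h2) (not_lt.2 h1.le)

end C0Family

/-! ### Existence of total `c₀` families -/

section Increments

open Cardinal

variable {E : Type u} [NormedAddCommGroup E] [NormedSpace ℝ E]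
  {s : E → StrongDual ℝ E} {s' : StrongDual ℝ E → E}

/-- For good sets `M ⊆ N`, the increment `V_N ∩ W_M^⊥`, which complements `V_M` in `V_N`. -/
noncomputable def IsGood.increment {M N : Set (E × StrongDual ℝ E)} (hN : IsGood s s' N)
    (_ : IsGood s s' M) : Submodule ℝ E :=
  hN.space ⊓ ⨅ a ∈ M, LinearMap.ker (a.2 : E →ₗ[ℝ] ℝ)

theorem IsGood.mem_increment {M N : Set (E × StrongDual ℝ E)} (hN : IsGood s s' N)
    (hM : IsGood s s' M) {e : E} :
    e ∈ hN.increment hM ↔ e ∈ hN.space ∧ ∀ a ∈ M, a.2 e = 0 := by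
  simp [IsGood.increment, Submodule.mem_inf]

theorem IsGood.isClosed_increment {M N : Set (E × StrongDual ℝ E)} (hN : IsGood s s' N)
    (hM : IsGood s s' M) : IsClosed (hN.increment hM : Set E) := by
  have : (hN.increment hM : Set E) = (hN.space : Set E) ∩ ⋂ a ∈ M, {z | a.2 z = 0} := by
    ext z
    simp [hN.mem_increment hM]
  rw [this]
  exact hN.isClosed_space.inter
    (isClosed_biInter fun a _ => isClosed_eq a.2.continuous continuous_const)

theorem IsGood.space_mono {M N : Set (E × StrongDual ℝ E)} (hM : IsGood s s' M)
    (hN : IsGood s s' N) (h : M ⊆ N) : hM.space ≤ hN.space :=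
  closure_mono (image_mono h)

variable [CompleteSpace E]

/-- The increment between two good sets has a total set no larger than the bigger good set: project
the elements of the latter. -/
theorem IsGood.exists_total_increment (hE : IsReflexiveSpace E) (hs : IsSupportMap s)
    (hs' : IsDualSupportMap s') {M N : Set (E × StrongDual ℝ E)} (hN : IsGood s s' N)
    (hM : IsGood s s' M) (h : M ⊆ N) :
    ∃ T : Set (hN.increment hM), #T ≤ #N ∧ IsTotal T := by
  choose P hP hPn hPz using hM.exists_decomposition hE hs hs'
  have hmem : ∀ n ∈ N, n.1 - P n.1 ∈ hN.increment hM := fun n hn =>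
    (hN.mem_increment hM).2 ⟨Submodule.sub_mem _ (hN.fst_mem_space hn)
      (hM.space_mono hN h (hP _)), hPz _⟩
  let t : N → hN.increment hM := fun n => ⟨n.1.1 - P n.1.1, hmem n.1 n.2⟩
  refine ⟨range t, mk_range_le, fun φ hφ => ?_⟩
  ext e
  obtain ⟨he1, he2⟩ := (hN.mem_increment hM).1 e.2
  have hcl : e ∈ closure (range t) := by
    rw [Metric.mem_closure_iff]
    intro ε hε
    obtain ⟨_, ⟨n, hn, rfl⟩, hd⟩ := Metric.mem_closure_iff.1 he1 (ε / 2) (half_pos hε)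
    refine ⟨t ⟨n, hn⟩, ⟨_, rfl⟩, ?_⟩
    -- `P n` is small because `n - e` differs from it by an element of `W_M^⊥`
    have hsm : ‖P n.1‖ ≤ ‖n.1 - e‖ := by
      have := hM.norm_le_add hs (hP n.1) (z := n.1 - P n.1 - e) (fun a ha => by
        rw [map_sub, hPz n.1 a ha, he2 a ha, sub_zero])
      rwa [show P n.1 + (n.1 - P n.1 - e) = n.1 - e by abel] at this
    rw [dist_eq_norm] at hd
    have hd' : ‖n.1 - (e : E)‖ < ε / 2 := by rwa [norm_sub_rev] at hd
    rw [dist_eq_norm, Submodule.coe_norm]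
    calc ‖(e : E) - (n.1 - P n.1)‖ = ‖((e : E) - n.1) + P n.1‖ := by congr 1; abel
      _ ≤ ‖(e : E) - n.1‖ + ‖P n.1‖ := norm_add_le _ _
      _ < ε := by linarith
  have hc : IsClosed {y : hN.increment hM | φ y = 0} :=
    isClosed_eq φ.continuous continuous_const
  exact closure_minimal (by rintro _ ⟨n, rfl⟩; exact hφ _ ⟨n, rfl⟩) hc hcl

/-- The norms of the restrictions of a functional to the increments of a well-ordered chain form a
`c₀` family: otherwise they would be bounded below along a strictly increasing sequence, but the
functional agrees on the union of the corresponding good sets with a limit of functionals each of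
which annihilates almost all of the increments. -/
theorem finite_setOf_increment (hE : IsReflexiveSpace E) (hs : IsSupportMap s)
    (hs' : IsDualSupportMap s') {I : Type*} [LinearOrder I] [WellFoundedLT I]
    {M N : I → Set (E × StrongDual ℝ E)} (hM : ∀ i, IsGood s s' (M i))
    (hN : ∀ i, IsGood s s' (N i)) (hNM : ∀ i j, i < j → N i ⊆ M j) (hMN : ∀ i, M i ⊆ N i)
    (φ : StrongDual ℝ E) {ε : ℝ} (hε : 0 < ε) :
    {i | ∃ e ∈ (hN i).increment (hM i), ‖e‖ ≤ 1 ∧ ε < |φ e|}.Finite := by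
  by_contra hinf
  have := (show Set.Infinite _ from hinf).to_subtype
  let f := Infinite.natEmbedding {i | ∃ e ∈ (hN i).increment (hM i), ‖e‖ ≤ 1 ∧ ε < |φ e|}
  obtain ⟨g, hg | hg⟩ := exists_increasing_or_nonincreasing_subseq (· < ·) (fun n => (f n : I))
  swap
  -- well-foundedness excludes strictly decreasing sequences
  · have hanti : ∀ m n, m < n → (f (g n) : I) < f (g m) := by
      intro m n hmn
      refine lt_of_le_of_ne (not_lt.1 (hg m n hmn)) fun h => ?_
      exact hmn.ne' (g.injective (f.injective (Subtype.ext h)))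
    exact not_strictAnti_of_wellFoundedLT (fun n => (f (g n) : I)) fun m n h => hanti m n h
  let k : ℕ → I := fun n => f (g n)
  have hk : ∀ m n, m < n → k m < k n := hg
  have hk' : ∀ m n, m ≤ n → N (k m) ⊆ N (k n) := by
    intro m n hmn
    rcases hmn.eq_or_lt with rfl | h
    · exact le_rfl
    · exact (hNM _ _ (hk m n h)).trans (hMN _)
  have hU : IsGood s s' (⋃ n, N (k n)) := by
    refine ⟨mem_iUnion.2 ⟨0, (hN _).zero⟩, fun a ha b hb => ?_, fun q a ha => ?_, fun a ha => ?_⟩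
    · obtain ⟨m, hm⟩ := mem_iUnion.1 ha
      obtain ⟨n, hn⟩ := mem_iUnion.1 hb
      exact mem_iUnion.2 ⟨max m n, (hN _).add a (hk' _ _ (le_max_left m n) hm) b
        (hk' _ _ (le_max_right m n) hn)⟩
    · obtain ⟨m, hm⟩ := mem_iUnion.1 ha
      exact mem_iUnion.2 ⟨m, (hN _).smul q a hm⟩
    · obtain ⟨m, hm⟩ := mem_iUnion.1 ha
      exact mem_iUnion.2 ⟨m, (hN _).support a hm⟩
  obtain ⟨w, hw, hφw⟩ := hU.exists_dual_decomposition hE hs hs' φ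
  obtain ⟨_, ⟨a, ha, rfl⟩, hd⟩ := Metric.mem_closure_iff.1 hw ε hε
  obtain ⟨m, hm⟩ := mem_iUnion.1 ha
  obtain ⟨e, he, hen, heφ⟩ := (f (g (m + 1))).2
  obtain ⟨he1, he2⟩ := ((hN _).mem_increment (hM _)).1 he
  have h1 : a.2 e = 0 := he2 a (hNM _ _ (hk m (m + 1) m.lt_succ_self) hm)
  have h2 : φ e = w e := hφw e ((hN _).space_mono hU (subset_iUnion (fun n => N (k n)) (m + 1)) he1)
  have h3 : |φ e| ≤ ‖w - a.2‖ * ‖e‖ := by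
    have := (w - a.2).le_opNorm e
    rwa [sub_apply, h1, sub_zero, ← h2] at this
  rw [dist_eq_norm] at hd
  have h4 : ‖w - a.2‖ * ‖e‖ ≤ ‖w - a.2‖ := mul_le_of_le_one_right (norm_nonneg _) hen
  linarith

/-- The inductive step: `c₀` families in the increments of a well-ordered chain of good sets
together form a `c₀` family. -/
theorem exists_isC0Family_of_wellOrder (hE : IsReflexiveSpace E) {I : Type u} [LinearOrder I]
    [WellFoundedLT I] (b : I → E) (htot : IsTotal (range b))
    (ih : ∀ V : Submodule ℝ E, IsClosed (V : Set E) → ∀ i : I,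
      (∃ T : Set V, #T ≤ max ℵ₀ #(Iic i) ∧ IsTotal T) →
        ∃ (Γ : Type u) (x : Γ → V), IsC0Family x) :
    ∃ (Γ : Type u) (x : Γ → E), IsC0Family x := by
  obtain ⟨s, hs⟩ := exists_isSupportMap (E := E)
  obtain ⟨s', hs'⟩ := hE.exists_isDualSupportMap
  let M : I → Set (E × StrongDual ℝ E) := fun i => goodClosure s s' (b '' Iio i)
  let N : I → Set (E × StrongDual ℝ E) := fun i => goodClosure s s' (b '' Iic i)
  have hM : ∀ i, IsGood s s' (M i) := fun i => isGood_goodClosure _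
  have hN : ∀ i, IsGood s s' (N i) := fun i => isGood_goodClosure _
  have hMN : ∀ i, M i ⊆ N i := fun i => goodClosure_mono (image_mono Iio_subset_Iic_self)
  have hNM : ∀ i j, i < j → N i ⊆ M j := fun i j hij =>
    goodClosure_mono (image_mono fun k hk => lt_of_le_of_lt hk hij)
  have hfam : ∀ i, ∃ (Γ : Type u) (x : Γ → (hN i).increment (hM i)), IsC0Family x := by
    intro i
    refine ih _ ((hN i).isClosed_increment (hM i)) i ?_
    obtain ⟨T, hT, hT'⟩ := (hN i).exists_total_increment hE hs hs' (hM i) (hMN i)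
    exact ⟨T, hT.trans (mk_goodClosure_le _ (le_max_left _ _)
      (mk_image_le.trans (le_max_right _ _))), hT'⟩
  choose Γ x hx using hfam
  refine ⟨Σ i, Γ i, fun p => (x p.1 p.2 : E), fun p => (hx p.1).norm_le p.2, ?_, ?_⟩
  · intro φ hφ
    have h1 : ∀ i, ∀ e ∈ (hN i).increment (hM i), φ e = 0 := by
      intro i e he
      have h := (hx i).total (φ.comp ((hN i).increment (hM i)).subtypeL) (by
        rintro _ ⟨γ, rfl⟩
        exact hφ _ ⟨⟨i, γ⟩, rfl⟩)
      exact DFunLike.congr_fun h ⟨e, he⟩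
    -- vanishing on the increments spreads along the chain by transfinite induction
    have h2 : ∀ i, ∀ a ∈ N i, φ a.1 = 0 := by
      intro i
      induction i using WellFoundedLT.induction with
      | ind i hi =>
        intro a ha
        obtain ⟨v, hv, -, hz⟩ := (hM i).exists_decomposition hE hs hs' a.1
        have h3 : φ (a.1 - v) = 0 := h1 i _ (((hN i).mem_increment (hM i)).2
          ⟨Submodule.sub_mem _ ((hN i).fst_mem_space ha)
            ((hM i).space_mono (hN i) (hMN i) hv), hz⟩)
        have h4 : φ v = 0 := by
          have hc : IsClosed {y : E | φ y = 0} := isClosed_eq φ.continuous continuous_const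
          refine closure_minimal ?_ hc hv
          rintro _ ⟨c, hc, rfl⟩
          rcases exists_of_mem_goodClosure_Iio hs hs' b i hc with rfl | ⟨j, hj, hc⟩
          · exact map_zero φ
          · exact hi j hj c hc
        rw [map_sub, h4, sub_zero] at h3
        exact h3
    refine htot φ ?_
    rintro _ ⟨i, rfl⟩
    exact h2 i _ (subset_goodClosure ⟨i, mem_Iic.2 le_rfl, rfl⟩)
  · intro φ ε hε
    have hfin := finite_setOf_increment hE hs hs' hM hN hNM hMN φ hε
    refine (hfin.biUnion fun i _ => ((hx i).finite (φ.comp ((hN i).increment (hM i)).subtypeL)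
      ε hε).image (Sigma.mk i)).subset ?_
    rintro ⟨i, γ⟩ h
    exact mem_biUnion (show i ∈ _ from ⟨x i γ, (x i γ).2, (hx i).norm_le γ, h⟩) ⟨γ, h, rfl⟩

end Increments

section Existence

open Cardinal

/-- The theorem of Lindenstrauss: the dual of a reflexive space embeds injectively into some
`c₀(Γ)`. Induction on the cardinality of a total set. -/
theorem exists_isC0Family_of_isTotal (c : Cardinal.{u}) :
    ∀ (E : Type u) [NormedAddCommGroup E] [NormedSpace ℝ E] [CompleteSpace E],
      IsReflexiveSpace E → ∀ S : Set E, #S ≤ c → IsTotal S →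
        ∃ (Γ : Type u) (x : Γ → E), IsC0Family x := by
  induction c using WellFoundedLT.induction with
  | ind c ih =>
    intro E _ _ _ hE S hS htot
    by_cases hcount : #S ≤ ℵ₀
    · exact exists_isC0Family_of_countable (le_aleph0_iff_set_countable.1 hcount) htot
    have hunc : ℵ₀ < #S := not_le.1 hcount
    let I := (#S).ord.ToType
    obtain ⟨e⟩ : Nonempty (I ≃ S) := Cardinal.eq.1 (mk_ord_toType #S)
    refine exists_isC0Family_of_wellOrder hE (I := I) (fun i => (e i : E)) ?_ ?_
    · intro φ hφ
      exact htot φ fun y hy => hφ y ⟨e.symm ⟨y, hy⟩, by simp⟩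
    · rintro V hV i ⟨T, hT, hT'⟩
      have : CompleteSpace V := hV.completeSpace_coe
      have h1 : #(Iio i) < #S := by simpa [I] using mk_Iio_lt i
      have h2 : #(Iic i) < #S := by
        rw [← Iio_insert]
        exact mk_insert_le.trans_lt (add_lt_of_lt hunc.le h1 (one_lt_aleph0.trans hunc))
      exact ih _ ((max_lt hunc h2).trans_le hS) V (hE.submodule V hV) T hT hT'

theorem IsReflexiveSpace.exists_isC0Family {E : Type u} [NormedAddCommGroup E] [NormedSpace ℝ E]
    [CompleteSpace E] (hE : IsReflexiveSpace E) : ∃ (Γ : Type u) (x : Γ → E), IsC0Family x :=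
  exists_isC0Family_of_isTotal #(univ : Set E) E hE univ le_rfl fun φ hφ => by
    ext x
    exact hφ x (mem_univ x)

end Existence

/-! ### The cost of approximation from `ℓ₁(Γ)` -/

theorem exists_tendsto_of_abs_le {ι : Type*} (U : Ultrafilter ι) (f : ι → ℝ) {R : ℝ}
    (hf : ∀ᶠ i in (U : Filter ι), |f i| ≤ R) : ∃ l, Tendsto f U (𝓝 l) := by
  obtain ⟨l, -, hl⟩ := (isCompact_Icc (a := -R) (b := R)).ultrafilter_le_nhds (U.map f) (by
    rw [le_principal_iff]
    exact hf.mono fun i hi => abs_le.1 hi)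
  exact ⟨l, hl⟩

section Cost

variable {E : Type*} [NormedAddCommGroup E] [NormedSpace ℝ E] {Γ : Type*}

/-- The operator `ℓ₁(Γ) → E` sending the unit vectors to a given family. -/
noncomputable def synthesis (x : Γ → E) (y : Γ → ℝ) : E := ∑' γ, y γ • x γ

theorem Summable.sq_of_summable {y : Γ → ℝ} (hy : Summable y) : Summable fun γ => y γ ^ 2 := by
  have h : ∀ᶠ γ in cofinite, |y γ| < 1 := by
    have := hy.abs.tendsto_cofinite_zero
    exact this.eventually (gt_mem_nhds one_pos)
  refine hy.abs.of_norm_bounded_eventually ?_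
  filter_upwards [h] with γ hγ
  rw [norm_pow, Real.norm_eq_abs, pow_two]
  exact mul_le_of_le_one_left (abs_nonneg _) hγ.le

variable {x : Γ → E}

theorem summable_smul [CompleteSpace E] (hx : ∀ γ, ‖x γ‖ ≤ 1) {y : Γ → ℝ} (hy : Summable y) :
    Summable fun γ => y γ • x γ := by
  refine Summable.of_norm_bounded hy.abs fun γ => ?_
  rw [norm_smul]
  exact mul_le_of_le_one_right (abs_nonneg _) (hx γ)

theorem norm_synthesis_le (hx : ∀ γ, ‖x γ‖ ≤ 1) {y : Γ → ℝ} (hy : Summable y) :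
    ‖synthesis x y‖ ≤ ∑' γ, |y γ| :=
  tsum_of_norm_bounded hy.abs.hasSum fun γ => by
    rw [norm_smul]
    exact mul_le_of_le_one_right (abs_nonneg _) (hx γ)

theorem synthesis_combo [CompleteSpace E] (hx : ∀ γ, ‖x γ‖ ≤ 1) {y z : Γ → ℝ} (hy : Summable y)
    (hz : Summable z) (a b : ℝ) :
    synthesis x (a • y + b • z) = a • synthesis x y + b • synthesis x z := by
  have h1 := (summable_smul hx hy).hasSum.const_smul a
  have h2 := (summable_smul hx hz).hasSum.const_smul b
  rw [synthesis, synthesis, synthesis, ← (h1.add h2).tsum_eq]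
  congr 1
  ext γ
  simp [add_smul, mul_smul]

theorem hasSum_map_synthesis [CompleteSpace E] (hx : ∀ γ, ‖x γ‖ ≤ 1) {y : Γ → ℝ}
    (hy : Summable y) (φ : StrongDual ℝ E) :
    HasSum (fun γ => y γ * φ (x γ)) (φ (synthesis x y)) := by
  have := φ.hasSum (summable_smul hx hy).hasSum
  simp only [map_smul, smul_eq_mul] at this
  exact this

/-- The price of representing `u` by `y ∈ ℓ₁(Γ)`: the squared error plus a multiple of the squared
locally uniformly rotund norm `(‖y‖₁² + ‖y‖₂²)^(1/2)` of `ℓ₁(Γ)`. -/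
noncomputable def cost (x : Γ → E) (k : ℕ) (u : E) (y : Γ → ℝ) : ℝ :=
  ‖u - synthesis x y‖ ^ 2 + ((k : ℝ) + 1)⁻¹ * ((∑' γ, |y γ|) ^ 2 + ∑' γ, y γ ^ 2)

theorem cost_nonneg (k : ℕ) (u : E) (y : Γ → ℝ) : 0 ≤ cost x k u y := by
  have : 0 ≤ ∑' γ, y γ ^ 2 := tsum_nonneg fun γ => sq_nonneg _
  unfold cost
  positivity

theorem cost_zero (k : ℕ) (u : E) : cost x k u 0 = ‖u‖ ^ 2 := by
  simp [cost, synthesis]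

theorem cost_neg (k : ℕ) (u : E) (y : Γ → ℝ) : cost x k (-u) (-y) = cost x k u y := by
  have : synthesis x (-y) = -synthesis x y := by
    simp [synthesis, tsum_neg]
  have h2 : ‖-u - -synthesis x y‖ = ‖u - synthesis x y‖ := by
    rw [← norm_neg]
    congr 1
    abel
  simp only [cost, this, h2, Pi.neg_apply, abs_neg, neg_sq]

/-- Joint convexity of the price, with the gain coming from each of its three terms. -/
theorem cost_combo_le [CompleteSpace E] (hx : ∀ γ, ‖x γ‖ ≤ 1) (k : ℕ) {a b : ℝ} (ha : 0 ≤ a)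
    (hb : 0 ≤ b) (hab : a + b = 1) (u v : E) {y z : Γ → ℝ} (hy : Summable y) (hz : Summable z) :
    cost x k (a • u + b • v) (a • y + b • z) + a * b *
      ((‖u - synthesis x y‖ - ‖v - synthesis x z‖) ^ 2 + ((k : ℝ) + 1)⁻¹ *
        ((∑' γ, |y γ| - ∑' γ, |z γ|) ^ 2 + ∑' γ, (y γ - z γ) ^ 2))
      ≤ a * cost x k u y + b * cost x k v z := by
  obtain rfl : b = 1 - a := by linarith
  have key : ∀ p q : ℝ, (a * p + (1 - a) * q) ^ 2 + a * (1 - a) * (p - q) ^ 2 =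
      a * p ^ 2 + (1 - a) * q ^ 2 := fun p q => by ring
  have h1 : ‖(a • u + (1 - a) • v) - synthesis x (a • y + (1 - a) • z)‖ ≤
      a * ‖u - synthesis x y‖ + (1 - a) * ‖v - synthesis x z‖ := by
    rw [synthesis_combo hx hy hz]
    calc _ = ‖a • (u - synthesis x y) + (1 - a) • (v - synthesis x z)‖ := by
          congr 1
          module
      _ ≤ _ := by
          refine (norm_add_le _ _).trans (le_of_eq ?_)
          rw [norm_smul, norm_smul, Real.norm_of_nonneg ha, Real.norm_of_nonneg hb]
  have h2 : ∑' γ, |(a • y + (1 - a) • z) γ| ≤ a * ∑' γ, |y γ| + (1 - a) * ∑' γ, |z γ| := by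
    rw [← tsum_mul_left, ← tsum_mul_left,
      ← (hy.abs.mul_left a).tsum_add (hz.abs.mul_left (1 - a))]
    refine Summable.tsum_le_tsum (fun γ => ?_) ((hy.const_smul a).add (hz.const_smul (1 - a))).abs
      ((hy.abs.mul_left a).add (hz.abs.mul_left (1 - a)))
    simp only [Pi.add_apply, Pi.smul_apply, smul_eq_mul]
    refine (abs_add_le _ _).trans (le_of_eq ?_)
    rw [abs_mul, abs_mul, abs_of_nonneg ha, abs_of_nonneg hb]
  have h3 : ∑' γ, (a • y + (1 - a) • z) γ ^ 2 + a * (1 - a) * ∑' γ, (y γ - z γ) ^ 2 =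
      a * ∑' γ, y γ ^ 2 + (1 - a) * ∑' γ, z γ ^ 2 := by
    have s1 := Summable.sq_of_summable ((hy.const_smul a).add (hz.const_smul (1 - a)))
    have s2 := (Summable.sq_of_summable (hy.sub hz)).mul_left (a * (1 - a))
    have s3 := (Summable.sq_of_summable hy).mul_left a
    have s4 := (Summable.sq_of_summable hz).mul_left (1 - a)
    rw [← tsum_mul_left, ← tsum_mul_left, ← tsum_mul_left, ← s3.tsum_add s4]
    have := s1.tsum_add s2
    simp only [Pi.add_apply, Pi.smul_apply, smul_eq_mul] at this ⊢
    rw [← this]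
    congr 1
    ext γ
    exact key _ _
  have hk : 0 ≤ ((k : ℝ) + 1)⁻¹ := by positivity
  have e1 := pow_le_pow_left₀ (norm_nonneg _) h1 2
  have e2 := pow_le_pow_left₀ (tsum_nonneg fun γ => abs_nonneg _) h2 2
  have k1 := key ‖u - synthesis x y‖ ‖v - synthesis x z‖
  have k2 := key (∑' γ, |y γ|) (∑' γ, |z γ|)
  have e3 : (∑' γ, |(a • y + (1 - a) • z) γ|) ^ 2 + ∑' γ, (a • y + (1 - a) • z) γ ^ 2 +
      a * (1 - a) * ((∑' γ, |y γ| - ∑' γ, |z γ|) ^ 2 + ∑' γ, (y γ - z γ) ^ 2) ≤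
      a * ((∑' γ, |y γ|) ^ 2 + ∑' γ, y γ ^ 2) +
        (1 - a) * ((∑' γ, |z γ|) ^ 2 + ∑' γ, z γ ^ 2) := by
    linarith
  have e4 := mul_le_mul_of_nonneg_left e3 hk
  unfold cost
  linarith

/-- The least price is attained: minimizing sequences in `ℓ₁(Γ)` converge pointwise along an
ultrafilter, and the operator `ℓ₁(Γ) → E` is continuous from the weak* to the weak topology because
the family is `c₀`. -/
theorem exists_cost_minimizer [CompleteSpace E] (hx : IsC0Family x) (k : ℕ) (u : E) :
    ∃ y : Γ → ℝ, Summable y ∧ ∀ z : Γ → ℝ, Summable z → cost x k u y ≤ cost x k u z := by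
  let S := {y : Γ → ℝ // Summable y}
  let c : S → ℝ := fun y => cost x k u y.1
  have hne : (⨅ z : S, 𝓟 {y | c y ≤ c z}).NeBot := by
    have : Nonempty S := ⟨⟨0, summable_zero⟩⟩
    refine iInf_neBot_of_directed' ?_ fun y => principal_neBot_iff.2 ⟨y, le_refl (c y)⟩
    intro y z
    rcases le_total (c y) (c z) with h | h
    · exact ⟨y, le_rfl, principal_mono.2 fun w hw => le_trans hw h⟩
    · exact ⟨z, principal_mono.2 fun w hw => le_trans hw h, le_rfl⟩
  let U := Ultrafilter.of (⨅ z : S, 𝓟 {y | c y ≤ c z})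
  have hU : ∀ z, ∀ᶠ y in (U : Filter S), c y ≤ c z := fun z =>
    (Ultrafilter.of_le _).trans (iInf_le _ z) (mem_principal_self _)
  have hU0 : ∀ᶠ y in (U : Filter S), c y ≤ ‖u‖ ^ 2 := by
    have := hU ⟨0, summable_zero⟩
    simpa only [c, cost_zero] using this
  set κ : ℝ := ((k : ℝ) + 1)⁻¹ with hκ
  have hκ0 : 0 < κ := by positivity
  have hsq : ∀ y : S, 0 ≤ ∑' γ, y.1 γ ^ 2 := fun y => tsum_nonneg fun γ => sq_nonneg _
  have hl1 : ∀ y : S, 0 ≤ ∑' γ, |y.1 γ| := fun y => tsum_nonneg fun γ => abs_nonneg _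
  have hc : ∀ y : S, c y = ‖u - synthesis x y.1‖ ^ 2 +
      κ * ((∑' γ, |y.1 γ|) ^ 2 + ∑' γ, y.1 γ ^ 2) := fun y => rfl
  -- bounds for the three terms, and their limits along the ultrafilter
  have hb1 : ∀ᶠ y in (U : Filter S), |‖u - synthesis x y.1‖| ≤ ‖u‖ := by
    filter_upwards [hU0] with y hy
    rw [abs_of_nonneg (norm_nonneg _)]
    refine le_of_sq_le_sq ?_ (norm_nonneg u)
    have := mul_nonneg hκ0.le (add_nonneg (sq_nonneg (∑' γ, |y.1 γ|)) (hsq y))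
    rw [hc] at hy
    linarith
  have hb23 : ∀ᶠ y in (U : Filter S), (∑' γ, |y.1 γ|) ^ 2 + ∑' γ, y.1 γ ^ 2 ≤ κ⁻¹ * ‖u‖ ^ 2 := by
    filter_upwards [hU0] with y hy
    rw [le_inv_mul_iff₀ hκ0]
    rw [hc] at hy
    linarith [sq_nonneg ‖u - synthesis x y.1‖]
  set R : ℝ := Real.sqrt (κ⁻¹ * ‖u‖ ^ 2) with hR
  have hb2 : ∀ᶠ y in (U : Filter S), ∑' γ, |y.1 γ| ≤ R := by
    filter_upwards [hb23] with y hy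
    exact Real.le_sqrt_of_sq_le (by linarith [hsq y])
  obtain ⟨α, hα⟩ := exists_tendsto_of_abs_le U (fun y : S => ‖u - synthesis x y.1‖) hb1
  obtain ⟨β, hβ⟩ := exists_tendsto_of_abs_le U (fun y : S => ∑' γ, |y.1 γ|) (R := R) (by
    filter_upwards [hb2] with y hy
    rwa [abs_of_nonneg (hl1 y)])
  obtain ⟨δ, hδ⟩ := exists_tendsto_of_abs_le U (fun y : S => ∑' γ, y.1 γ ^ 2)
    (R := κ⁻¹ * ‖u‖ ^ 2) (by
    filter_upwards [hb23] with y hy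
    rw [abs_of_nonneg (hsq y)]
    linarith [sq_nonneg (∑' γ, |y.1 γ|)])
  have hcoord : ∀ γ, ∃ l, Tendsto (fun y : S => y.1 γ) U (𝓝 l) := fun γ =>
    exists_tendsto_of_abs_le U _ (R := R) (by
      filter_upwards [hb2] with y hy
      exact (y.2.abs.le_tsum γ fun _ _ => abs_nonneg _).trans hy)
  choose y hy using hcoord
  have hβR : β ≤ R := le_of_tendsto hβ hb2
  have hfin1 : ∀ A : Finset Γ, ∑ γ ∈ A, |y γ| ≤ β := fun A =>
    le_of_tendsto_of_tendsto (tendsto_finsetSum A fun γ _ => (hy γ).abs) hβ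
      (Eventually.of_forall fun z => z.2.abs.sum_le_tsum A fun _ _ => abs_nonneg _)
  have hfin2 : ∀ A : Finset Γ, ∑ γ ∈ A, y γ ^ 2 ≤ δ := fun A =>
    le_of_tendsto_of_tendsto (tendsto_finsetSum A fun γ _ => (hy γ).pow 2) hδ
      (Eventually.of_forall fun z =>
        (Summable.sq_of_summable z.2).sum_le_tsum A fun _ _ => sq_nonneg _)
  have hyabs : Summable fun γ => |y γ| :=
    summable_of_sum_le (fun γ => abs_nonneg _) hfin1
  have hys : Summable y := hyabs.of_abs
  have hy1 : ∑' γ, |y γ| ≤ β := hyabs.tsum_le_of_sum_le hfin1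
  have hy2 : ∑' γ, y γ ^ 2 ≤ δ := (Summable.sq_of_summable hys).tsum_le_of_sum_le hfin2
  have hweak : ∀ φ : StrongDual ℝ E,
      Tendsto (fun z : S => φ (synthesis x z.1)) U (𝓝 (φ (synthesis x y))) := by
    intro φ
    rw [Metric.tendsto_nhds]
    intro ε hε
    have hR0 : 0 ≤ R := Real.sqrt_nonneg _
    set τ : ℝ := ε / (2 * (2 * R + 1)) with hτ
    have hτ0 : 0 < τ := by positivity
    let A : Finset Γ := (hx.finite φ τ hτ0).toFinset
    have hA : ∀ γ, γ ∉ A → |φ (x γ)| ≤ τ := fun γ hγ => by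
      simpa [A] using hγ
    have hlim : Tendsto (fun z : S => ∑ γ ∈ A, |z.1 γ - y γ| * |φ (x γ)|) U (𝓝 0) := by
      have : Tendsto (fun z : S => ∑ γ ∈ A, |z.1 γ - y γ| * |φ (x γ)|) U
          (𝓝 (∑ γ ∈ A, |y γ - y γ| * |φ (x γ)|)) :=
        tendsto_finsetSum A fun γ _ => (((hy γ).sub_const (y γ)).abs).mul_const _
      simpa using this
    filter_upwards [hb2, hlim.eventually (gt_mem_nhds (half_pos hε))] with z hz hz'
    have hsub : Summable fun γ => z.1 γ - y γ := z.2.sub hys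
    have h1 := (hasSum_map_synthesis hx.norm_le z.2 φ).sub (hasSum_map_synthesis hx.norm_le hys φ)
    have hsum1 : ∑' γ, |z.1 γ - y γ| ≤ 2 * R := by
      calc ∑' γ, |z.1 γ - y γ| ≤ ∑' γ, (|z.1 γ| + |y γ|) :=
            Summable.tsum_le_tsum (fun γ => abs_sub _ _) hsub.abs (z.2.abs.add hyabs)
        _ = ∑' γ, |z.1 γ| + ∑' γ, |y γ| := z.2.abs.tsum_add hyabs
        _ ≤ 2 * R := by linarith
    -- off the finite set `A` the coefficients `φ (x γ)` are small
    have hbound : ∀ γ, ‖z.1 γ * φ (x γ) - y γ * φ (x γ)‖ ≤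
        (A : Set Γ).indicator (fun γ => |z.1 γ - y γ| * |φ (x γ)|) γ + τ * |z.1 γ - y γ| := by
      intro γ
      rw [← sub_mul, norm_mul, Real.norm_eq_abs, Real.norm_eq_abs]
      by_cases hγ : γ ∈ A
      · rw [indicator_of_mem (by exact_mod_cast hγ)]
        have := mul_nonneg hτ0.le (abs_nonneg (z.1 γ - y γ))
        linarith
      · rw [indicator_of_notMem (by exact_mod_cast hγ), zero_add, mul_comm]
        exact mul_le_mul_of_nonneg_right (hA γ hγ) (abs_nonneg _)
    have hind : HasSum ((A : Set Γ).indicator (fun γ => |z.1 γ - y γ| * |φ (x γ)|))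
        (∑ γ ∈ A, |z.1 γ - y γ| * |φ (x γ)|) := by
      rw [← hasSum_subtype_iff_indicator]
      exact A.hasSum _
    have h2 := tsum_of_norm_bounded (hind.add (hsub.abs.hasSum.mul_left τ)) hbound
    rw [h1.tsum_eq] at h2
    rw [Real.dist_eq, ← Real.norm_eq_abs]
    refine lt_of_le_of_lt h2 ?_
    have h3 : τ * ∑' γ, |z.1 γ - y γ| ≤ τ * (2 * R) := mul_le_mul_of_nonneg_left hsum1 hτ0.le
    have h4 : τ * (2 * R + 1) = ε / 2 := by
      rw [hτ]
      field_simp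
    linarith
  have hα' : ‖u - synthesis x y‖ ≤ α := by
    obtain ⟨φ, hφ1, hφ2⟩ := norm_eq_of_support (u - synthesis x y)
    rw [← hφ2]
    have h1 : Tendsto (fun z : S => φ (u - synthesis x z.1)) U (𝓝 (φ (u - synthesis x y))) := by
      simp only [map_sub]
      exact (hweak φ).const_sub _
    refine le_of_tendsto_of_tendsto h1 hα (Eventually.of_forall fun z => ?_)
    exact ((le_abs_self _).trans (φ.le_opNorm _)).trans
      (mul_le_of_le_one_left (norm_nonneg _) hφ1)
  have hlimc : Tendsto c U (𝓝 (α ^ 2 + κ * (β ^ 2 + δ))) :=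
    (hα.pow 2).add (((hβ.pow 2).add hδ).const_mul κ)
  refine ⟨y, hys, fun z hz => ?_⟩
  have h1 : α ^ 2 + κ * (β ^ 2 + δ) ≤ cost x k u z := le_of_tendsto hlimc (hU ⟨z, hz⟩)
  refine le_trans ?_ h1
  have e1 := pow_le_pow_left₀ (norm_nonneg _) hα' 2
  have e2 := pow_le_pow_left₀ (tsum_nonneg fun γ => abs_nonneg _) hy1 2
  have e3 := mul_le_mul_of_nonneg_left (add_le_add e2 hy2) hκ0.le
  exact add_le_add e1 e3

end Cost

/-! ### A locally uniformly convex function -/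

section LURFunction

variable {E : Type*} [NormedAddCommGroup E] [NormedSpace ℝ E] {Γ : Type*} {x : Γ → E}

/-- The least price of representing `u`. -/
noncomputable def minCost (x : Γ → E) (k : ℕ) (u : E) : ℝ := sInf (cost x k u '' {y | Summable y})

theorem minCost_le (k : ℕ) (u : E) {y : Γ → ℝ} (hy : Summable y) :
    minCost x k u ≤ cost x k u y :=
  csInf_le ⟨0, by rintro _ ⟨z, -, rfl⟩; exact cost_nonneg k u z⟩ ⟨y, hy, rfl⟩

theorem minCost_nonneg (k : ℕ) (u : E) : 0 ≤ minCost x k u :=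
  Real.sInf_nonneg (by rintro _ ⟨z, -, rfl⟩; exact cost_nonneg k u z)

theorem minCost_le_sq (k : ℕ) (u : E) : minCost x k u ≤ ‖u‖ ^ 2 :=
  (minCost_le k u summable_zero).trans (cost_zero k u).le

theorem summable_combo {y z : Γ → ℝ} (hy : Summable y) (hz : Summable z) (a b : ℝ) :
    Summable (a • y + b • z) :=
  (hy.const_smul a).add (hz.const_smul b)

/-- The range of `ℓ₁(Γ) → E` is dense. -/
theorem IsC0Family.exists_synthesis_near (hx : IsC0Family x) (u : E) {ε : ℝ} (hε : 0 < ε) :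
    ∃ y : Γ → ℝ, Summable y ∧ ‖u - synthesis x y‖ < ε := by
  have hmem : u ∈ closure (Submodule.span ℝ (range x) : Set E) := by
    by_contra hn
    let V := (Submodule.span ℝ (range x)).topologicalClosure
    obtain ⟨φ, s, hφ, hs⟩ := geometric_hahn_banach_closed_point V.convex
      (Submodule.isClosed_topologicalClosure _) hn
    have h0 : ∀ v ∈ V, φ v = 0 := by
      intro v hv
      by_contra hne
      have h1 := hφ _ (V.smul_mem ((s + 1) / φ v) hv)
      rw [map_smul, smul_eq_mul, div_mul_cancel₀ _ hne] at h1
      linarith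
    have hφ0 : φ = 0 := hx.total φ fun y hy =>
      h0 y (subset_closure (Submodule.subset_span hy))
    have h2 := hφ 0 V.zero_mem
    rw [hφ0] at hs h2
    simp only [zero_apply] at hs h2
    linarith
  obtain ⟨v, hv, hd⟩ := Metric.mem_closure_iff.1 hmem ε hε
  obtain ⟨c, rfl⟩ := (Finsupp.mem_span_range_iff_exists_finsupp).1 hv
  refine ⟨c, summable_of_hasFiniteSupport c.hasFiniteSupport, ?_⟩
  have : synthesis x c = c.sum fun i a => a • x i := by
    rw [synthesis, Finsupp.sum]
    refine tsum_eq_sum fun γ hγ => ?_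
    rw [Finsupp.notMem_support_iff.1 hγ, zero_smul]
  rwa [this, ← dist_eq_norm]

/-- The norm `(‖y‖₁² + ‖y‖₂²)^(1/2)` of `ℓ₁(Γ)` is locally uniformly rotund: convergence in `ℓ₂`
together with convergence of the `ℓ₁` norms implies convergence in `ℓ₁`. -/
theorem exists_l1_near {y : Γ → ℝ} (hy : Summable y) {ε : ℝ} (hε : 0 < ε) :
    ∃ τ > (0 : ℝ), ∀ z : Γ → ℝ, Summable z → abs (∑' γ, |y γ| - ∑' γ, |z γ|) ≤ τ →
      ∑' γ, (y γ - z γ) ^ 2 ≤ τ ^ 2 → ∑' γ, |y γ - z γ| ≤ ε := by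
  obtain ⟨A, hA⟩ := ((hy.abs.hasSum).eventually (lt_mem_nhds
    (show ∑' γ, |y γ| - ε / 4 < ∑' γ, |y γ| by linarith))).exists
  have hpos : 0 < 4 * (2 * (A.card : ℝ) + 1) := by positivity
  refine ⟨ε / (4 * (2 * (A.card : ℝ) + 1)), div_pos hε hpos, fun z hz h1 h2 => ?_⟩
  set τ := ε / (4 * (2 * (A.card : ℝ) + 1)) with hτ
  have hτ0 : 0 < τ := div_pos hε hpos
  have hτε : τ * (2 * A.card + 1) = ε / 4 := by
    rw [hτ]
    field_simp
  have hsub : Summable fun γ => y γ - z γ := hy.sub hz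
  have hcoord : ∀ γ, |y γ - z γ| ≤ τ := fun γ => by
    refine abs_le_of_sq_le_sq ?_ hτ0.le
    exact ((Summable.sq_of_summable hsub).le_tsum γ fun _ _ => sq_nonneg _).trans h2
  have hAs : ∑ γ ∈ A, |y γ - z γ| ≤ A.card * τ := by
    have := A.sum_le_card_nsmul (fun γ => |y γ - z γ|) τ fun γ _ => hcoord γ
    rwa [nsmul_eq_mul] at this
  have hAz : ∑ γ ∈ A, |y γ| ≤ ∑ γ ∈ A, |z γ| + A.card * τ := by
    refine le_trans ?_ (add_le_add le_rfl hAs)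
    rw [← Finset.sum_add_distrib]
    refine Finset.sum_le_sum fun γ _ => ?_
    have := abs_add_le (z γ) (y γ - z γ)
    rwa [add_sub_cancel] at this
  have e1 := hsub.abs.sum_add_tsum_compl (s := A)
  have e2 := hy.abs.sum_add_tsum_compl (s := A)
  have e3 := hz.abs.sum_add_tsum_compl (s := A)
  have hrest : ∑' γ : ((A : Set Γ)ᶜ : Set Γ), |y γ - z γ| ≤
      ∑' γ : ((A : Set Γ)ᶜ : Set Γ), |y γ| + ∑' γ : ((A : Set Γ)ᶜ : Set Γ), |z γ| := by
    have sy := hy.abs.subtype ((A : Set Γ)ᶜ)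
    have sz := hz.abs.subtype ((A : Set Γ)ᶜ)
    exact (Summable.tsum_le_tsum (fun γ => abs_sub _ _) (hsub.abs.subtype _) (sy.add sz)).trans
      (sy.tsum_add sz).le
  have h1' := (abs_le.1 h1).1
  linarith

/-- The sum of the least prices with geometric weights. -/
noncomputable def lurFun (x : Γ → E) (u : E) : ℝ := ∑' k : ℕ, (1 / 2 : ℝ) ^ (k + 1) * minCost x k u

theorem hasSum_half_pow_succ : HasSum (fun k : ℕ => (1 / 2 : ℝ) ^ (k + 1)) 1 := by
  have := (hasSum_geometric_two).mul_left (1 / 2 : ℝ)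
  simp only [← pow_succ'] at this
  norm_num at this ⊢
  exact this

theorem summable_lurFun (u : E) : Summable fun k : ℕ => (1 / 2 : ℝ) ^ (k + 1) * minCost x k u :=
  Summable.of_nonneg_of_le (fun k => mul_nonneg (by positivity) (minCost_nonneg k u))
    (fun k => mul_le_mul_of_nonneg_left (minCost_le_sq k u) (by positivity))
    (hasSum_half_pow_succ.summable.mul_right (‖u‖ ^ 2))

theorem lurFun_le_sq (u : E) : lurFun x u ≤ ‖u‖ ^ 2 := by
  have h := hasSum_half_pow_succ.mul_right (‖u‖ ^ 2)
  rw [one_mul] at h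
  exact hasSum_le (fun k => mul_le_mul_of_nonneg_left (minCost_le_sq k u) (by positivity))
    (summable_lurFun u).hasSum h

theorem IsC0Family.exists_minCost_lt (hx : IsC0Family x) (u : E) {ε : ℝ} (hε : 0 < ε) :
    ∃ k, minCost x k u < ε := by
  -- the approximation is chosen before `k`, so its price tends to the squared error
  obtain ⟨y, hy, h⟩ := hx.exists_synthesis_near u (Real.sqrt_pos.2 (half_pos hε))
  have h1 : ‖u - synthesis x y‖ ^ 2 < ε / 2 := by
    have := pow_lt_pow_left₀ h (norm_nonneg _) two_ne_zero
    rwa [Real.sq_sqrt (half_pos hε).le] at this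
  have hlim : Tendsto (fun k : ℕ => ((k : ℝ) + 1)⁻¹ * ((∑' γ, |y γ|) ^ 2 + ∑' γ, y γ ^ 2)) atTop
      (𝓝 0) := by
    have := (tendsto_one_div_add_atTop_nhds_zero_nat (𝕜 := ℝ)).mul_const
      ((∑' γ, |y γ|) ^ 2 + ∑' γ, y γ ^ 2)
    simpa using this
  obtain ⟨k, hk⟩ := (hlim.eventually (gt_mem_nhds (half_pos hε))).exists
  refine ⟨k, (minCost_le k u hy).trans_lt ?_⟩
  unfold cost
  linarith

variable [CompleteSpace E]

theorem IsC0Family.exists_minCost_eq (hx : IsC0Family x) (k : ℕ) (u : E) :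
    ∃ y : Γ → ℝ, Summable y ∧ minCost x k u = cost x k u y := by
  obtain ⟨y, hy, hmin⟩ := exists_cost_minimizer hx k u
  refine ⟨y, hy, le_antisymm (minCost_le k u hy) (le_csInf ⟨_, y, hy, rfl⟩ ?_)⟩
  rintro _ ⟨z, hz, rfl⟩
  exact hmin z hz

theorem IsC0Family.minCost_neg_le (hx : IsC0Family x) (k : ℕ) (u : E) :
    minCost x k (-u) ≤ minCost x k u := by
  obtain ⟨y, hy, h⟩ := hx.exists_minCost_eq k u
  rw [h, ← cost_neg]
  exact minCost_le k _ hy.neg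

theorem IsC0Family.minCost_neg (hx : IsC0Family x) (k : ℕ) (u : E) :
    minCost x k (-u) = minCost x k u :=
  le_antisymm (hx.minCost_neg_le k u) (by simpa using hx.minCost_neg_le k (-u))

theorem IsC0Family.convexOn_minCost (hx : IsC0Family x) (k : ℕ) :
    ConvexOn ℝ univ (minCost x k) := by
  refine ⟨convex_univ, fun u _ v _ a b ha hb hab => ?_⟩
  obtain ⟨y, hy, h1⟩ := hx.exists_minCost_eq k u
  obtain ⟨z, hz, h2⟩ := hx.exists_minCost_eq k v
  rw [h1, h2]
  refine (minCost_le k _ (summable_combo hy hz a b)).trans ?_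
  have := cost_combo_le hx.norm_le k ha hb hab u v hy hz
  refine le_trans ?_ this
  have h3 : 0 ≤ ∑' γ, (y γ - z γ) ^ 2 := tsum_nonneg fun γ => sq_nonneg _
  have : 0 ≤ a * b * ((‖u - synthesis x y‖ - ‖v - synthesis x z‖) ^ 2 + ((k : ℝ) + 1)⁻¹ *
        ((∑' γ, |y γ| - ∑' γ, |z γ|) ^ 2 + ∑' γ, (y γ - z γ) ^ 2)) := by positivity
  linarith

theorem IsC0Family.sq_le_minCost_zero (hx : IsC0Family x) (u : E) :
    ‖u‖ ^ 2 / 2 ≤ minCost x 0 u := by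
  obtain ⟨y, hy, h⟩ := hx.exists_minCost_eq 0 u
  rw [h, cost]
  have h1 : ‖u‖ ≤ ‖u - synthesis x y‖ + ∑' γ, |y γ| := by
    have := norm_add_le (u - synthesis x y) (synthesis x y)
    rw [sub_add_cancel] at this
    exact this.trans (add_le_add le_rfl (norm_synthesis_le hx.norm_le hy))
  have h2 : 0 ≤ ∑' γ, y γ ^ 2 := tsum_nonneg fun γ => sq_nonneg _
  have h3 := pow_le_pow_left₀ (norm_nonneg u) h1 2
  simp only [CharP.cast_eq_zero, zero_add, inv_one, one_mul]
  nlinarith [sq_nonneg (‖u - synthesis x y‖ - ∑' γ, |y γ|)]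

theorem IsC0Family.sq_le_lurFun (hx : IsC0Family x) (u : E) : ‖u‖ ^ 2 / 4 ≤ lurFun x u := by
  have h1 := (summable_lurFun (x := x) u).le_tsum 0 fun k _ =>
    mul_nonneg (by positivity) (minCost_nonneg k u)
  have h2 := hx.sq_le_minCost_zero u
  norm_num at h1
  unfold lurFun
  norm_num
  linarith

theorem IsC0Family.lurFun_neg (hx : IsC0Family x) (u : E) : lurFun x (-u) = lurFun x u := by
  simp only [lurFun, hx.minCost_neg]

/-- The convexity gain of `lurFun` controls that of each of its summands. -/
theorem IsC0Family.lurFun_combo_le (hx : IsC0Family x) (k : ℕ) {a b : ℝ} (ha : 0 ≤ a) (hb : 0 ≤ b)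
    (hab : a + b = 1) (u v : E) :
    lurFun x (a • u + b • v) + (1 / 2 : ℝ) ^ (k + 1) *
      (a * minCost x k u + b * minCost x k v - minCost x k (a • u + b • v)) ≤
      a * lurFun x u + b * lurFun x v := by
  have s := ((summable_lurFun (x := x) u).mul_left a).add ((summable_lurFun (x := x) v).mul_left b)
  have s' := s.sub (summable_lurFun (x := x) (a • u + b • v))
  have h := s'.le_tsum k fun j _ => by
    have := (hx.convexOn_minCost j).2 (mem_univ u) (mem_univ v) ha hb hab
    simp only [smul_eq_mul] at this
    have h2 : 0 ≤ (1 / 2 : ℝ) ^ (j + 1) := by positivity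
    nlinarith
  rw [s.tsum_sub (summable_lurFun _), ((summable_lurFun u).mul_left a).tsum_add
    ((summable_lurFun v).mul_left b), tsum_mul_left, tsum_mul_left] at h
  change _ ≤ a * lurFun x u + b * lurFun x v - lurFun x (a • u + b • v) at h
  linarith

theorem IsC0Family.convexOn_lurFun (hx : IsC0Family x) : ConvexOn ℝ univ (lurFun x) := by
  refine ⟨convex_univ, fun u _ v _ a b ha hb hab => ?_⟩
  have h1 := hx.lurFun_combo_le 0 ha hb hab u v
  have h2 := (hx.convexOn_minCost 0).2 (mem_univ u) (mem_univ v) ha hb hab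
  simp only [smul_eq_mul] at h2 ⊢
  norm_num at h1
  linarith

/-- `lurFun` is locally uniformly convex: choose `k` so that `u` is represented at a low cost.
A small convexity gain at the midpoint of `u` and `v` forces their optimal representations to be
close in `ℓ₁(Γ)`, and the errors to be equally small. -/
theorem IsC0Family.exists_lurFun_near (hx : IsC0Family x) (u : E) {ε : ℝ} (hε : 0 < ε) :
    ∃ η > 0, ∀ v, (lurFun x u + lurFun x v) / 2 - lurFun x ((1 / 2 : ℝ) • u + (1 / 2 : ℝ) • v) ≤ η →
      ‖v - u‖ ≤ ε := by
  obtain ⟨k, hk⟩ := hx.exists_minCost_lt u (ε := (ε / 4) ^ 2) (by positivity)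
  obtain ⟨y, hy, hyc⟩ := hx.exists_minCost_eq k u
  obtain ⟨τ', hτ', hτy⟩ := exists_l1_near hy (ε := ε / 4) (by positivity)
  set τ := min τ' (ε / 4) with hτ
  have hτ0 : 0 < τ := lt_min hτ' (by positivity)
  set κ : ℝ := ((k : ℝ) + 1)⁻¹ with hκ
  have hκ0 : 0 < κ := by positivity
  have hκ1 : κ ≤ 1 := inv_le_one_of_one_le₀ (by linarith [(Nat.cast_nonneg k : (0 : ℝ) ≤ k)])
  have hw : (0 : ℝ) < (1 / 2) ^ (k + 1) := by positivity
  refine ⟨(1 / 2) ^ (k + 1) * (κ * τ ^ 2 / 4), by positivity, fun v hv => ?_⟩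
  obtain ⟨z, hz, hzc⟩ := hx.exists_minCost_eq k v
  have h1 := hx.lurFun_combo_le k (a := 1 / 2) (b := 1 / 2) (by norm_num) (by norm_num)
    (by norm_num) u v
  have h2 : 1 / 2 * minCost x k u + 1 / 2 * minCost x k v -
      minCost x k ((1 / 2 : ℝ) • u + (1 / 2 : ℝ) • v) ≤ κ * τ ^ 2 / 4 := by
    refine le_of_mul_le_mul_left ?_ hw
    linarith
  have h3 := cost_combo_le hx.norm_le k (a := 1 / 2) (b := 1 / 2) (by norm_num) (by norm_num)
    (by norm_num) u v hy hz
  have h4 := minCost_le (x := x) k ((1 / 2 : ℝ) • u + (1 / 2 : ℝ) • v)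
    (summable_combo hy hz (1 / 2) (1 / 2))
  have hS : 0 ≤ ∑' γ, (y γ - z γ) ^ 2 := tsum_nonneg fun γ => sq_nonneg _
  have h5 : (‖u - synthesis x y‖ - ‖v - synthesis x z‖) ^ 2 + κ *
      ((∑' γ, |y γ| - ∑' γ, |z γ|) ^ 2 + ∑' γ, (y γ - z γ) ^ 2) ≤ κ * τ ^ 2 := by
    rw [← hyc, ← hzc] at h3
    linarith
  have h6 : (∑' γ, |y γ| - ∑' γ, |z γ|) ^ 2 + ∑' γ, (y γ - z γ) ^ 2 ≤ τ ^ 2 := by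
    refine le_of_mul_le_mul_left ?_ hκ0
    linarith [sq_nonneg (‖u - synthesis x y‖ - ‖v - synthesis x z‖)]
  have h7 : (‖u - synthesis x y‖ - ‖v - synthesis x z‖) ^ 2 ≤ τ ^ 2 := by
    have : 0 ≤ κ * ((∑' γ, |y γ| - ∑' γ, |z γ|) ^ 2 + ∑' γ, (y γ - z γ) ^ 2) := by positivity
    have : κ * τ ^ 2 ≤ τ ^ 2 := mul_le_of_le_one_left (sq_nonneg _) hκ1
    linarith
  have hττ : τ ≤ τ' := min_le_left _ _
  have h8 : ∑' γ, |y γ - z γ| ≤ ε / 4 := by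
    refine hτy z hz ((abs_le_of_sq_le_sq (by linarith) hτ0.le).trans hττ) ?_
    have := pow_le_pow_left₀ hτ0.le hττ 2
    linarith [sq_nonneg (∑' γ, |y γ| - ∑' γ, |z γ|)]
  have h9 : ‖v - synthesis x z‖ ≤ ‖u - synthesis x y‖ + ε / 4 := by
    have := (abs_le.1 (abs_le_of_sq_le_sq h7 hτ0.le)).1
    have : τ ≤ ε / 4 := min_le_right _ _
    linarith
  have h10 : ‖u - synthesis x y‖ ≤ ε / 4 := by
    refine le_of_sq_le_sq ?_ (by positivity)
    rw [hyc, cost] at hk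
    have : 0 ≤ ∑' γ, y γ ^ 2 := tsum_nonneg fun γ => sq_nonneg _
    have : 0 ≤ ((k : ℝ) + 1)⁻¹ * ((∑' γ, |y γ|) ^ 2 + ∑' γ, y γ ^ 2) := by positivity
    linarith
  have h11 : ‖synthesis x z - synthesis x y‖ ≤ ε / 4 := by
    have e := synthesis_combo hx.norm_le hy hz 1 (-1)
    have e2 : synthesis x z - synthesis x y = -synthesis x ((1 : ℝ) • y + (-1 : ℝ) • z) := by
      rw [e]
      module
    rw [e2, norm_neg]
    refine (norm_synthesis_le hx.norm_le (summable_combo hy hz _ _)).trans ?_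
    simpa [sub_eq_add_neg] using h8
  calc ‖v - u‖ = ‖(v - synthesis x z) + (synthesis x z - synthesis x y) -
        (u - synthesis x y)‖ := by congr 1; abel
    _ ≤ ‖v - synthesis x z‖ + ‖synthesis x z - synthesis x y‖ + ‖u - synthesis x y‖ :=
        (norm_sub_le _ _).trans (add_le_add (norm_add_le _ _) le_rfl)
    _ ≤ ε := by linarith

end LURFunction

/-! ### Conjugates and a smooth function on the dual -/

section Smooth

variable {E : Type*} [NormedAddCommGroup E]

/-- Second-order differences are `o(‖h‖)`. For continuous convex functions this is Fréchet
differentiability everywhere, in a form that does not mention the derivative. -/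
def SecondDiffSmooth (f : E → ℝ) : Prop :=
  ∀ a, ∀ ε > (0 : ℝ), ∃ δ > (0 : ℝ), ∀ h : E, ‖h‖ < δ → f (a + h) + f (a - h) - 2 * f a ≤ ε * ‖h‖

theorem SecondDiffSmooth.add {f g : E → ℝ} (hf : SecondDiffSmooth f) (hg : SecondDiffSmooth g) :
    SecondDiffSmooth fun a => f a + g a := by
  intro a ε hε
  obtain ⟨δ, hδ, h1⟩ := hf a (ε / 2) (half_pos hε)
  obtain ⟨δ', hδ', h2⟩ := hg a (ε / 2) (half_pos hε)
  refine ⟨min δ δ', lt_min hδ hδ', fun h hh => ?_⟩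
  have := h1 h (hh.trans_le (min_le_left _ _))
  have := h2 h (hh.trans_le (min_le_right _ _))
  linarith

theorem SecondDiffSmooth.const_mul {f : E → ℝ} (hf : SecondDiffSmooth f) {c : ℝ} (hc : 0 ≤ c) :
    SecondDiffSmooth fun a => c * f a := by
  intro a ε hε
  obtain ⟨δ, hδ, h1⟩ := hf a (ε / (c + 1)) (by positivity)
  refine ⟨δ, hδ, fun h hh => ?_⟩
  have h2 := mul_le_mul_of_nonneg_left (h1 h hh) hc
  have h3 : c * (ε / (c + 1) * ‖h‖) ≤ ε * ‖h‖ := by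
    rw [← mul_assoc]
    refine mul_le_mul_of_nonneg_right ?_ (norm_nonneg h)
    rw [mul_div_assoc', div_le_iff₀ (by positivity)]
    nlinarith
  linarith

/-- Smoothness passes to a function touched from above, at each point, by a smooth function. -/
theorem SecondDiffSmooth.of_touching {f : E → ℝ}
    (h : ∀ a, ∃ (g : E → ℝ) (b : E),
      SecondDiffSmooth g ∧ (∀ h, f (a + h) ≤ g (b + h)) ∧ f a = g b) :
    SecondDiffSmooth f := by
  intro a ε hε
  obtain ⟨g, b, hg, hle, heq⟩ := h a
  obtain ⟨δ, hδ, h1⟩ := hg b ε hε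
  refine ⟨δ, hδ, fun h hh => ?_⟩
  have h2 := hle h
  have h3 := hle (-h)
  simp only [← sub_eq_add_neg] at h3
  have := h1 h hh
  linarith

end Smooth

section Conjugate

variable {E : Type*} [NormedAddCommGroup E] [NormedSpace ℝ E]

/-- The Fenchel conjugate. -/
noncomputable def conjugate (G : E → ℝ) (φ : StrongDual ℝ E) : ℝ := sSup (range fun u => φ u - G u)

/-- Functions sharing the growth of `lurFun`: convex, continuous, with quadratic growth. -/
structure QuadraticGrowth (G : E → ℝ) : Prop where
  convex : ConvexOn ℝ univ G
  continuous : Continuous G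
  lower : ∀ u, ‖u‖ ^ 2 / 4 ≤ G u
  upper : ∀ u, G u ≤ ‖u‖ ^ 2

variable {G : E → ℝ}

theorem QuadraticGrowth.apply_sub_le (hG : QuadraticGrowth G) (φ : StrongDual ℝ E) (u : E) :
    φ u - G u ≤ ‖φ‖ ^ 2 := by
  have h1 := hG.lower u
  have h2 := (le_abs_self _).trans (φ.le_opNorm u)
  nlinarith [sq_nonneg (‖u‖ / 2 - ‖φ‖)]

theorem QuadraticGrowth.le_conjugate (hG : QuadraticGrowth G) (φ : StrongDual ℝ E) (u : E) :
    φ u - G u ≤ conjugate G φ :=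
  le_csSup ⟨‖φ‖ ^ 2, by rintro _ ⟨v, rfl⟩; exact hG.apply_sub_le φ v⟩ ⟨u, rfl⟩

theorem QuadraticGrowth.conjugate_le (hG : QuadraticGrowth G) (φ : StrongDual ℝ E) :
    conjugate G φ ≤ ‖φ‖ ^ 2 :=
  csSup_le (range_nonempty _) (by rintro _ ⟨v, rfl⟩; exact hG.apply_sub_le φ v)

theorem QuadraticGrowth.exists_conjugate_eq (hE : IsReflexiveSpace E) (hG : QuadraticGrowth G)
    (φ : StrongDual ℝ E) : ∃ u, conjugate G φ = φ u - G u := by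
  have hconv : ConvexOn ℝ univ fun u => G u - φ u :=
    hG.convex.sub ((φ : E →ₗ[ℝ] ℝ).concaveOn convex_univ)
  obtain ⟨u, hu⟩ := hE.exists_forall_le hconv (hG.continuous.sub φ.continuous) (by
    intro C
    refine (Metric.isBounded_closedBall (x := (0 : E)) (r := 4 * ‖φ‖ + 4 * |C| + 1)).subset ?_
    intro u hu
    rw [mem_closedBall_zero_iff]
    have h1 := hG.lower u
    have h2 := (le_abs_self _).trans (φ.le_opNorm u)
    have h3 : G u - φ u ≤ C := hu
    have h4 := le_abs_self C
    by_contra hn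
    push Not at hn
    have h5 : 0 ≤ ‖φ‖ := norm_nonneg φ
    have h6 : 0 ≤ |C| := abs_nonneg C
    nlinarith)
  refine ⟨u, le_antisymm (csSup_le (range_nonempty _) ?_) (hG.le_conjugate φ u)⟩
  rintro _ ⟨v, rfl⟩
  have := hu v
  simp only
  linarith

theorem QuadraticGrowth.sq_le_conjugate (hE : IsReflexiveSpace E) (hG : QuadraticGrowth G)
    (φ : StrongDual ℝ E) : ‖φ‖ ^ 2 / 4 ≤ conjugate G φ := by
  obtain ⟨x, hx1, hx2⟩ := hE.exists_norm_attaining φ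
  have h1 := hG.le_conjugate φ ((‖φ‖ / 2) • x)
  have h2 := hG.upper ((‖φ‖ / 2) • x)
  have h3 : ‖(‖φ‖ / 2) • x‖ ^ 2 ≤ (‖φ‖ / 2) ^ 2 := by
    rw [norm_smul, Real.norm_of_nonneg (by positivity), mul_pow]
    exact mul_le_of_le_one_right (by positivity) (pow_le_one₀ (norm_nonneg x) hx1)
  rw [map_smul, hx2, smul_eq_mul] at h1
  nlinarith

theorem QuadraticGrowth.convexOn_conjugate (hG : QuadraticGrowth G) :
    ConvexOn ℝ univ (conjugate G) := by
  refine ⟨convex_univ, fun φ _ ψ _ a b ha hb hab => csSup_le (range_nonempty _) ?_⟩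
  rintro _ ⟨u, rfl⟩
  have h1 := mul_le_mul_of_nonneg_left (hG.le_conjugate φ u) ha
  have h2 := mul_le_mul_of_nonneg_left (hG.le_conjugate ψ u) hb
  have h3 : G u = a * G u + b * G u := by rw [← add_mul, hab, one_mul]
  simp only [add_apply, smul_apply, smul_eq_mul]
  linarith

theorem QuadraticGrowth.conjugate_quadraticGrowth (hE : IsReflexiveSpace E)
    (hG : QuadraticGrowth G) : QuadraticGrowth (conjugate G) where
  convex := hG.convexOn_conjugate
  continuous := continuous_of_convexOn_of_le hG.convexOn_conjugate (C := 1) fun φ => by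
    linarith [hG.conjugate_le φ]
  lower := hG.sq_le_conjugate hE
  upper := hG.conjugate_le

theorem conjugate_neg (hG : ∀ u, G (-u) = G u) (φ : StrongDual ℝ E) :
    conjugate G (-φ) = conjugate G φ := by
  unfold conjugate
  congr 1
  ext c
  constructor <;>
  · rintro ⟨u, rfl⟩
    exact ⟨-u, by simp [hG]⟩

/-- The conjugate of a locally uniformly convex function is smooth: the maximizers of `φ - G` depend
continuously on `φ`. -/
theorem QuadraticGrowth.secondDiffSmooth_conjugate (hE : IsReflexiveSpace E)
    (hG : QuadraticGrowth G)
    (hlur : ∀ u, ∀ ε > 0, ∃ η > 0, ∀ v,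
      (G u + G v) / 2 - G ((1 / 2 : ℝ) • u + (1 / 2 : ℝ) • v) ≤ η → ‖v - u‖ ≤ ε) :
    SecondDiffSmooth (conjugate G) := by
  intro φ ε hε
  obtain ⟨x, hx⟩ := hG.exists_conjugate_eq hE φ
  obtain ⟨η, hη, hnear⟩ := hlur x (ε / 2) (half_pos hε)
  -- the maximizers at points near `φ` are bounded by `R`
  set R : ℝ := 4 * (‖φ‖ + 1) + ‖x‖ with hR
  have hRpos : 0 < R := by positivity
  refine ⟨min 1 (η / R), lt_min one_pos (by positivity), ?_⟩
  have hmax : ∀ h : StrongDual ℝ E, ‖h‖ < min 1 (η / R) → ∀ u,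
      conjugate G (φ + h) = (φ + h) u - G u → ‖u - x‖ ≤ ε / 2 := by
    intro h hh u hu
    have hh1 : ‖h‖ ≤ 1 := (hh.trans_le (min_le_left _ _)).le
    have hh2 : ‖h‖ * R ≤ η := by
      rw [← le_div_iff₀ hRpos]
      exact (hh.trans_le (min_le_right _ _)).le
    have hub : ‖u‖ ≤ 4 * (‖φ‖ + 1) := by
      have h1 := hG.lower u
      have h2 : (φ + h) u ≤ (‖φ‖ + 1) * ‖u‖ := (le_abs_self _).trans (((φ + h).le_opNorm u).trans
        (mul_le_mul_of_nonneg_right ((norm_add_le _ _).trans (by linarith)) (norm_nonneg u)))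
      have h3 : 0 ≤ conjugate G (φ + h) :=
        (by positivity : (0 : ℝ) ≤ ‖φ + h‖ ^ 2 / 4).trans (hG.sq_le_conjugate hE _)
      by_contra hn
      push Not at hn
      nlinarith [norm_nonneg φ]
    have h1 := hG.le_conjugate (φ + h) x
    have h2 := hG.le_conjugate φ ((1 / 2 : ℝ) • u + (1 / 2 : ℝ) • x)
    have h3 : h (u - x) ≤ ‖h‖ * R := by
      refine (le_abs_self _).trans ((h.le_opNorm _).trans
        (mul_le_mul_of_nonneg_left ?_ (norm_nonneg h)))
      exact (norm_sub_le _ _).trans (by linarith)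
    refine hnear u ?_
    rw [add_comm ((1 / 2 : ℝ) • x)]
    rw [hu] at h1
    rw [hx] at h2
    simp only [add_apply, map_add, map_sub, map_smul, smul_eq_mul] at h1 h2 h3
    linarith
  intro h hh
  obtain ⟨u, hu⟩ := hG.exists_conjugate_eq hE (φ + h)
  obtain ⟨v, hv⟩ := hG.exists_conjugate_eq hE (φ + -h)
  have h1 := hmax h hh u hu
  have h2 := hmax (-h) (by rwa [norm_neg]) v hv
  have h3 := hG.le_conjugate φ u
  have h4 := hG.le_conjugate φ v
  have h5 : h (u - v) ≤ ε * ‖h‖ := by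
    refine (le_abs_self _).trans ((h.le_opNorm _).trans ?_)
    rw [mul_comm]
    refine mul_le_mul_of_nonneg_right ?_ (norm_nonneg h)
    calc ‖u - v‖ = ‖(u - x) - (v - x)‖ := by congr 1; abel
      _ ≤ ‖u - x‖ + ‖v - x‖ := norm_sub_le _ _
      _ ≤ ε := by linarith
  rw [sub_eq_add_neg φ h, hu, hv]
  simp only [add_apply, neg_apply, map_sub] at h5 ⊢
  linarith

end Conjugate

/-- The dual of a reflexive space carries a smooth function of quadratic growth. -/
theorem IsReflexiveSpace.exists_smooth_dual {E : Type u} [NormedAddCommGroup E] [NormedSpace ℝ E]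
    [CompleteSpace E] (hE : IsReflexiveSpace E) :
    ∃ J : StrongDual ℝ E → ℝ, QuadraticGrowth J ∧ SecondDiffSmooth J ∧ ∀ φ, J (-φ) = J φ := by
  obtain ⟨Γ, x, hx⟩ := hE.exists_isC0Family
  have hG : QuadraticGrowth (lurFun x) :=
    { convex := hx.convexOn_lurFun
      continuous := continuous_of_convexOn_of_le hx.convexOn_lurFun (C := 1) fun u => by
        linarith [lurFun_le_sq (x := x) u]
      lower := hx.sq_le_lurFun
      upper := lurFun_le_sq }
  exact ⟨conjugate (lurFun x), hG.conjugate_quadraticGrowth hE,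
    hG.secondDiffSmooth_conjugate hE fun u ε hε => hx.exists_lurFun_near u hε,
    conjugate_neg hx.lurFun_neg⟩

/-! ### A strictly convex function on `c₀(Γ)` -/

section TopSum

variable {Γ : Type*}

/-- The supremum of the sums of `k` squares of terms of a bounded family. -/
noncomputable def topSum (k : ℕ) (a : Γ → ℝ) : ℝ :=
  sSup ((fun A : Finset Γ => ∑ γ ∈ A, a γ ^ 2) '' {A | A.card ≤ k})

theorem sum_sq_le {a : Γ → ℝ} {M : ℝ} (ha : ∀ γ, |a γ| ≤ M) {k : ℕ} {A : Finset Γ}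
    (hA : A.card ≤ k) : ∑ γ ∈ A, a γ ^ 2 ≤ k * M ^ 2 := by
  have h1 : ∀ γ ∈ A, a γ ^ 2 ≤ M ^ 2 := fun γ _ => by
    rw [← sq_abs]
    exact pow_le_pow_left₀ (abs_nonneg _) (ha γ) 2
  have h2 := A.sum_le_card_nsmul _ _ h1
  rw [nsmul_eq_mul] at h2
  exact h2.trans (mul_le_mul_of_nonneg_right (by exact_mod_cast hA) (sq_nonneg M))

theorem topSum_le_of_forall {k : ℕ} {a : Γ → ℝ} {c : ℝ}
    (h : ∀ A : Finset Γ, A.card ≤ k → ∑ γ ∈ A, a γ ^ 2 ≤ c) : topSum k a ≤ c :=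
  csSup_le ⟨_, ∅, by simp, rfl⟩ (by rintro _ ⟨A, hA, rfl⟩; exact h A hA)

theorem topSum_le {a : Γ → ℝ} {M : ℝ} (ha : ∀ γ, |a γ| ≤ M) (k : ℕ) : topSum k a ≤ k * M ^ 2 :=
  topSum_le_of_forall fun _ hA => sum_sq_le ha hA

theorem sum_le_topSum {a : Γ → ℝ} {M : ℝ} (ha : ∀ γ, |a γ| ≤ M) {k : ℕ} {A : Finset Γ}
    (hA : A.card ≤ k) : ∑ γ ∈ A, a γ ^ 2 ≤ topSum k a :=
  le_csSup ⟨k * M ^ 2, by rintro _ ⟨B, hB, rfl⟩; exact sum_sq_le ha hB⟩ ⟨A, hA, rfl⟩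

theorem topSum_nonneg (k : ℕ) (a : Γ → ℝ) : 0 ≤ topSum k a :=
  Real.sSup_nonneg (by rintro _ ⟨B, -, rfl⟩; exact Finset.sum_nonneg fun _ _ => sq_nonneg _)

/-- A pointwise inequality between squares is inherited by `topSum`. -/
theorem topSum_le_combo {a b c : Γ → ℝ} {M : ℝ} (ha : ∀ γ, |a γ| ≤ M) (hb : ∀ γ, |b γ| ≤ M)
    {s t : ℝ} (hs : 0 ≤ s) (ht : 0 ≤ t) (h : ∀ γ, c γ ^ 2 ≤ s * a γ ^ 2 + t * b γ ^ 2) (k : ℕ) :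
    topSum k c ≤ s * topSum k a + t * topSum k b := by
  refine topSum_le_of_forall fun A hA => ?_
  calc ∑ γ ∈ A, c γ ^ 2 ≤ ∑ γ ∈ A, (s * a γ ^ 2 + t * b γ ^ 2) := Finset.sum_le_sum fun γ _ => h γ
    _ = s * ∑ γ ∈ A, a γ ^ 2 + t * ∑ γ ∈ A, b γ ^ 2 := by
        rw [Finset.sum_add_distrib, Finset.mul_sum, Finset.mul_sum]
    _ ≤ _ := add_le_add (mul_le_mul_of_nonneg_left (sum_le_topSum ha hA) hs)
        (mul_le_mul_of_nonneg_left (sum_le_topSum hb hA) ht)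

/-- A set of largest terms maximizes the sum of squares among the sets of its cardinality; `j` more
terms contribute at most `j * m ^ 2`. -/
theorem sum_sq_le_of_largest {z : Γ → ℝ} {A B : Finset Γ} {m : ℝ} (hm : 0 ≤ m)
    (hA : ∀ γ ∈ A, m ≤ |z γ|) (hAc : ∀ γ, γ ∉ A → |z γ| ≤ m) {j : ℕ}
    (hB : B.card ≤ A.card + j) : ∑ γ ∈ B, z γ ^ 2 ≤ ∑ γ ∈ A, z γ ^ 2 + j * m ^ 2 := by
  classical
  have e1 := Finset.sum_inter_add_sum_sdiff B A fun γ => z γ ^ 2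
  have e2 := Finset.sum_inter_add_sum_sdiff A B fun γ => z γ ^ 2
  have c1 := Finset.card_inter_add_card_sdiff B A
  have c2 := Finset.card_inter_add_card_sdiff A B
  rw [Finset.inter_comm] at e2 c2
  have h1 : ∑ γ ∈ B \ A, z γ ^ 2 ≤ (B \ A).card * m ^ 2 := by
    have := (B \ A).sum_le_card_nsmul (fun γ => z γ ^ 2) (m ^ 2) fun γ hγ => by
      rw [← sq_abs]
      exact pow_le_pow_left₀ (abs_nonneg _) (hAc γ (Finset.mem_sdiff.1 hγ).2) 2
    rwa [nsmul_eq_mul] at this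
  have h2 : (A \ B).card * m ^ 2 ≤ ∑ γ ∈ A \ B, z γ ^ 2 := by
    have := (A \ B).card_nsmul_le_sum (fun γ => z γ ^ 2) (m ^ 2) fun γ hγ => by
      rw [← sq_abs (z γ)]
      exact pow_le_pow_left₀ hm (hA γ (Finset.mem_sdiff.1 hγ).1) 2
    rwa [nsmul_eq_mul] at this
  have h3 : ((B \ A).card : ℝ) ≤ (A \ B).card + j := by
    have : (B \ A).card ≤ (A \ B).card + j := by omega
    exact_mod_cast this
  have h4 := mul_le_mul_of_nonneg_right h3 (sq_nonneg m)
  linarith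

/-- Midpoint equality for all the functions `topSum k` forces equality: compare the largest terms
of the midpoint. -/
theorem eq_of_topSum_midpoint {a b : Γ → ℝ} {M : ℝ} (ha : ∀ γ, |a γ| ≤ M) (hb : ∀ γ, |b γ| ≤ M)
    (hfin : ∀ ε > 0, {γ | ε < |(a γ + b γ) / 2|}.Finite)
    (h : ∀ k, topSum k a + topSum k b ≤ 2 * topSum k fun γ => (a γ + b γ) / 2) : a = b := by
  classical
  set z : Γ → ℝ := fun γ => (a γ + b γ) / 2 with hz
  have hfin' : ∀ ε > 0, {γ | ε ≤ |z γ|}.Finite := fun ε hε =>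
    (hfin (ε / 2) (half_pos hε)).subset fun γ hγ =>
      lt_of_lt_of_le (half_lt_self hε) (show ε ≤ |z γ| from hγ)
  -- on the support of the midpoint, compare the sums over the largest terms
  have hsupp : ∀ γ, z γ ≠ 0 → a γ = b γ := by
    intro γ hγ
    let A := (hfin' |z γ| (abs_pos.2 hγ)).toFinset
    have hA : ∀ β, β ∈ A ↔ |z γ| ≤ |z β| := fun β => by simp [A]
    have h1 : topSum A.card z ≤ ∑ β ∈ A, z β ^ 2 := topSum_le_of_forall fun B hB => by
      have := sum_sq_le_of_largest (abs_nonneg (z γ)) (fun β hβ => (hA β).1 hβ)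
        (fun β hβ => (not_le.1 fun hle => hβ ((hA β).2 hle)).le) (j := 0) hB
      simpa using this
    have h2 := sum_le_topSum ha (le_refl A.card)
    have h3 := sum_le_topSum hb (le_refl A.card)
    have h4 := h A.card
    have h5 : ∑ β ∈ A, (a β - b β) ^ 2 + 4 * ∑ β ∈ A, z β ^ 2 =
        2 * (∑ β ∈ A, a β ^ 2 + ∑ β ∈ A, b β ^ 2) := by
      rw [Finset.mul_sum, ← Finset.sum_add_distrib, ← Finset.sum_add_distrib, Finset.mul_sum]
      refine Finset.sum_congr rfl fun β _ => ?_
      simp only [hz]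
      ring
    have h6 : ∑ β ∈ A, (a β - b β) ^ 2 ≤ 0 := by linarith
    have h7 := (Finset.single_le_sum (f := fun β => (a β - b β) ^ 2) (fun β _ => sq_nonneg _)
      ((hA γ).2 le_rfl)).trans h6
    exact sub_eq_zero.1 (pow_eq_zero_iff two_ne_zero |>.1 (le_antisymm h7 (sq_nonneg _)))
  ext γ
  by_cases hγ : z γ = 0
  swap
  · exact hsupp γ hγ
  by_contra hne
  -- off the support, adding `γ` to the set of terms at least `|a γ|` increases the sums for `a` and
  -- `b` more than any single term can increase the one for the midpoint
  have hba : b γ = -a γ := by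
    have : (a γ + b γ) / 2 = 0 := hγ
    linarith
  have hw : a γ ≠ 0 := fun h0 => hne (by rw [hba, h0, neg_zero])
  have hw' : 0 < |a γ| := abs_pos.2 hw
  let A := (hfin' |a γ| hw').toFinset
  have hA : ∀ β, β ∈ A ↔ |a γ| ≤ |z β| := fun β => by simp [A]
  have hγA : γ ∉ A := by
    rw [hA, hγ, abs_zero]
    exact not_le.2 hw'
  have hAab : ∀ β ∈ A, a β = z β ∧ b β = z β := by
    intro β hβ
    have hzβ : z β ≠ 0 := abs_pos.1 (hw'.trans_le ((hA β).1 hβ))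
    have := hsupp β hzβ
    simp only [hz]
    constructor <;> linarith
  -- off `A`, the midpoint is bounded by some `m < |a γ|`
  obtain ⟨m, hm0, hm1, hm⟩ : ∃ m, 0 ≤ m ∧ m < |a γ| ∧ ∀ β, β ∉ A → |z β| ≤ m := by
    let B := (hfin' (|a γ| / 2) (half_pos hw')).toFinset \ A
    have hBc : ∀ β, β ∉ A → β ∉ B → |z β| ≤ |a γ| / 2 := by
      intro β h1 h2
      by_contra h3
      exact h2 (Finset.mem_sdiff.2 ⟨by simpa using (not_le.1 h3).le, h1⟩)
    rcases B.eq_empty_or_nonempty with hB | hB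
    · refine ⟨|a γ| / 2, by positivity, half_lt_self hw', fun β hβ => hBc β hβ ?_⟩
      simp [hB]
    · obtain ⟨β₀, hβ₀, hmax⟩ := B.exists_max_image (fun β => |z β|) hB
      have hlt : |z β₀| < |a γ| :=
        not_le.1 fun hle => (Finset.mem_sdiff.1 hβ₀).2 ((hA β₀).2 hle)
      refine ⟨max (|z β₀|) (|a γ| / 2), by positivity, max_lt hlt (half_lt_self hw'), ?_⟩
      intro β hβ
      by_cases hβB : β ∈ B
      · exact (hmax β hβB).trans (le_max_left _ _)
      · exact (hBc β hβ hβB).trans (le_max_right _ _)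
  have h1 : topSum (A.card + 1) z ≤ ∑ β ∈ A, z β ^ 2 + m ^ 2 := topSum_le_of_forall fun B hB => by
    have := sum_sq_le_of_largest hm0 (fun β hβ => hm1.le.trans ((hA β).1 hβ)) hm (j := 1) hB
    simpa using this
  have hcard : (insert γ A).card ≤ A.card + 1 := Finset.card_insert_le γ A
  have h2 := sum_le_topSum ha hcard
  have h3 := sum_le_topSum hb hcard
  rw [Finset.sum_insert hγA] at h2 h3
  rw [Finset.sum_congr rfl fun β hβ => by rw [(hAab β hβ).1]] at h2
  rw [Finset.sum_congr rfl fun β hβ => by rw [(hAab β hβ).2], hba, neg_sq] at h3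
  have h4 := h (A.card + 1)
  have h5 : m ^ 2 < a γ ^ 2 := by
    rw [← sq_abs (a γ)]
    exact pow_lt_pow_left₀ hm1 hm0 two_ne_zero
  linarith

end TopSum

section DaySum

variable {Γ : Type*}

/-- A weighted sum of all the functions `topSum k`, a strictly convex function on `c₀(Γ)` in the
spirit of Day's norm. -/
noncomputable def daySum (a : Γ → ℝ) : ℝ :=
  ∑' k : ℕ, (1 / 2 : ℝ) ^ (k + 1) * (((k : ℝ) + 1)⁻¹ * topSum k a)

theorem inv_mul_topSum_le {a : Γ → ℝ} {M : ℝ} (ha : ∀ γ, |a γ| ≤ M) (k : ℕ) :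
    ((k : ℝ) + 1)⁻¹ * topSum k a ≤ M ^ 2 := by
  rw [inv_mul_le_iff₀ (by positivity)]
  refine (topSum_le ha k).trans (mul_le_mul_of_nonneg_right (by linarith) (sq_nonneg M))

theorem summable_daySum {a : Γ → ℝ} {M : ℝ} (ha : ∀ γ, |a γ| ≤ M) :
    Summable fun k : ℕ => (1 / 2 : ℝ) ^ (k + 1) * (((k : ℝ) + 1)⁻¹ * topSum k a) :=
  Summable.of_nonneg_of_le (fun k => by have := topSum_nonneg k a; positivity)
    (fun k => mul_le_mul_of_nonneg_left (inv_mul_topSum_le ha k) (by positivity))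
    (hasSum_half_pow_succ.summable.mul_right (M ^ 2))

theorem daySum_nonneg (a : Γ → ℝ) : 0 ≤ daySum a :=
  tsum_nonneg fun k => by have := topSum_nonneg k a; positivity

theorem daySum_le {a : Γ → ℝ} {M : ℝ} (ha : ∀ γ, |a γ| ≤ M) : daySum a ≤ M ^ 2 := by
  have h := hasSum_half_pow_succ.mul_right (M ^ 2)
  rw [one_mul] at h
  exact hasSum_le
    (fun k => mul_le_mul_of_nonneg_left (inv_mul_topSum_le ha k) (by positivity))
    (summable_daySum ha).hasSum h

theorem daySum_neg (a : Γ → ℝ) : daySum (-a) = daySum a := by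
  simp [daySum, topSum]

theorem daySum_le_combo {a b c : Γ → ℝ} {M : ℝ} (ha : ∀ γ, |a γ| ≤ M) (hb : ∀ γ, |b γ| ≤ M)
    (hcM : ∃ K, ∀ γ, |c γ| ≤ K)
    {s t : ℝ} (hs : 0 ≤ s) (ht : 0 ≤ t) (h : ∀ γ, c γ ^ 2 ≤ s * a γ ^ 2 + t * b γ ^ 2) :
    daySum c ≤ s * daySum a + t * daySum b := by
  obtain ⟨K, hc⟩ := hcM
  unfold daySum
  rw [← tsum_mul_left, ← tsum_mul_left,
    ← ((summable_daySum ha).mul_left s).tsum_add ((summable_daySum hb).mul_left t)]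
  refine Summable.tsum_le_tsum (fun k => ?_) (summable_daySum hc)
    (((summable_daySum ha).mul_left s).add ((summable_daySum hb).mul_left t))
  have h1 := topSum_le_combo ha hb hs ht h k
  have h2 : (0 : ℝ) ≤ (1 / 2 : ℝ) ^ (k + 1) * ((k : ℝ) + 1)⁻¹ := by positivity
  have h3 := mul_le_mul_of_nonneg_left h1 h2
  linarith

theorem eq_of_daySum_midpoint {a b : Γ → ℝ} {M : ℝ} (ha : ∀ γ, |a γ| ≤ M) (hb : ∀ γ, |b γ| ≤ M)
    (hfin : ∀ ε > 0, {γ | ε < |(a γ + b γ) / 2|}.Finite)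
    (h : daySum a + daySum b ≤ 2 * daySum fun γ => (a γ + b γ) / 2) : a = b := by
  have hc : ∀ γ, |(a γ + b γ) / 2| ≤ M := fun γ => by
    rw [abs_div, abs_two]
    linarith [abs_add_le (a γ) (b γ), ha γ, hb γ]
  have hle : ∀ k, 2 * topSum k (fun γ => (a γ + b γ) / 2) ≤ topSum k a + topSum k b := by
    intro k
    have := topSum_le_combo (c := fun γ => (a γ + b γ) / 2) ha hb (s := 1 / 2) (t := 1 / 2)
      (by norm_num) (by norm_num) (fun γ => by nlinarith [sq_nonneg (a γ - b γ)]) k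
    linarith
  refine eq_of_topSum_midpoint ha hb hfin fun k => ?_
  have s := ((summable_daySum ha).add (summable_daySum hb)).sub ((summable_daySum hc).mul_left 2)
  have h0 : ∀ j : ℕ, 0 ≤ (1 / 2 : ℝ) ^ (j + 1) * (((j : ℝ) + 1)⁻¹ * topSum j a) +
      (1 / 2 : ℝ) ^ (j + 1) * (((j : ℝ) + 1)⁻¹ * topSum j b) -
      2 * ((1 / 2 : ℝ) ^ (j + 1) * (((j : ℝ) + 1)⁻¹ * topSum j fun γ => (a γ + b γ) / 2)) := by
    intro j
    have h2 : (0 : ℝ) ≤ (1 / 2 : ℝ) ^ (j + 1) * ((j : ℝ) + 1)⁻¹ := by positivity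
    have h3 := mul_le_mul_of_nonneg_left (hle j) h2
    linarith
  have h1 := s.le_tsum k fun j _ => h0 j
  rw [((summable_daySum ha).add (summable_daySum hb)).tsum_sub ((summable_daySum hc).mul_left 2),
    (summable_daySum ha).tsum_add (summable_daySum hb), tsum_mul_left] at h1
  change _ ≤ daySum a + daySum b - 2 * daySum _ at h1
  have h2 : (0 : ℝ) < (1 / 2 : ℝ) ^ (k + 1) * ((k : ℝ) + 1)⁻¹ := by positivity
  refine le_of_mul_le_mul_left ?_ h2
  linarith

end DaySum

/-! ### Smoothing by infimal convolution -/

section SmoothSum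

variable {E : Type*} [NormedAddCommGroup E] [NormedSpace ℝ E]

theorem summable_half_pow_mul {g : ℕ → ℝ} {M : ℝ} (h0 : ∀ m, 0 ≤ g m) (hM : ∀ m, g m ≤ M) :
    Summable fun m : ℕ => (1 / 2 : ℝ) ^ (m + 1) * g m :=
  Summable.of_nonneg_of_le (fun m => mul_nonneg (by positivity) (h0 m))
    (fun m => mul_le_mul_of_nonneg_left (hM m) (by positivity))
    (hasSum_half_pow_succ.summable.mul_right M)

theorem tsum_half_pow_mul_le {g : ℕ → ℝ} {M : ℝ} (h0 : ∀ m, 0 ≤ g m) (hM : ∀ m, g m ≤ M) :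
    ∑' m : ℕ, (1 / 2 : ℝ) ^ (m + 1) * g m ≤ M := by
  have h := hasSum_half_pow_succ.mul_right M
  rw [one_mul] at h
  exact hasSum_le (fun m => mul_le_mul_of_nonneg_left (hM m) (by positivity))
    (summable_half_pow_mul h0 hM).hasSum h

/-- Second differences of a nonnegative convex function are at most linear in the increment. -/
theorem secondDiff_le {g : E → ℝ} (hg : ConvexOn ℝ univ g) (h0 : ∀ a, 0 ≤ g a)
    (hle : ∀ a, g a ≤ ‖a‖ ^ 2) (a : E) {h : E} (hh : ‖h‖ ≤ 1) :
    g (a + h) + g (a - h) - 2 * g a ≤ 2 * (‖a‖ + 1) ^ 2 * ‖h‖ := by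
  have key : ∀ h : E, ‖h‖ ≤ 1 → g (a + h) - g a ≤ (‖a‖ + 1) ^ 2 * ‖h‖ := by
    intro h hh
    by_cases hz : h = 0
    · simp [hz]
    have hn : ‖h‖ ≠ 0 := norm_ne_zero_iff.2 hz
    have h1 := hg.2 (mem_univ a) (mem_univ (a + ‖h‖⁻¹ • h)) (sub_nonneg.2 hh) (norm_nonneg h)
      (sub_add_cancel 1 ‖h‖)
    have h2 : (1 - ‖h‖) • a + ‖h‖ • (a + ‖h‖⁻¹ • h) = a + h := by
      rw [smul_add, smul_smul, mul_inv_cancel₀ hn, one_smul, ← add_assoc, ← add_smul,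
        sub_add_cancel, one_smul]
    have h3 : ‖a + ‖h‖⁻¹ • h‖ ≤ ‖a‖ + 1 := by
      refine (norm_add_le _ _).trans (add_le_add le_rfl ?_)
      rw [norm_smul, norm_inv, norm_norm, inv_mul_cancel₀ hn]
    have h4 := (hle (a + ‖h‖⁻¹ • h)).trans (pow_le_pow_left₀ (norm_nonneg _) h3 2)
    have h5 := mul_le_mul_of_nonneg_left h4 (norm_nonneg h)
    have h6 := mul_nonneg (norm_nonneg h) (h0 a)
    rw [h2, smul_eq_mul, smul_eq_mul] at h1
    linarith
  have h1 := key h hh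
  have h2 := key (-h) (by rwa [norm_neg])
  rw [norm_neg, ← sub_eq_add_neg] at h2
  linarith

/-- A geometrically weighted sum of convex smooth functions with a common bound is smooth: the tail
of the series is controlled by `secondDiff_le`. -/
theorem SecondDiffSmooth.tsum {g : ℕ → E → ℝ} (hg : ∀ m, ConvexOn ℝ univ (g m))
    (h0 : ∀ m a, 0 ≤ g m a) (hle : ∀ m a, g m a ≤ ‖a‖ ^ 2) (hs : ∀ m, SecondDiffSmooth (g m)) :
    SecondDiffSmooth fun a => ∑' m : ℕ, (1 / 2 : ℝ) ^ (m + 1) * g m a := by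
  intro a ε hε
  set K : ℝ := 2 * (‖a‖ + 1) ^ 2 with hK
  have hlim : Tendsto (fun n : ℕ => (1 / 2 : ℝ) ^ n * K) atTop (𝓝 0) := by
    simpa using (tendsto_pow_atTop_nhds_zero_of_lt_one (r := (1 / 2 : ℝ)) (by norm_num)
      (by norm_num)).mul_const K
  obtain ⟨N, hN⟩ := (hlim.eventually (gt_mem_nhds (half_pos hε))).exists
  choose δ hδ hd using fun m => hs m a (ε / 2) (half_pos hε)
  have hev : ∀ᶠ r : ℝ in 𝓝 0, ∀ m ∈ Finset.range N, r < δ m :=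
    (Finset.eventually_all _).2 fun m _ => gt_mem_nhds (hδ m)
  obtain ⟨ρ, hρ, hball⟩ := Metric.eventually_nhds_iff.1 hev
  refine ⟨min ρ 1, lt_min hρ one_pos, fun h hh => ?_⟩
  have hh1 : ‖h‖ ≤ 1 := (hh.trans_le (min_le_right _ _)).le
  have hhδ : ∀ m ∈ Finset.range N, ‖h‖ < δ m := hball (by
    rw [Real.dist_eq, sub_zero, abs_norm]
    exact hh.trans_le (min_le_left _ _))
  have s : ∀ b, Summable fun m : ℕ => (1 / 2 : ℝ) ^ (m + 1) * g m b := fun b =>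
    summable_half_pow_mul (fun m => h0 m b) fun m => hle m b
  let d : ℕ → ℝ := fun m => (1 / 2 : ℝ) ^ (m + 1) * (g m (a + h) + g m (a - h) - 2 * g m a)
  have hd' : HasSum d ((∑' m : ℕ, (1 / 2 : ℝ) ^ (m + 1) * g m (a + h)) +
      (∑' m : ℕ, (1 / 2 : ℝ) ^ (m + 1) * g m (a - h)) -
      2 * ∑' m : ℕ, (1 / 2 : ℝ) ^ (m + 1) * g m a) := by
    have := (((s (a + h)).hasSum.add (s (a - h)).hasSum).sub ((s a).hasSum.mul_left 2))
    refine this.congr_fun ?_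
    intro m
    simp only [d]
    ring
  rw [← hd'.tsum_eq, ← hd'.summable.sum_add_tsum_nat_add N]
  have h1 : ∑ m ∈ Finset.range N, d m ≤ ε / 2 * ‖h‖ := by
    calc ∑ m ∈ Finset.range N, d m
        ≤ ∑ m ∈ Finset.range N, (1 / 2 : ℝ) ^ (m + 1) * (ε / 2 * ‖h‖) :=
          Finset.sum_le_sum fun m hm =>
            mul_le_mul_of_nonneg_left (hd m h (hhδ m hm)) (by positivity)
      _ ≤ 1 * (ε / 2 * ‖h‖) := by
          rw [← Finset.sum_mul]
          refine mul_le_mul_of_nonneg_right ?_ (by positivity)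
          exact sum_le_hasSum _ (fun m _ => by positivity) hasSum_half_pow_succ
      _ = ε / 2 * ‖h‖ := one_mul _
  have h2 : ∑' m, d (m + N) ≤ (1 / 2 : ℝ) ^ N * K * ‖h‖ := by
    have e := hasSum_half_pow_succ.mul_right ((1 / 2 : ℝ) ^ N * K * ‖h‖)
    rw [one_mul] at e
    refine hasSum_le (fun m => ?_) ((summable_nat_add_iff N).2 hd'.summable).hasSum e
    have := mul_le_mul_of_nonneg_left (secondDiff_le (hg (m + N)) (h0 _) (hle _) a hh1)
      (by positivity : (0 : ℝ) ≤ (1 / 2) ^ (m + N + 1))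
    calc d (m + N) ≤ (1 / 2 : ℝ) ^ (m + N + 1) * (K * ‖h‖) := this
      _ = _ := by ring
  have h3 : (1 / 2 : ℝ) ^ N * K * ‖h‖ ≤ ε / 2 * ‖h‖ :=
    mul_le_mul_of_nonneg_right hN.le (norm_nonneg h)
  linarith

end SmoothSum

section InfConvolution

variable {E : Type*} [NormedAddCommGroup E] [NormedSpace ℝ E]

/-- Strict midpoint convexity. -/
def StrictMidpoint (f : E → ℝ) : Prop :=
  ∀ a b, f a + f b ≤ 2 * f ((1 / 2 : ℝ) • a + (1 / 2 : ℝ) • b) → a = b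

/-- The infimal convolution of `D` and `(m + 1) • J`. -/
noncomputable def infConv (D J : E → ℝ) (m : ℕ) (a : E) : ℝ :=
  sInf (range fun b => D (a - b) + ((m : ℝ) + 1) * J b)

variable {D J : E → ℝ}

theorem infConv_le (hD : ∀ a, 0 ≤ D a) (hJ : QuadraticGrowth J) (m : ℕ) (a b : E) :
    infConv D J m a ≤ D (a - b) + ((m : ℝ) + 1) * J b := by
  refine csInf_le ⟨0, ?_⟩ ⟨b, rfl⟩
  rintro _ ⟨c, rfl⟩
  have h1 : 0 ≤ J c := (by positivity : (0 : ℝ) ≤ ‖c‖ ^ 2 / 4).trans (hJ.lower c)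
  have h2 := hD (a - c)
  positivity

theorem exists_infConv_eq (hE : IsReflexiveSpace E) (hDc : ConvexOn ℝ univ D)
    (hDcont : Continuous D) (hD : ∀ a, 0 ≤ D a) (hJ : QuadraticGrowth J) (m : ℕ) (a : E) :
    ∃ b, infConv D J m a = D (a - b) + ((m : ℝ) + 1) * J b := by
  have hm : (0 : ℝ) ≤ (m : ℝ) + 1 := by positivity
  have h1 : ConvexOn ℝ univ fun b => D (a - b) := by
    refine ⟨convex_univ, fun b _ c _ s t hs ht hst => ?_⟩
    have := hDc.2 (mem_univ (a - b)) (mem_univ (a - c)) hs ht hst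
    have e : s • (a - b) + t • (a - c) = a - (s • b + t • c) := by
      rw [smul_sub, smul_sub, sub_add_sub_comm, ← add_smul, hst, one_smul]
    rwa [e] at this
  have hconv : ConvexOn ℝ univ fun b => D (a - b) + ((m : ℝ) + 1) * J b :=
    h1.add (hJ.convex.smul hm)
  have hJcont := hJ.continuous
  obtain ⟨b, hb⟩ := hE.exists_forall_le hconv (by fun_prop) (by
    intro C
    refine (Metric.isBounded_closedBall (x := (0 : E)) (r := 4 * |C| + 1)).subset ?_
    intro b hb
    rw [mem_closedBall_zero_iff]
    have h1 : D (a - b) + ((m : ℝ) + 1) * J b ≤ C := hb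
    have h2 := hJ.lower b
    have h3 := hD (a - b)
    have h4 : J b ≤ ((m : ℝ) + 1) * J b := by
      refine le_mul_of_one_le_left ((by positivity : (0 : ℝ) ≤ ‖b‖ ^ 2 / 4).trans h2) ?_
      linarith [(Nat.cast_nonneg m : (0 : ℝ) ≤ m)]
    have h5 := le_abs_self C
    by_contra hn
    push Not at hn
    nlinarith [abs_nonneg C])
  refine ⟨b, le_antisymm (infConv_le hD hJ m a b) (le_csInf (range_nonempty _) ?_)⟩
  rintro _ ⟨c, rfl⟩
  exact hb c

/-- The smoothing of `D` by infimal convolutions with multiples of `J`. -/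
noncomputable def smoothing (D J : E → ℝ) (a : E) : ℝ :=
  ∑' m : ℕ, (1 / 2 : ℝ) ^ (m + 1) * infConv D J m a

/-- Smoothing preserves strict convexity, and produces a smooth function. Each infimal convolution
is smooth as it is touched from above by a translate of a multiple of `J`. If all of them were
affine on a segment, strict convexity of `D` would make its length equal to the distance between
the minimizers at its endpoints, and these tend to zero. -/
theorem exists_smooth_strictMidpoint (hE : IsReflexiveSpace E) (hDc : ConvexOn ℝ univ D)
    (hD0 : ∀ a, 0 ≤ D a) (hDle : ∀ a, D a ≤ ‖a‖ ^ 2) (hDs : StrictMidpoint D)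
    (hDn : ∀ a, D (-a) = D a)
    (hDp : ∀ a e, ∀ t > 0, D (a + e) ≤ (1 + t) * D a + (1 + t⁻¹) * D e)
    (hJ : QuadraticGrowth J) (hJs : SecondDiffSmooth J) (hJn : ∀ a, J (-a) = J a) :
    ∃ F : E → ℝ, ConvexOn ℝ univ F ∧ Continuous F ∧ StrictMidpoint F ∧ SecondDiffSmooth F ∧
      (∀ a, 0 ≤ F a) ∧ (∀ a, F a ≤ D a) ∧ (∀ a, F (-a) = F a) ∧
      ∀ a e, ∀ t > 0, F (a + e) ≤ (1 + t) * F a + (1 + t⁻¹) * D e := by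
  have hDcont : Continuous D := continuous_of_convexOn_of_le hDc (C := 1) fun a => by
    linarith [hDle a]
  have hJ0 : ∀ a, 0 ≤ J a := fun a =>
    (by positivity : (0 : ℝ) ≤ ‖a‖ ^ 2 / 4).trans (hJ.lower a)
  have hJz : J 0 = 0 := le_antisymm (by simpa using hJ.upper 0) (hJ0 0)
  choose ψ hψ using fun m a => exists_infConv_eq hE hDc hDcont hD0 hJ m a
  have hle := infConv_le hD0 hJ
  have hI0 : ∀ m a, 0 ≤ infConv D J m a := fun m a => by
    rw [hψ]
    have := hD0 (a - ψ m a)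
    have := hJ0 (ψ m a)
    positivity
  have hID : ∀ m a, infConv D J m a ≤ D a := fun m a => by
    have := hle m a 0
    rwa [sub_zero, hJz, mul_zero, add_zero] at this
  have hIsq : ∀ m a, infConv D J m a ≤ ‖a‖ ^ 2 := fun m a => (hID m a).trans (hDle a)
  have hcombo : ∀ (m : ℕ) (a b : E) (s t : ℝ), s • a + t • b - (s • ψ m a + t • ψ m b) =
      s • (a - ψ m a) + t • (b - ψ m b) := fun m a b s t => by module
  have hIc : ∀ m, ConvexOn ℝ univ (infConv D J m) := by
    intro m
    refine ⟨convex_univ, fun a _ b _ s t hs ht hst => ?_⟩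
    refine (hle m _ (s • ψ m a + t • ψ m b)).trans ?_
    rw [hcombo, hψ m a, hψ m b]
    have h1 := hDc.2 (mem_univ (a - ψ m a)) (mem_univ (b - ψ m b)) hs ht hst
    have h2 := hJ.convex.2 (mem_univ (ψ m a)) (mem_univ (ψ m b)) hs ht hst
    simp only [smul_eq_mul] at h1 h2 ⊢
    have h3 := mul_le_mul_of_nonneg_left h2 (by positivity : (0 : ℝ) ≤ (m : ℝ) + 1)
    linarith
  have hIs : ∀ m, SecondDiffSmooth (infConv D J m) := by
    intro m
    refine SecondDiffSmooth.of_touching fun a =>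
      ⟨fun b => ((m : ℝ) + 1) * J b + D (a - ψ m a), ψ m a, ?_, fun h => ?_, ?_⟩
    · have := hJs.const_mul (by positivity : (0 : ℝ) ≤ (m : ℝ) + 1)
      intro b ε hε
      obtain ⟨δ, hδ, h⟩ := this b ε hε
      exact ⟨δ, hδ, fun k hk => by linarith [h k hk]⟩
    · have := hle m (a + h) (ψ m a + h)
      rw [add_sub_add_right_eq_sub] at this
      linarith
    · rw [hψ]
      ring
  have sI : ∀ a, Summable fun m : ℕ => (1 / 2 : ℝ) ^ (m + 1) * infConv D J m a := fun a =>
    summable_half_pow_mul (fun m => hI0 m a) fun m => hIsq m a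
  have hFD : ∀ a, smoothing D J a ≤ D a := fun a =>
    tsum_half_pow_mul_le (fun m => hI0 m a) fun m => hID m a
  have hFc : ConvexOn ℝ univ (smoothing D J) := by
    refine ⟨convex_univ, fun a _ b _ s t hs ht hst => ?_⟩
    rw [smul_eq_mul, smul_eq_mul]
    unfold smoothing
    rw [← tsum_mul_left, ← tsum_mul_left,
      ← ((sI a).mul_left s).tsum_add ((sI b).mul_left t)]
    refine Summable.tsum_le_tsum (fun m => ?_) (sI _) (((sI a).mul_left s).add ((sI b).mul_left t))
    have h1 := (hIc m).2 (mem_univ a) (mem_univ b) hs ht hst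
    have h2 := mul_le_mul_of_nonneg_left h1 (by positivity : (0 : ℝ) ≤ (1 / 2) ^ (m + 1))
    simp only [smul_eq_mul] at h2
    linarith
  refine ⟨smoothing D J, hFc, continuous_of_convexOn_of_le hFc (C := 1) fun a => by
    linarith [hFD a, hDle a], ?_, SecondDiffSmooth.tsum hIc hI0 hIsq hIs, fun a =>
    tsum_nonneg fun m => mul_nonneg (by positivity) (hI0 m a), hFD, ?_, ?_⟩
  · intro a b hab
    have hm : ∀ m, infConv D J m a + infConv D J m b ≤
        2 * infConv D J m ((1 / 2 : ℝ) • a + (1 / 2 : ℝ) • b) := by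
      intro m
      have s := ((sI a).add (sI b)).sub
        ((sI ((1 / 2 : ℝ) • a + (1 / 2 : ℝ) • b)).mul_left 2)
      have h1 := s.le_tsum m fun j _ => by
        have h1 := (hIc j).2 (mem_univ a) (mem_univ b) (by norm_num : (0 : ℝ) ≤ 1 / 2)
          (by norm_num : (0 : ℝ) ≤ 1 / 2) (by norm_num)
        have h2 := mul_le_mul_of_nonneg_left h1 (by positivity : (0 : ℝ) ≤ (1 / 2) ^ (j + 1))
        simp only [smul_eq_mul] at h2
        linarith
      rw [((sI a).add (sI b)).tsum_sub ((sI _).mul_left 2), (sI a).tsum_add (sI b),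
        tsum_mul_left] at h1
      change _ ≤ smoothing D J a + smoothing D J b - 2 * smoothing D J _ at h1
      refine le_of_mul_le_mul_left ?_ (by positivity : (0 : ℝ) < (1 / 2) ^ (m + 1))
      linarith
    have heq : ∀ m, a - ψ m a = b - ψ m b := by
      intro m
      refine hDs _ _ ?_
      have h1 := hm m
      have h2 := hle m ((1 / 2 : ℝ) • a + (1 / 2 : ℝ) • b)
        ((1 / 2 : ℝ) • ψ m a + (1 / 2 : ℝ) • ψ m b)
      have h3 := hJ.convex.2 (mem_univ (ψ m a)) (mem_univ (ψ m b))
        (by norm_num : (0 : ℝ) ≤ 1 / 2) (by norm_num : (0 : ℝ) ≤ 1 / 2) (by norm_num)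
      have h4 := mul_le_mul_of_nonneg_left h3 (by positivity : (0 : ℝ) ≤ (m : ℝ) + 1)
      rw [hcombo] at h2
      rw [hψ m a, hψ m b] at h1
      simp only [smul_eq_mul] at h4
      linarith
    have hsmall : ∀ c, Tendsto (fun m => ψ m c) atTop (𝓝 0) := by
      intro c
      have hb : ∀ m : ℕ, ‖ψ m c‖ ^ 2 ≤ 4 * D c * (1 / ((m : ℝ) + 1)) := by
        intro m
        have h1 := hID m c
        rw [hψ] at h1
        have h2 := hD0 (c - ψ m c)
        have h3 := mul_le_mul_of_nonneg_left (hJ.lower (ψ m c))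
          (by positivity : (0 : ℝ) ≤ (m : ℝ) + 1)
        rw [mul_one_div, le_div_iff₀ (by positivity)]
        linarith
      have h1 : Tendsto (fun m : ℕ => ‖ψ m c‖ ^ 2) atTop (𝓝 0) := by
        refine squeeze_zero (fun m => sq_nonneg _) hb ?_
        simpa using (tendsto_one_div_add_atTop_nhds_zero_nat (𝕜 := ℝ)).const_mul (4 * D c)
      have h2 := h1.sqrt
      simp only [Real.sqrt_sq (norm_nonneg _), Real.sqrt_zero] at h2
      exact tendsto_zero_iff_norm_tendsto_zero.2 h2
    have hlim : Tendsto (fun m => ψ m a - ψ m b) atTop (𝓝 0) := by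
      simpa using (hsmall a).sub (hsmall b)
    have hconst : ∀ m, ψ m a - ψ m b = a - b := fun m => by
      have := heq m
      rw [sub_eq_sub_iff_add_eq_add] at this ⊢
      rw [add_comm (ψ m a), add_comm a, ← this, add_comm]
    simp only [hconst] at hlim
    exact sub_eq_zero.1 (tendsto_nhds_unique tendsto_const_nhds hlim)
  · have h1 : ∀ m a, infConv D J m (-a) ≤ infConv D J m a := by
      intro m a
      have := hle m (-a) (-ψ m a)
      rw [hJn, neg_sub_neg, ← neg_sub, hDn, ← hψ] at this
      exact this
    intro a
    unfold smoothing
    congr 1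
    ext m
    rw [le_antisymm (h1 m a) (by simpa using h1 m (-a))]
  · intro a e t ht
    have s1 := (sI a).mul_left (1 + t)
    have s2 := hasSum_half_pow_succ.mul_right ((1 + t⁻¹) * D e)
    rw [one_mul] at s2
    have s3 := s1.hasSum.add s2
    rw [tsum_mul_left] at s3
    refine hasSum_le (fun m => ?_) (sI (a + e)).hasSum s3
    have h1 := hle m (a + e) (ψ m a)
    have h2 := hDp (a - ψ m a) e t ht
    have h3 : infConv D J m (a + e) ≤ (1 + t) * infConv D J m a + (1 + t⁻¹) * D e := by
      rw [add_sub_right_comm] at h1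
      rw [hψ m a]
      have := mul_nonneg ht.le (mul_nonneg (by positivity : (0 : ℝ) ≤ (m : ℝ) + 1) (hJ0 (ψ m a)))
      linarith
    have h4 := mul_le_mul_of_nonneg_left h3 (by positivity : (0 : ℝ) ≤ (1 / 2) ^ (m + 1))
    linarith

end InfConvolution

/-! ### Norms with a prescribed dual ball -/

section Body

variable {E : Type*} [NormedAddCommGroup E] [NormedSpace ℝ E]

/-- A continuous linear functional attains its maximum on a bounded closed convex set. -/
theorem IsReflexiveSpace.exists_isMaxOn (hE : IsReflexiveSpace E) {K : Set E} (hK : Convex ℝ K)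
    (hKc : IsClosed K) (hne : K.Nonempty) {R : ℝ} (hR : ∀ x ∈ K, ‖x‖ ≤ R) (φ : StrongDual ℝ E) :
    ∃ x ∈ K, ∀ y ∈ K, φ y ≤ φ x := by
  have := hne.to_subtype
  have hNe : (⨅ y : K, 𝓟 {x : K | φ y ≤ φ x}).NeBot := by
    refine iInf_neBot_of_directed' ?_ fun y => principal_neBot_iff.2 ⟨y, le_refl (φ y)⟩
    intro y z
    rcases le_total (φ y) (φ z) with h | h
    · exact ⟨z, principal_mono.2 fun x hx => le_trans h hx, le_rfl⟩
    · exact ⟨y, le_rfl, principal_mono.2 fun x hx => le_trans h hx⟩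
  let U := Ultrafilter.of (⨅ y : K, 𝓟 {x : K | φ y ≤ φ x})
  have hU : ∀ y : K, ∀ᶠ x : K in (U : Filter K), φ y ≤ φ x := fun y =>
    (Ultrafilter.of_le _).trans (iInf_le _ y) (mem_principal_self _)
  obtain ⟨x, hx⟩ := hE.exists_weak_limit U (fun x : K => (x : E)) (R := R)
    (Eventually.of_forall fun x => hR x x.2)
  exact ⟨x, mem_of_weak_limit hx hK hKc (Eventually.of_forall fun x => x.2).frequently,
    fun y hy => ge_of_tendsto (hx φ) (hU ⟨y, hy⟩)⟩

/-- The functions on the dual whose sublevel sets `{Φ ≤ 1}` are the dual unit balls of Gâteaux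
differentiable ALUR norms. -/
structure IsDualBody (Φ : StrongDual ℝ E → ℝ) : Prop where
  convex : ConvexOn ℝ univ Φ
  continuous : Continuous Φ
  strict : StrictMidpoint Φ
  smooth : SecondDiffSmooth Φ
  zero : Φ 0 = 0
  neg : ∀ φ, Φ (-φ) = Φ φ
  bounded : ∃ R, ∀ φ, Φ φ ≤ 1 → ‖φ‖ ≤ R

/-- The support function of `{Φ ≤ 1}`. -/
noncomputable def bodyFun (Φ : StrongDual ℝ E → ℝ) (x : E) : ℝ :=
  sSup ((fun φ : StrongDual ℝ E => φ x) '' {φ | Φ φ ≤ 1})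

variable {Φ : StrongDual ℝ E → ℝ}

theorem IsDualBody.smul_le (hΦ : IsDualBody Φ) (φ : StrongDual ℝ E) {t : ℝ} (h0 : 0 ≤ t)
    (h1 : t ≤ 1) : Φ (t • φ) ≤ t * Φ φ := by
  have h := hΦ.convex.2 (mem_univ φ) (mem_univ 0) h0 (sub_nonneg.2 h1) (add_sub_cancel t 1)
  rwa [smul_zero, add_zero, hΦ.zero, smul_zero, add_zero, smul_eq_mul] at h

theorem IsDualBody.le_bodyFun (hΦ : IsDualBody Φ) {φ : StrongDual ℝ E} (h : Φ φ ≤ 1) (x : E) :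
    φ x ≤ bodyFun Φ x := by
  obtain ⟨R, hR⟩ := hΦ.bounded
  refine le_csSup ⟨R * ‖x‖, ?_⟩ ⟨φ, h, rfl⟩
  rintro _ ⟨ψ, hψ, rfl⟩
  exact ((le_abs_self _).trans (ψ.le_opNorm x)).trans
    (mul_le_mul_of_nonneg_right (hR ψ hψ) (norm_nonneg x))

theorem IsDualBody.bodyFun_le (hΦ : IsDualBody Φ) {x : E} {c : ℝ}
    (h : ∀ φ : StrongDual ℝ E, Φ φ ≤ 1 → φ x ≤ c) : bodyFun Φ x ≤ c :=
  csSup_le ⟨_, 0, hΦ.zero.trans_le zero_le_one, rfl⟩ (by rintro _ ⟨φ, hφ, rfl⟩; exact h φ hφ)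

/-- The seminorm (in fact, norm) with dual unit ball `{Φ ≤ 1}`. -/
noncomputable def IsDualBody.seminorm (hΦ : IsDualBody Φ) : Seminorm ℝ E :=
  Seminorm.ofSMulLE (bodyFun Φ)
    (le_antisymm (hΦ.bodyFun_le fun φ _ => (map_zero φ).le) (by
      simpa using hΦ.le_bodyFun (hΦ.zero.trans_le zero_le_one) 0))
    (fun x y => hΦ.bodyFun_le fun φ hφ => by
      rw [map_add]
      exact add_le_add (hΦ.le_bodyFun hφ x) (hΦ.le_bodyFun hφ y))
    (fun r x => hΦ.bodyFun_le fun φ hφ => by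
      rw [map_smul, smul_eq_mul, Real.norm_eq_abs]
      rcases abs_cases r with ⟨h, h0⟩ | ⟨h, h0⟩ <;> rw [h]
      · exact mul_le_mul_of_nonneg_left (hΦ.le_bodyFun hφ x) h0
      · have := hΦ.le_bodyFun (φ := -φ) (by rwa [hΦ.neg]) x
        rw [neg_apply] at this
        nlinarith)

theorem IsDualBody.le_seminorm (hΦ : IsDualBody Φ) {φ : StrongDual ℝ E} (h : Φ φ ≤ 1) (x : E) :
    φ x ≤ hΦ.seminorm x :=
  hΦ.le_bodyFun h x

/-- Functionals only slightly outside of the body. -/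
theorem IsDualBody.le_mul_seminorm (hΦ : IsDualBody Φ) {φ : StrongDual ℝ E} {t : ℝ} (ht : 0 ≤ t)
    (h : Φ φ ≤ 1 + t) (x : E) : φ x ≤ (1 + t) * hΦ.seminorm x := by
  have h1 : 0 < 1 + t := by linarith
  have h2 : Φ ((1 + t)⁻¹ • φ) ≤ 1 := by
    refine (hΦ.smul_le φ (by positivity) (inv_le_one_of_one_le₀ (by linarith))).trans ?_
    rwa [inv_mul_le_iff₀ h1, mul_one]
  have h3 := hΦ.le_seminorm h2 x
  rwa [smul_apply, smul_eq_mul, inv_mul_le_iff₀ h1] at h3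

theorem IsDualBody.exists_eq (hE : IsReflexiveSpace E) (hΦ : IsDualBody Φ) (x : E) :
    ∃ φ : StrongDual ℝ E, Φ φ ≤ 1 ∧ φ x = hΦ.seminorm x := by
  obtain ⟨R, hR⟩ := hΦ.bounded
  have hc : Convex ℝ {φ | Φ φ ≤ 1} := by simpa using hΦ.convex.convex_le 1
  obtain ⟨φ, hφ, hmax⟩ := hE.dual.exists_isMaxOn hc (isClosed_le hΦ.continuous continuous_const)
    ⟨0, hΦ.zero.trans_le zero_le_one⟩ hR (NormedSpace.inclusionInDoubleDual ℝ E x)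
  exact ⟨φ, hφ, le_antisymm (hΦ.le_seminorm hφ x) (hΦ.bodyFun_le hmax)⟩

theorem IsDualBody.isEquivalentNorm (hΦ : IsDualBody Φ) : IsEquivalentNorm hΦ.seminorm := by
  obtain ⟨R, hR⟩ := hΦ.bounded
  have hev : ∀ᶠ φ in 𝓝 (0 : StrongDual ℝ E), Φ φ < 1 :=
    (hΦ.continuous.tendsto 0).eventually (gt_mem_nhds (by rw [hΦ.zero]; exact one_pos))
  obtain ⟨r, hr, hball⟩ := Metric.eventually_nhds_iff.1 hev
  refine ⟨r / 2, by positivity, max R 1, by positivity, fun x => ⟨?_, ?_⟩⟩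
  · obtain ⟨φ, hφ1, hφ2⟩ := norm_eq_of_support x
    have h1 : Φ ((r / 2) • φ) ≤ 1 := (hball (by
      rw [dist_zero_right, norm_smul, Real.norm_of_nonneg (by positivity)]
      nlinarith [norm_nonneg φ])).le
    have h2 := hΦ.le_seminorm h1 x
    rwa [smul_apply, smul_eq_mul, hφ2] at h2
  · refine hΦ.bodyFun_le fun φ hφ => ((le_abs_self _).trans (φ.le_opNorm x)).trans
      (mul_le_mul_of_nonneg_right ((hR φ hφ).trans (le_max_left _ _)) (norm_nonneg x))

/-- Points of the interior of the body do not attain a nonzero norm. -/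
theorem IsDualBody.lt_seminorm (hΦ : IsDualBody Φ) {φ : StrongDual ℝ E} (h : Φ φ < 1) {x : E}
    (hx : 0 < hΦ.seminorm x) : φ x < hΦ.seminorm x := by
  have hc : ContinuousAt (fun t : ℝ => Φ ((1 + t) • φ)) 0 := by
    have := hΦ.continuous
    fun_prop
  have hev := hc.eventually (gt_mem_nhds (show Φ ((1 + (0 : ℝ)) • φ) < 1 by simpa using h))
  obtain ⟨r, hr, hball⟩ := Metric.eventually_nhds_iff.1 hev
  have h1 : Φ ((1 + r / 2) • φ) ≤ 1 := (hball (by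
    rw [Real.dist_eq, sub_zero, abs_of_pos (by positivity)]
    linarith)).le
  have h2 := hΦ.le_seminorm h1 x
  rw [smul_apply, smul_eq_mul] at h2
  by_contra hn
  push Not at hn
  nlinarith

theorem IsDualBody.eq_of_eq_seminorm (hΦ : IsDualBody Φ) {x : E} (hx : 0 < hΦ.seminorm x)
    {φ ψ : StrongDual ℝ E} (hφ : Φ φ ≤ 1) (hψ : Φ ψ ≤ 1) (hφx : φ x = hΦ.seminorm x)
    (hψx : ψ x = hΦ.seminorm x) : φ = ψ := by
  refine hΦ.strict φ ψ ?_
  by_contra hn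
  push Not at hn
  have h1 : Φ ((1 / 2 : ℝ) • φ + (1 / 2 : ℝ) • ψ) < 1 := by linarith
  have h2 := hΦ.lt_seminorm h1 hx
  simp only [add_apply, smul_apply, smul_eq_mul, hφx, hψx] at h2
  linarith

/-- Strict convexity of the dual ball makes the norm Gâteaux differentiable: the derivative is the
unique norming functional, and nearby norming functionals converge weakly to it. -/
theorem IsDualBody.isGateauxNorm (hE : IsReflexiveSpace E) (hΦ : IsDualBody Φ) :
    IsGateauxNorm hΦ.seminorm := by
  obtain ⟨R, hR⟩ := hΦ.bounded
  intro x hx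
  have hp : 0 < hΦ.seminorm x := by
    obtain ⟨c, hc, C, -, h⟩ := hΦ.isEquivalentNorm
    exact (mul_pos hc (norm_pos_iff.2 hx)).trans_le (h x).1
  choose ψ hψ1 hψ2 using hΦ.exists_eq hE
  refine ⟨ψ x, fun v => ?_⟩
  have hlim : Tendsto (fun t : ℝ => ψ (x + t • v) v) (𝓝[≠] 0) (𝓝 (ψ x v)) := by
    rw [tendsto_iff_ultrafilter]
    intro U hU
    obtain ⟨θ, hθ⟩ := hE.dual.exists_weak_limit U (fun t => ψ (x + t • v)) (R := R)
      (Eventually.of_forall fun t => hR _ (hψ1 _))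
    have hθ' : ∀ y, Tendsto (fun t => ψ (x + t • v) y) (U : Filter ℝ) (𝓝 (θ y)) := fun y =>
      hθ (NormedSpace.inclusionInDoubleDual ℝ E y)
    have hU0 : Tendsto (fun t : ℝ => t) U (𝓝 0) := hU.trans nhdsWithin_le_nhds
    have hθ1 : Φ θ ≤ 1 := le_of_weak_limit hθ hΦ.convex hΦ.continuous
      (Eventually.of_forall fun t => hψ1 _).frequently
    have hθ2 : hΦ.seminorm x ≤ θ x := by
      -- `p x ≤ p (x + t v) + |t| p v` and `p (x + t v)` is attained at `ψ (x + t v)`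
      have h1 : ∀ t : ℝ, hΦ.seminorm x ≤ ψ (x + t • v) x + t * ψ (x + t • v) v +
          |t| * hΦ.seminorm v := by
        intro t
        have e1 := hψ2 (x + t • v)
        rw [map_add, map_smul, smul_eq_mul] at e1
        have e2 := map_sub_le_add hΦ.seminorm (x + t • v) (t • v)
        rw [add_sub_cancel_right, map_smul_eq_mul, Real.norm_eq_abs] at e2
        linarith
      have h2 : Tendsto (fun t : ℝ => ψ (x + t • v) x + t * ψ (x + t • v) v +
          |t| * hΦ.seminorm v) U (𝓝 (θ x + 0 * θ v + |0| * hΦ.seminorm v)) :=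
        ((hθ' x).add (hU0.mul (hθ' v))).add (hU0.abs.mul_const _)
      have := ge_of_tendsto' h2 h1
      simpa using this
    have hθx : θ = ψ x := hΦ.eq_of_eq_seminorm hp hθ1 (hψ1 x)
      (le_antisymm (hΦ.le_seminorm hθ1 x) hθ2) (hψ2 x)
    rw [← hθx]
    exact hθ' v
  rw [HasLineDerivAt, hasDerivAt_iff_tendsto_slope]
  have hdist : Tendsto (fun t : ℝ => |ψ (x + t • v) v - ψ x v|) (𝓝[≠] 0) (𝓝 0) := by
    have := (hlim.sub_const (ψ x v)).abs
    simpa using this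
  refine tendsto_iff_dist_tendsto_zero.2 (squeeze_zero'
    (Eventually.of_forall fun _ => dist_nonneg) ?_ hdist)
  filter_upwards [self_mem_nhdsWithin] with t ht
  have ht : t ≠ 0 := ht
  rw [slope_def_field, Real.dist_eq, sub_zero, zero_smul, add_zero]
  -- the difference quotient lies between the values at `v` of the two norming functionals
  have h1 : hΦ.seminorm x + t * ψ x v ≤ hΦ.seminorm (x + t • v) := by
    have := hΦ.le_seminorm (hψ1 x) (x + t • v)
    rwa [map_add, hψ2 x, map_smul, smul_eq_mul] at this
  have h2 : hΦ.seminorm (x + t • v) ≤ hΦ.seminorm x + t * ψ (x + t • v) v := by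
    have := hΦ.le_seminorm (hψ1 (x + t • v)) x
    rw [← hψ2 (x + t • v), map_add, map_smul, smul_eq_mul]
    linarith
  have h3 : (hΦ.seminorm (x + t • v) - hΦ.seminorm x) / t - ψ x v =
      (hΦ.seminorm (x + t • v) - hΦ.seminorm x - t * ψ x v) / t := by
    field_simp
  rw [h3, abs_div, div_le_iff₀ (abs_pos.2 ht), ← abs_mul,
    abs_of_nonneg (by linarith : 0 ≤ hΦ.seminorm (x + t • v) - hΦ.seminorm x - t * ψ x v)]
  exact le_trans (by linarith) (le_abs_self _)

/-- Smoothness of `Φ` makes every point of the sphere strongly exposed by its norming functional,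
hence denting (Šmulian's lemma). -/
theorem IsDualBody.isALUR (hE : IsReflexiveSpace E) (hΦ : IsDualBody Φ) : IsALUR hΦ.seminorm := by
  obtain ⟨R', hR'⟩ := hΦ.bounded
  set R : ℝ := max R' 1 with hRdef
  have hR : ∀ φ, Φ φ ≤ 1 → ‖φ‖ ≤ R := fun φ h => (hR' φ h).trans (le_max_left _ _)
  have hR0 : 0 < R := lt_max_of_lt_right one_pos
  intro x hx ε hε
  obtain ⟨φ, hφ1, hφx⟩ := hΦ.exists_eq hE x
  rw [hx] at hφx
  obtain ⟨δ, hδ, hsm⟩ := hΦ.smooth φ (ε / (8 * R)) (by positivity)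
  -- the increment `τ • k` used below has norm at most `δ / 2`, as `‖k‖ ≤ 2 * R`
  set τ : ℝ := δ / (4 * R) with hτ
  have hτ0 : 0 < τ := by positivity
  set η : ℝ := min (ε / 4) (τ * ε / 4) with hη
  have hη0 : 0 < η := lt_min (by positivity) (by positivity)
  -- on functionals taking the value one at `x`, `Φ` is at least one
  have hge : ∀ ψ : StrongDual ℝ E, ψ x = 1 → 1 ≤ Φ ψ := by
    intro ψ hψ
    by_contra hn
    have := hΦ.lt_seminorm (not_le.1 hn) (x := x) (by rw [hx]; exact one_pos)
    rw [hψ, hx] at this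
    exact lt_irrefl _ this
  -- the slice of the ball given by `φ` and `η` is contained in the ball of radius `ε` about `x`
  have hslice : ∀ u, hΦ.seminorm u ≤ 1 → 1 - η < φ u → hΦ.seminorm (u - x) < ε := by
    intro u hu hφu
    obtain ⟨h, hh1, hh2⟩ := hΦ.exists_eq hE (u - x)
    have hhx : |h x| ≤ 1 := by
      rw [abs_le]
      have e1 := hΦ.le_seminorm hh1 x
      have e2 := hΦ.le_seminorm (φ := -h) (by rwa [hΦ.neg]) x
      rw [neg_apply] at e2
      rw [hx] at e1 e2
      exact ⟨by linarith, e1⟩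
    -- moving `φ` along the component of `h` vanishing at `x` leaves the body only slightly
    set k : StrongDual ℝ E := h - h x • φ with hk
    have hkx : k x = 0 := by
      rw [hk, sub_apply, smul_apply, smul_eq_mul, hφx, mul_one, sub_self]
    have hkn : ‖k‖ ≤ 2 * R := by
      refine (norm_sub_le _ _).trans ?_
      rw [norm_smul, Real.norm_eq_abs]
      have := mul_le_mul hhx (hR φ hφ1) (norm_nonneg _) zero_le_one
      linarith [hR h hh1]
    have hτk : ‖τ • k‖ ≤ τ * (2 * R) := by
      rw [norm_smul, Real.norm_of_nonneg hτ0.le]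
      exact mul_le_mul_of_nonneg_left hkn hτ0.le
    have hτδ : τ * (2 * R) = δ / 2 := by
      rw [hτ]
      field_simp
      ring
    have h1 := hsm (τ • k) (by linarith)
    have h2 : 1 ≤ Φ (φ - τ • k) := hge _ (by
      rw [sub_apply, smul_apply, hkx, smul_zero, sub_zero, hφx])
    have h3 : ε / (8 * R) * ‖τ • k‖ ≤ τ * ε / 4 := by
      calc ε / (8 * R) * ‖τ • k‖ ≤ ε / (8 * R) * (τ * (2 * R)) :=
            mul_le_mul_of_nonneg_left hτk (by positivity)
        _ = τ * ε / 4 := by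
            field_simp
            ring
    have h4 : Φ (φ + τ • k) ≤ 1 + τ * ε / 4 := by linarith
    have h5 := hΦ.le_mul_seminorm (by positivity) h4 u
    rw [add_apply, smul_apply, smul_eq_mul] at h5
    have h6 : (1 + τ * ε / 4) * hΦ.seminorm u ≤ 1 + τ * ε / 4 :=
      mul_le_of_le_one_right (by positivity) hu
    have h7 : τ * k u ≤ τ * (ε / 2) := by
      have : η ≤ τ * ε / 4 := min_le_right _ _
      linarith
    have h8 : k u ≤ ε / 2 := le_of_mul_le_mul_left h7 hτ0
    have h9 : φ u ≤ 1 := (hΦ.le_seminorm hφ1 u).trans hu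
    have h10 : h x * (φ u - 1) ≤ ε / 4 := by
      have e1 : |h x * (φ u - 1)| ≤ 1 * η := by
        rw [abs_mul]
        refine mul_le_mul hhx ?_ (abs_nonneg _) zero_le_one
        rw [abs_le]
        constructor <;> linarith
      have e2 : η ≤ ε / 4 := min_le_left _ _
      linarith [le_abs_self (h x * (φ u - 1))]
    have h11 : h (u - x) = h x * (φ u - 1) + k u := by
      rw [hk, map_sub, sub_apply, smul_apply, smul_eq_mul]
      ring
    rw [← hh2, h11]
    linarith
  intro hmem
  have hC : closure (convexHull ℝ {y : E | hΦ.seminorm y ≤ 1 ∧ ε ≤ hΦ.seminorm (y - x)}) ⊆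
      {y | φ y ≤ 1 - η} := by
    refine closure_minimal (convexHull_min ?_ ?_) (isClosed_le φ.continuous continuous_const)
    · rintro u ⟨hu1, hu2⟩
      by_contra hn
      exact absurd (hslice u hu1 (not_le.1 hn)) (not_lt.2 hu2)
    · exact convex_halfSpace_le φ.isLinear _
  have := hC hmem
  rw [mem_ofPred, hφx] at this
  linarith

end Body

/-! ### Almost biorthogonal weakly null sequences -/

section WeakSequences

/-- The coordinates at which some member of a sequence of `c₀` families is nonzero form a
countable set. -/
theorem countable_setOf_exists_ne_zero {Γ : Type*} {c : ℕ → Γ → ℝ}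
    (hc : ∀ n, ∀ ε > 0, {γ | ε < |c n γ|}.Finite) : {γ | ∃ n, c n γ ≠ 0}.Countable := by
  have h : {γ | ∃ n, c n γ ≠ 0} ⊆ ⋃ (n : ℕ) (k : ℕ), {γ | ((k : ℝ) + 1)⁻¹ < |c n γ|} := by
    rintro γ ⟨n, hn⟩
    obtain ⟨k, hk⟩ := exists_nat_one_div_lt (abs_pos.2 hn)
    rw [one_div] at hk
    exact mem_iUnion₂.2 ⟨n, k, hk⟩
  exact (countable_iUnion fun n => countable_iUnion fun k =>
    (hc n _ (by positivity)).countable).mono h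

variable {E : Type u} [NormedAddCommGroup E] [NormedSpace ℝ E]

/-- Bounded sequences in a reflexive space have weakly convergent subsequences. -/
theorem IsReflexiveSpace.exists_subseq_weak (hE : IsReflexiveSpace E) {u : ℕ → E} {R : ℝ}
    (hu : ∀ n, ‖u n‖ ≤ R) : ∃ (σ : ℕ → ℕ) (x : E), StrictMono σ ∧
      ∀ φ : StrongDual ℝ E, Tendsto (fun n => φ (u (σ n))) atTop (𝓝 (φ x)) := by
  obtain ⟨Γ, ξ, hξ⟩ := hE.dual.exists_isC0Family
  have hfin : ∀ n, ∀ ε > 0, {γ | ε < |ξ γ (u n)|}.Finite := fun n =>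
    hξ.finite (NormedSpace.inclusionInDoubleDual ℝ E (u n))
  have hcount : Countable {γ | ∃ n, ξ γ (u n) ≠ 0} := countable_setOf_exists_ne_zero hfin
  let c : ℕ → {γ | ∃ n, ξ γ (u n) ≠ 0} → ℝ := fun n γ => ξ γ (u n)
  have hcomp : IsCompact (Set.pi univ fun _ : {γ | ∃ n, ξ γ (u n) ≠ 0} => Icc (-R) R) :=
    isCompact_univ_pi fun _ => isCompact_Icc
  obtain ⟨l, -, σ, hσ, hl⟩ := hcomp.tendsto_subseq (x := c) fun n γ _ => abs_le.1 (by
    have h1 := (ξ γ).le_opNorm (u n)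
    have h2 := mul_le_mul (hξ.norm_le γ) (hu n) (norm_nonneg _) zero_le_one
    rw [one_mul] at h2
    exact h1.trans h2)
  have hlγ : ∀ γ, ∃ r, Tendsto (fun n => ξ γ (u (σ n))) atTop (𝓝 r) := by
    intro γ
    by_cases hγ : ∃ n, ξ γ (u n) ≠ 0
    · exact ⟨l ⟨γ, hγ⟩, (tendsto_pi_nhds.1 hl) ⟨γ, hγ⟩⟩
    · push Not at hγ
      exact ⟨0, by simp [hγ]⟩
  choose r hr using hlγ
  have hlim : ∀ U : Ultrafilter ℕ, (U : Filter ℕ) ≤ atTop → ∃ y : E, (∀ γ, ξ γ y = r γ) ∧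
      ∀ φ : StrongDual ℝ E, Tendsto (fun n => φ (u (σ n))) U (𝓝 (φ y)) := by
    intro U hU
    obtain ⟨y, hy⟩ := hE.exists_weak_limit U (fun n => u (σ n)) (R := R)
      (Eventually.of_forall fun n => hu _)
    exact ⟨y, fun γ => tendsto_nhds_unique (hy (ξ γ)) ((hr γ).mono_left hU), hy⟩
  obtain ⟨x, hx, -⟩ := hlim (Ultrafilter.of atTop) (Ultrafilter.of_le _)
  refine ⟨σ, x, hσ, fun φ => ?_⟩
  rw [tendsto_iff_ultrafilter]
  intro U hU
  obtain ⟨y, hy, hyφ⟩ := hlim U hU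
  -- the coordinates determine the limit
  have hxy : NormedSpace.inclusionInDoubleDual ℝ E (y - x) = 0 := by
    refine hξ.total _ ?_
    rintro _ ⟨γ, rfl⟩
    rw [NormedSpace.dual_def, map_sub, hy, hx, sub_self]
  have : y - x = 0 := by
    obtain ⟨φ, -, hφ⟩ := norm_eq_of_support (y - x)
    rw [← norm_eq_zero, ← hφ]
    exact DFunLike.congr_fun hxy φ
  rw [← sub_eq_zero.1 this]
  exact hyφ φ

/-- Weakly null sequences of vectors and of functionals that are almost biorthogonal. -/
structure IsNullSystem (f : ℕ → E) (e : ℕ → StrongDual ℝ E) (C : ℝ) : Prop where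
  norm_le : ∀ n, ‖f n‖ ≤ C
  dual_norm_le : ∀ n, ‖e n‖ ≤ C
  tendsto : ∀ φ : StrongDual ℝ E, Tendsto (fun n => φ (f n)) atTop (𝓝 0)
  dual_tendsto : ∀ x : E, Tendsto (fun n => e n x) atTop (𝓝 0)
  apply_self : ∀ n, e n (f n) = 1
  apply_le : ∀ m n, m ≠ n → |e m (f n)| ≤ 1 / 2

theorem IsReflexiveSpace.exists_weakly_null (hE : IsReflexiveSpace E)
    (hinf : ¬ FiniteDimensional ℝ E) : ∃ (C : ℝ) (d : ℕ → E), (∀ n, ‖d n‖ ≤ C) ∧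
      (∀ n, 1 ≤ ‖d n‖) ∧ ∀ φ : StrongDual ℝ E, Tendsto (fun n => φ (d n)) atTop (𝓝 0) := by
  obtain ⟨R, g, -, hgR, hg⟩ := exists_seq_norm_le_one_le_norm_sub (𝕜 := ℝ) hinf
  obtain ⟨σ, x, hσ, hx⟩ := hE.exists_subseq_weak hgR
  refine ⟨R + R, fun n => g (σ (n + 1)) - g (σ n), fun n =>
    (norm_sub_le _ _).trans (add_le_add (hgR _) (hgR _)),
    fun n => hg (hσ.injective.ne (Nat.succ_ne_self n)), fun φ => ?_⟩
  have := ((tendsto_add_atTop_iff_nat 1).2 (hx φ)).sub (hx φ)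
  simpa using this

/-- Weak limits are subtracted from norming functionals of a weakly null sequence, and a sparse
subsequence is taken. -/
theorem IsReflexiveSpace.exists_isNullSystem (hE : IsReflexiveSpace E)
    (hinf : ¬ FiniteDimensional ℝ E) :
    ∃ (f : ℕ → E) (e : ℕ → StrongDual ℝ E) (C : ℝ), IsNullSystem f e C := by
  obtain ⟨C, d, hdC, hd1, hd⟩ := hE.exists_weakly_null hinf
  choose ψ hψ1 hψ2 using fun n => norm_eq_of_support (d n)
  obtain ⟨σ, θ, hσ, hθ⟩ := hE.dual.exists_subseq_weak hψ1
  have hθ' : ∀ y : E, Tendsto (fun n => ψ (σ n) y) atTop (𝓝 (θ y)) := fun y =>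
    hθ (NormedSpace.inclusionInDoubleDual ℝ E y)
  have hdσ : ∀ φ : StrongDual ℝ E, Tendsto (fun n => φ (d (σ n))) atTop (𝓝 0) := fun φ =>
    (hd φ).comp hσ.tendsto_atTop
  set χ : ℕ → StrongDual ℝ E := fun n => ψ (σ n) - θ with hχ
  have hχn : ∀ n, ‖χ n‖ ≤ 1 + ‖θ‖ := fun n =>
    (norm_sub_le _ _).trans (add_le_add_left (hψ1 _) _)
  have hχ0 : ∀ y : E, Tendsto (fun n => χ n y) atTop (𝓝 0) := fun y => by
    have := (hθ' y).sub_const (θ y)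
    rw [sub_self] at this
    exact this
  have hhalf : ∀ᶠ n in atTop, 1 / 2 ≤ χ n (d (σ n)) := by
    filter_upwards [(hdσ θ).eventually (gt_mem_nhds (by norm_num : (0 : ℝ) < 1 / 2))] with n hn
    rw [hχ, sub_apply, hψ2]
    linarith [hd1 (σ n)]
  -- a subsequence along which the system is almost biorthogonal
  have hmul : ∀ {c s : ℝ}, 1 / 2 ≤ c → |c⁻¹ * s| ≤ 2 * |s| := by
    intro c s hc
    have hc0 : 0 < c := by linarith
    rw [abs_mul, abs_of_pos (inv_pos.2 hc0)]
    refine mul_le_mul_of_nonneg_right ?_ (abs_nonneg s)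
    rw [inv_le_comm₀ hc0 two_pos]
    linarith
  obtain ⟨τ, hτ1, hτ2⟩ := exists_seq_of_forall_finset_exists
    (fun n => 1 / 2 ≤ χ n (d (σ n)))
    (fun m n => m < n ∧ |χ n (d (σ m))| ≤ 1 / 4 ∧ |χ m (d (σ n))| ≤ 1 / 4) (by
      intro s hs
      have h1 : ∀ᶠ n in atTop, ∀ m ∈ s,
          m < n ∧ |χ n (d (σ m))| ≤ 1 / 4 ∧ |χ m (d (σ n))| ≤ 1 / 4 := by
        rw [eventually_all_finset]
        intro m _
        have e1 := ((hχ0 (d (σ m))).abs).eventually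
          (ge_mem_nhds (by norm_num : |(0 : ℝ)| < 1 / 4))
        have e2 := ((hdσ (χ m)).abs).eventually
          (ge_mem_nhds (by norm_num : |(0 : ℝ)| < 1 / 4))
        filter_upwards [eventually_gt_atTop m, e1, e2] with n h h' h''
        exact ⟨h, h', h''⟩
      obtain ⟨n, hn1, hn2⟩ := (hhalf.and h1).exists
      exact ⟨n, hn1, hn2⟩)
  have hτ : StrictMono τ := fun m n h => (hτ2 m n h).1
  refine ⟨fun n => d (σ (τ n)), fun n => (χ (τ n) (d (σ (τ n))))⁻¹ • χ (τ n),
    max C (2 * (1 + ‖θ‖)), ?_, ?_, ?_, ?_, ?_, ?_⟩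
  · exact fun n => (hdC _).trans (le_max_left _ _)
  · intro n
    refine le_trans ?_ (le_max_right _ _)
    have h1 := hmul (s := ‖χ (τ n)‖) (hτ1 n)
    rw [abs_mul, abs_norm] at h1
    rw [norm_smul, Real.norm_eq_abs]
    linarith [hχn (τ n)]
  · exact fun φ => (hdσ φ).comp hτ.tendsto_atTop
  · intro y
    have h1 : Tendsto (fun n => 2 * |χ (τ n) y|) atTop (𝓝 0) := by
      simpa using (((hχ0 y).comp hτ.tendsto_atTop).abs).const_mul 2
    exact squeeze_zero_norm (fun n => hmul (hτ1 n)) h1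
  · exact fun n => inv_mul_cancel₀ (by linarith [hτ1 n])
  · intro m n hmn
    have h1 : |χ (τ m) (d (σ (τ n)))| ≤ 1 / 4 := by
      rcases lt_or_gt_of_ne hmn with h | h
      · exact (hτ2 m n h).2.2
      · exact (hτ2 n m h).2.1
    have h2 := hmul (s := χ (τ m) (d (σ (τ n)))) (hτ1 m)
    rw [smul_apply, smul_eq_mul]
    linarith

end WeakSequences

section Reweighting

variable {E : Type*} [NormedAddCommGroup E] [NormedSpace ℝ E] {Γ : Type*} {x : Γ → E}

/-- A total `c₀` family can be rescaled so that a given weakly null sequence of functionals becomes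
null in the supremum norm: only countably many coordinates matter, and they get weights tending to
zero. -/
theorem IsC0Family.exists_smul (hx : IsC0Family x) {e : ℕ → StrongDual ℝ E} {C : ℝ}
    (heC : ∀ n, ‖e n‖ ≤ C) (he : ∀ y, Tendsto (fun n => e n y) atTop (𝓝 0)) :
    ∃ w : Γ → ℝ, IsC0Family (fun γ => w γ • x γ) ∧
      ∀ ε > 0, ∀ᶠ n in atTop, ∀ γ, |e n (w γ • x γ)| ≤ ε := by
  have hcount := countable_setOf_exists_ne_zero (c := fun n γ => e n (x γ))
    fun n => hx.finite (e n)
  obtain ⟨i, hi⟩ := countable_iff_exists_injOn.1 hcount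
  set w : Γ → ℝ := fun γ => ((i γ : ℝ) + 1)⁻¹ with hw
  have hw0 : ∀ γ, 0 < w γ := fun γ => by positivity
  have hw1 : ∀ γ, w γ ≤ 1 := fun γ =>
    inv_le_one_of_one_le₀ (by linarith [(i γ).cast_nonneg (α := ℝ)])
  have habs : ∀ (φ : StrongDual ℝ E) γ, |φ (w γ • x γ)| = w γ * |φ (x γ)| := fun φ γ => by
    rw [map_smul, smul_eq_mul, abs_mul, abs_of_pos (hw0 γ)]
  have hle : ∀ (φ : StrongDual ℝ E) γ, |φ (w γ • x γ)| ≤ |φ (x γ)| := fun φ γ => by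
    rw [habs]
    exact mul_le_of_le_one_left (abs_nonneg _) (hw1 γ)
  have hC0 : 0 ≤ C := (norm_nonneg _).trans (heC 0)
  refine ⟨w, ⟨fun γ => ?_, fun φ hφ => ?_, fun φ ε hε => ?_⟩, fun ε hε => ?_⟩
  · rw [norm_smul, Real.norm_of_nonneg (hw0 γ).le]
    exact mul_le_one₀ (hw1 γ) (norm_nonneg _) (hx.norm_le γ)
  · refine hx.total φ ?_
    rintro _ ⟨γ, rfl⟩
    have := hφ _ ⟨γ, rfl⟩
    rw [map_smul, smul_eq_mul] at this
    exact (mul_eq_zero.1 this).resolve_left (hw0 γ).ne'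
  · exact (hx.finite φ ε hε).subset fun γ hγ => lt_of_lt_of_le hγ (hle φ γ)
  · obtain ⟨K, hK⟩ := exists_nat_gt (C / ε)
    have hfin : ({γ | ∃ n, e n (x γ) ≠ 0} ∩ i ⁻¹' Iio K).Finite :=
      Set.Finite.of_finite_image ((finite_Iio K).subset (by rintro _ ⟨γ, hγ, rfl⟩; exact hγ.2))
        (hi.mono inter_subset_left)
    have h1 : ∀ᶠ n in atTop, ∀ γ ∈ {γ | ∃ n, e n (x γ) ≠ 0} ∩ i ⁻¹' Iio K, |e n (x γ)| ≤ ε := by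
      rw [eventually_all_finite hfin]
      exact fun γ _ => ((he (x γ)).abs).eventually (ge_mem_nhds (by rwa [abs_zero]))
    filter_upwards [h1] with n hn γ
    by_cases hγ : ∃ n, e n (x γ) ≠ 0
    · by_cases hγK : i γ < K
      · exact (hle _ γ).trans (hn γ ⟨hγ, hγK⟩)
      · have h2 : |e n (x γ)| ≤ C := by
          have := mul_le_mul (heC n) (hx.norm_le γ) (norm_nonneg _) hC0
          rw [mul_one] at this
          exact ((e n).le_opNorm _).trans this
        have h3 : C < K * ε := (div_lt_iff₀ hε).1 hK
        have h4 : (K : ℝ) ≤ i γ := by exact_mod_cast not_lt.1 hγK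
        rw [habs, hw, inv_mul_le_iff₀ (by positivity)]
        nlinarith
    · push Not at hγ
      rw [habs, hγ, abs_zero, mul_zero]
      exact hε.le

end Reweighting

/-! ### Penalties along a weakly null sequence -/

section PositivePart

/-- The square of the positive part. -/
noncomputable def posSq (s : ℝ) : ℝ := max s 0 ^ 2

theorem posSq_nonneg (s : ℝ) : 0 ≤ posSq s := sq_nonneg _

theorem posSq_of_nonpos {s : ℝ} (h : s ≤ 0) : posSq s = 0 := by simp [posSq, h]

theorem continuous_posSq : Continuous posSq := by unfold posSq; fun_prop

theorem posSq_add_le (s a : ℝ) : posSq (s + a) ≤ posSq s + 2 * max s 0 * a + a ^ 2 := by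
  unfold posSq
  rcases max_cases (s + a) 0 with ⟨h, h'⟩ | ⟨h, h'⟩ <;>
    rcases max_cases s 0 with ⟨k, k'⟩ | ⟨k, k'⟩ <;> rw [h, k] <;> nlinarith [sq_nonneg (s + a)]

theorem le_one_add_of_posSq_le {s ε : ℝ} (hε : 0 ≤ ε) (h : posSq (s - 1) ≤ ε ^ 2) :
    s ≤ 1 + ε := by
  have h1 := abs_le_of_sq_le_sq' h hε
  have h2 := le_max_left (s - 1) 0
  linarith [h1.2]

variable {E : Type*} [NormedAddCommGroup E] [NormedSpace ℝ E]

theorem convexOn_posSq_comp {h : E → ℝ} (hh : ConvexOn ℝ univ h) :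
    ConvexOn ℝ univ fun a => posSq (h a) := by
  have h1 : ConvexOn ℝ univ fun a => max (h a) 0 := hh.sup (convexOn_const 0 convex_univ)
  exact h1.pow (fun a _ => le_max_right _ _) 2

theorem SecondDiffSmooth.posSq_comp {h : E → ℝ} (hs : SecondDiffSmooth h)
    (hc : ConvexOn ℝ univ h) (hcont : Continuous h) : SecondDiffSmooth fun a => posSq (h a) := by
  intro a ε hε
  obtain ⟨L, hL0, r, hr, hL⟩ : ∃ L : ℝ, 0 < L ∧ ∃ r > 0, ∀ k : E, ‖k‖ < r →
      |h (a + k) - h a| ≤ L * ‖k‖ := by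
    have hll := ((hc.continuousOn_tfae isOpen_univ univ_nonempty).out 1 0).1 hcont.continuousOn
    obtain ⟨K, t, ht, hK⟩ := hll (mem_univ a)
    rw [nhdsWithin_univ] at ht
    obtain ⟨r, hr, hball⟩ := Metric.mem_nhds_iff.1 ht
    refine ⟨K + 1, by positivity, r, hr, fun k hk => ?_⟩
    have h1 := hK.dist_le_mul (a + k) (hball (by simpa using hk)) a (hball (by simpa using hr))
    rw [Real.dist_eq, dist_eq_norm, add_sub_cancel_left] at h1
    nlinarith [norm_nonneg k]
  set m : ℝ := max (h a) 0 with hm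
  have hm0 : 0 ≤ m := le_max_right _ _
  obtain ⟨δ, hδ, hsm⟩ := hs a (ε / (4 * (m + 1))) (by positivity)
  refine ⟨min (min δ r) (ε / (4 * L ^ 2)), by positivity, fun k hk => ?_⟩
  have hkδ : ‖k‖ < δ := hk.trans_le ((min_le_left _ _).trans (min_le_left _ _))
  have hkr : ‖k‖ < r := hk.trans_le ((min_le_left _ _).trans (min_le_right _ _))
  have hkL : ‖k‖ * (4 * L ^ 2) < ε := by
    rw [← lt_div_iff₀ (by positivity)]
    exact hk.trans_le (min_le_right _ _)
  have e1 := hsm k hkδ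
  have e2 := hL k hkr
  have e3 := hL (-k) (by rwa [norm_neg])
  rw [norm_neg, ← sub_eq_add_neg] at e3
  have e4 := posSq_add_le (h a) (h (a + k) - h a)
  have e5 := posSq_add_le (h a) (h (a - k) - h a)
  rw [add_sub_cancel] at e4 e5
  have hk0 := norm_nonneg k
  have sq : ∀ s : ℝ, |s| ≤ L * ‖k‖ → s ^ 2 ≤ ε / 4 * ‖k‖ := by
    intro s hs
    have h1 : s ^ 2 ≤ (L * ‖k‖) ^ 2 := sq_le_sq' (by linarith [neg_abs_le s]) (by
      linarith [le_abs_self s])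
    nlinarith
  have e6 := sq _ e2
  have e7 := sq _ e3
  have e8 : m * (ε / (4 * (m + 1)) * ‖k‖) ≤ ε / 4 * ‖k‖ := by
    rw [← mul_assoc]
    refine mul_le_mul_of_nonneg_right ?_ hk0
    rw [mul_div_assoc', div_le_div_iff₀ (by positivity) (by norm_num)]
    nlinarith
  have e9 := mul_le_mul_of_nonneg_left e1 hm0
  linarith

end PositivePart

section Spikes

variable {E : Type*} [NormedAddCommGroup E] [NormedSpace ℝ E] {f : ℕ → E} {C : ℝ}

/-- The penalty for taking a value outside of `[-1, 1]` at `f n`. -/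
noncomputable def spike (f : ℕ → E) (n : ℕ) (φ : StrongDual ℝ E) : ℝ :=
  ((n : ℝ) + 1) * (posSq (φ (f n) - 1) + posSq (-φ (f n) - 1))

theorem spike_nonneg (n : ℕ) (φ : StrongDual ℝ E) : 0 ≤ spike f n φ :=
  mul_nonneg (by positivity) (add_nonneg (posSq_nonneg _) (posSq_nonneg _))

theorem spike_eq_zero {n : ℕ} {φ : StrongDual ℝ E} (h : |φ (f n)| ≤ 1) : spike f n φ = 0 := by
  obtain ⟨h1, h2⟩ := abs_le.1 h
  rw [spike, posSq_of_nonpos (by linarith), posSq_of_nonpos (by linarith), add_zero, mul_zero]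

theorem spike_neg (n : ℕ) (φ : StrongDual ℝ E) : spike f n (-φ) = spike f n φ := by
  rw [spike, spike, neg_apply, neg_neg, add_comm (posSq _)]

theorem continuous_spike (n : ℕ) : Continuous (spike f n) := by
  have h : Continuous fun φ : StrongDual ℝ E => φ (f n) := by fun_prop
  exact ((continuous_posSq.comp (h.sub continuous_const)).add
    (continuous_posSq.comp (h.neg.sub continuous_const))).const_mul _

theorem convexOn_apply_sub (x : E) (c : ℝ) :
    ConvexOn ℝ univ fun φ : StrongDual ℝ E => φ x - c := by
  refine ⟨convex_univ, fun φ _ ψ _ a b _ _ hab => le_of_eq ?_⟩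
  simp only [add_apply, smul_apply, smul_eq_mul]
  linear_combination c * hab

theorem secondDiffSmooth_apply_sub (x : E) (c : ℝ) :
    SecondDiffSmooth fun φ : StrongDual ℝ E => φ x - c := by
  intro φ ε hε
  refine ⟨1, one_pos, fun k _ => ?_⟩
  simp only [add_apply, sub_apply]
  have : 0 ≤ ε * ‖k‖ := by positivity
  linarith

theorem convexOn_spike (n : ℕ) : ConvexOn ℝ univ (spike f n) := by
  have h1 := convexOn_posSq_comp (convexOn_apply_sub (f n) 1)
  have h2 := convexOn_posSq_comp (convexOn_apply_sub (-f n) 1)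
  simp only [map_neg] at h2
  exact (h1.add h2).smul (by positivity : (0 : ℝ) ≤ (n : ℝ) + 1)

theorem secondDiffSmooth_spike (n : ℕ) : SecondDiffSmooth (spike f n) := by
  have hc : ∀ x : E, Continuous fun φ : StrongDual ℝ E => φ x - 1 := fun x => by fun_prop
  have h1 := (secondDiffSmooth_apply_sub (f n) 1).posSq_comp (convexOn_apply_sub _ _) (hc _)
  have h2 := (secondDiffSmooth_apply_sub (-f n) 1).posSq_comp (convexOn_apply_sub _ _) (hc _)
  simp only [map_neg] at h2
  exact (h1.add h2).const_mul (by positivity : (0 : ℝ) ≤ (n : ℝ) + 1)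

/-- The sum of all the penalties; it is locally finite when `f` is weakly null. -/
noncomputable def spikeSum (f : ℕ → E) (φ : StrongDual ℝ E) : ℝ := ∑' n, spike f n φ

theorem spikeSum_nonneg (φ : StrongDual ℝ E) : 0 ≤ spikeSum f φ :=
  tsum_nonneg fun n => spike_nonneg n φ

theorem spikeSum_neg (φ : StrongDual ℝ E) : spikeSum f (-φ) = spikeSum f φ :=
  tsum_congr fun n => spike_neg n φ

theorem spikeSum_eq_zero {φ : StrongDual ℝ E} (h : ∀ n, |φ (f n)| ≤ 1) : spikeSum f φ = 0 := by
  rw [spikeSum, tsum_congr fun n => spike_eq_zero (h n), tsum_zero]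

/-- Near each functional, all but finitely many of the penalties vanish. -/
theorem exists_spike_eq_zero (hC : ∀ n, ‖f n‖ ≤ C)
    (hf : ∀ φ : StrongDual ℝ E, Tendsto (fun n => φ (f n)) atTop (𝓝 0)) (φ : StrongDual ℝ E) :
    ∃ N : ℕ, ∃ δ > 0, ∀ k : StrongDual ℝ E, ‖k‖ < δ → ∀ n, N ≤ n → spike f n (φ + k) = 0 := by
  have hC0 : 0 ≤ C := (norm_nonneg _).trans (hC 0)
  obtain ⟨N, hN⟩ := eventually_atTop.1
    (((hf φ).abs).eventually (ge_mem_nhds (by norm_num : |(0 : ℝ)| < 1 / 2)))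
  refine ⟨N, (2 * (C + 1))⁻¹, by positivity, fun k hk n hn => spike_eq_zero ?_⟩
  have h1 : ‖k‖ * (C + 1) ≤ 1 / 2 := by
    rw [← le_div_iff₀ (by positivity)]
    refine hk.le.trans (le_of_eq ?_)
    rw [mul_inv]
    ring
  have h2 : |k (f n)| ≤ ‖k‖ * (C + 1) :=
    (k.le_opNorm _).trans (mul_le_mul_of_nonneg_left (by linarith [hC n]) (norm_nonneg k))
  rw [add_apply]
  linarith [abs_add_le (φ (f n)) (k (f n)), hN n hn]

theorem exists_spikeSum_eq (hC : ∀ n, ‖f n‖ ≤ C)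
    (hf : ∀ φ : StrongDual ℝ E, Tendsto (fun n => φ (f n)) atTop (𝓝 0)) (φ : StrongDual ℝ E) :
    ∃ N : ℕ, ∃ δ > 0, ∀ k : StrongDual ℝ E, ‖k‖ < δ →
      spikeSum f (φ + k) = ∑ n ∈ Finset.range N, spike f n (φ + k) := by
  obtain ⟨N, δ, hδ, h⟩ := exists_spike_eq_zero hC hf φ
  refine ⟨N, δ, hδ, fun k hk => tsum_eq_sum fun n hn => h k hk n ?_⟩
  simpa using hn

theorem summable_spike (hC : ∀ n, ‖f n‖ ≤ C)
    (hf : ∀ φ : StrongDual ℝ E, Tendsto (fun n => φ (f n)) atTop (𝓝 0)) (φ : StrongDual ℝ E) :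
    Summable fun n => spike f n φ := by
  obtain ⟨N, δ, hδ, h⟩ := exists_spike_eq_zero hC hf φ
  refine summable_of_ne_finset_zero (s := Finset.range N) fun n hn => ?_
  have := h 0 (by rwa [norm_zero]) n (by simpa using hn)
  rwa [add_zero] at this

theorem continuous_spikeSum (hC : ∀ n, ‖f n‖ ≤ C)
    (hf : ∀ φ : StrongDual ℝ E, Tendsto (fun n => φ (f n)) atTop (𝓝 0)) :
    Continuous (spikeSum f) := by
  rw [continuous_iff_continuousAt]
  intro φ
  obtain ⟨N, δ, hδ, h⟩ := exists_spikeSum_eq hC hf φ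
  have h1 : Continuous fun ψ => ∑ n ∈ Finset.range N, spike f n ψ :=
    continuous_finsetSum _ fun n _ => continuous_spike n
  refine h1.continuousAt.congr ?_
  filter_upwards [Metric.ball_mem_nhds φ hδ] with ψ hψ
  have := h (ψ - φ) (by rwa [← dist_eq_norm])
  rw [add_sub_cancel] at this
  exact this.symm

theorem convexOn_spikeSum (hC : ∀ n, ‖f n‖ ≤ C)
    (hf : ∀ φ : StrongDual ℝ E, Tendsto (fun n => φ (f n)) atTop (𝓝 0)) :
    ConvexOn ℝ univ (spikeSum f) := by
  refine ⟨convex_univ, fun φ _ ψ _ a b ha hb hab => ?_⟩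
  have hs := summable_spike hC hf
  have h1 : HasSum (fun n => a • spike f n φ + b • spike f n ψ)
      (a • spikeSum f φ + b • spikeSum f ψ) :=
    ((hs φ).hasSum.const_smul a).add ((hs ψ).hasSum.const_smul b)
  exact hasSum_le (fun n => (convexOn_spike n).2 (mem_univ φ) (mem_univ ψ) ha hb hab)
    (hs _).hasSum h1

theorem secondDiffSmooth_spikeSum (hC : ∀ n, ‖f n‖ ≤ C)
    (hf : ∀ φ : StrongDual ℝ E, Tendsto (fun n => φ (f n)) atTop (𝓝 0)) :
    SecondDiffSmooth (spikeSum f) := by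
  have hsum : ∀ N : ℕ, SecondDiffSmooth fun φ => ∑ n ∈ Finset.range N, spike f n φ := by
    intro N
    induction N with
    | zero =>
      intro φ ε hε
      refine ⟨1, one_pos, fun k _ => ?_⟩
      simp only [Finset.range_zero, Finset.sum_empty]
      have : 0 ≤ ε * ‖k‖ := by positivity
      linarith
    | succ N ih =>
      simp only [Finset.sum_range_succ]
      exact ih.add (secondDiffSmooth_spike N)
  intro φ ε hε
  obtain ⟨N, δ, hδ, h⟩ := exists_spikeSum_eq hC hf φ
  obtain ⟨δ', hδ', h'⟩ := hsum N φ ε hε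
  refine ⟨min δ δ', lt_min hδ hδ', fun k hk => ?_⟩
  have e1 := h k (hk.trans_le (min_le_left _ _))
  have e2 := h (-k) (by rw [norm_neg]; exact hk.trans_le (min_le_left _ _))
  have e3 := h 0 (by rwa [norm_zero])
  rw [← sub_eq_add_neg] at e2
  rw [add_zero] at e3
  rw [e1, e2, e3]
  exact h' k (hk.trans_le (min_le_right _ _))

theorem spike_le_spikeSum (hC : ∀ n, ‖f n‖ ≤ C)
    (hf : ∀ φ : StrongDual ℝ E, Tendsto (fun n => φ (f n)) atTop (𝓝 0)) (n : ℕ)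
    (φ : StrongDual ℝ E) : spike f n φ ≤ spikeSum f φ :=
  (summable_spike hC hf φ).le_tsum n fun m _ => spike_nonneg m φ

end Spikes

/-! ### The norm that is not locally uniformly rotund -/

section DayFun

variable {E : Type*} [NormedAddCommGroup E] [NormedSpace ℝ E] {Γ : Type*} {x : Γ → E}

/-- The function induced on the dual by the `c₀` family `x`. -/
noncomputable def dayFun (x : Γ → E) (φ : StrongDual ℝ E) : ℝ := daySum fun γ => φ (x γ)

theorem IsC0Family.abs_apply_le (hx : IsC0Family x) (φ : StrongDual ℝ E) (γ : Γ) :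
    |φ (x γ)| ≤ ‖φ‖ :=
  (φ.le_opNorm _).trans (mul_le_of_le_one_right (norm_nonneg φ) (hx.norm_le γ))

theorem IsC0Family.dayFun_le_sq (hx : IsC0Family x) (φ : StrongDual ℝ E) :
    dayFun x φ ≤ ‖φ‖ ^ 2 :=
  daySum_le (hx.abs_apply_le φ)

theorem dayFun_neg (φ : StrongDual ℝ E) : dayFun x (-φ) = dayFun x φ :=
  daySum_neg fun γ => φ (x γ)

theorem IsC0Family.dayFun_le_combo (hx : IsC0Family x) {φ ψ θ : StrongDual ℝ E} {s t : ℝ}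
    (hs : 0 ≤ s) (ht : 0 ≤ t) (h : ∀ y, θ y ^ 2 ≤ s * φ y ^ 2 + t * ψ y ^ 2) :
    dayFun x θ ≤ s * dayFun x φ + t * dayFun x ψ :=
  daySum_le_combo (fun γ => (hx.abs_apply_le φ γ).trans (le_max_left _ ‖ψ‖))
    (fun γ => (hx.abs_apply_le ψ γ).trans (le_max_right _ _)) ⟨_, hx.abs_apply_le θ⟩ hs ht
    fun γ => h (x γ)

theorem IsC0Family.convexOn_dayFun (hx : IsC0Family x) : ConvexOn ℝ univ (dayFun x) := by
  refine ⟨convex_univ, fun φ _ ψ _ s t hs ht hst => hx.dayFun_le_combo hs ht fun y => ?_⟩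
  have h1 : t = 1 - s := by linarith
  subst h1
  simp only [add_apply, smul_apply, smul_eq_mul]
  nlinarith [mul_nonneg (mul_nonneg hs ht) (sq_nonneg (φ y - ψ y))]

theorem IsC0Family.dayFun_add_le (hx : IsC0Family x) (φ ψ : StrongDual ℝ E) {t : ℝ} (ht : 0 < t) :
    dayFun x (φ + ψ) ≤ (1 + t) * dayFun x φ + (1 + t⁻¹) * dayFun x ψ := by
  refine hx.dayFun_le_combo (by positivity) (by positivity) fun y => ?_
  rw [add_apply]
  have h1 : 2 * (φ y * ψ y) ≤ t * φ y ^ 2 + t⁻¹ * ψ y ^ 2 := by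
    have h2 : t * φ y ^ 2 + t⁻¹ * ψ y ^ 2 - 2 * (φ y * ψ y) = t⁻¹ * (t * φ y - ψ y) ^ 2 := by
      field_simp
      ring
    have h3 : 0 ≤ t⁻¹ * (t * φ y - ψ y) ^ 2 := by positivity
    linarith
  linarith

theorem IsC0Family.strictMidpoint_dayFun (hx : IsC0Family x) : StrictMidpoint (dayFun x) := by
  intro φ ψ h
  have hmid : ∀ γ, ((1 / 2 : ℝ) • φ + (1 / 2 : ℝ) • ψ) (x γ) = (φ (x γ) + ψ (x γ)) / 2 := by
    intro γ
    simp only [add_apply, smul_apply, smul_eq_mul]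
    ring
  have hfin := hx.finite ((1 / 2 : ℝ) • φ + (1 / 2 : ℝ) • ψ)
  simp only [hmid] at hfin
  have h1 : (fun γ => φ (x γ)) = fun γ => ψ (x γ) := by
    refine eq_of_daySum_midpoint (fun γ => (hx.abs_apply_le φ γ).trans (le_max_left _ ‖ψ‖))
      (fun γ => (hx.abs_apply_le ψ γ).trans (le_max_right _ _)) hfin ?_
    simpa only [dayFun, hmid] using h
  refine sub_eq_zero.1 (hx.total _ ?_)
  rintro _ ⟨γ, rfl⟩
  rw [sub_apply, sub_eq_zero]
  exact congrFun h1 γ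

end DayFun

section Construction

variable {E : Type u} [NormedAddCommGroup E] [NormedSpace ℝ E]

/-- The boundary points of a dual body are norming functionals. -/
theorem IsDualBody.exists_seminorm_eq {Φ : StrongDual ℝ E → ℝ} (hE : IsReflexiveSpace E)
    (hΦ : IsDualBody Φ) {a : StrongDual ℝ E} (ha : Φ a = 1) :
    ∃ x, hΦ.seminorm x = 1 ∧ a x = 1 := by
  have hc : Convex ℝ {φ | Φ φ < 1} := by simpa using hΦ.convex.convex_lt 1
  obtain ⟨Λ, hΛ⟩ := geometric_hahn_banach_open_point hc
    (isOpen_lt hΦ.continuous continuous_const) (x := a) (by rw [mem_ofPred, ha]; exact lt_irrefl _)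
  obtain ⟨y, hy⟩ := hE.exists_eval Λ
  simp only [hy] at hΛ
  have hpos : 0 < a y := hΛ 0 (by rw [mem_ofPred, hΦ.zero]; exact one_pos)
  have hle : hΦ.seminorm y ≤ a y := by
    obtain ⟨φ, hφ1, hφ2⟩ := hΦ.exists_eq hE y
    by_contra hn
    push Not at hn
    have hp : 0 < hΦ.seminorm y := hpos.trans hn
    have hs1 : a y / hΦ.seminorm y < 1 := (div_lt_one hp).2 hn
    have h1 : Φ ((a y / hΦ.seminorm y) • φ) < 1 :=
      (hΦ.smul_le φ (by positivity) hs1.le).trans_lt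
        ((mul_le_of_le_one_right (by positivity) hφ1).trans_lt hs1)
    have h2 := hΛ _ h1
    rw [smul_apply, hφ2, smul_eq_mul, div_mul_cancel₀ _ hp.ne'] at h2
    exact lt_irrefl _ h2
  have heq : hΦ.seminorm y = a y := le_antisymm hle (hΦ.le_seminorm ha.le y)
  refine ⟨(a y)⁻¹ • y, ?_, ?_⟩
  · rw [map_smul_eq_mul, heq, Real.norm_of_nonneg (by positivity), inv_mul_cancel₀ hpos.ne']
  · rw [map_smul, smul_eq_mul, inv_mul_cancel₀ hpos.ne']

/-- The body is cut out of the body of a strictly convex smooth function `F` by the constraints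
`|φ (f n)| ≤ 1`, which are relaxed to penalties to keep the body smooth. The term with `J` makes the
body bounded, and it vanishes for `J φ ≤ R`. -/
theorem isDualBody_spike {F J : StrongDual ℝ E → ℝ} {f : ℕ → E} {C : ℝ} (hC : ∀ n, ‖f n‖ ≤ C)
    (hf : ∀ φ : StrongDual ℝ E, Tendsto (fun n => φ (f n)) atTop (𝓝 0))
    (hFc : ConvexOn ℝ univ F) (hFcont : Continuous F) (hFs : StrictMidpoint F)
    (hFd : SecondDiffSmooth F) (hF0 : ∀ φ, 0 ≤ F φ) (hFz : F 0 = 0) (hFn : ∀ φ, F (-φ) = F φ)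
    (hJ : QuadraticGrowth J) (hJs : SecondDiffSmooth J) (hJn : ∀ φ, J (-φ) = J φ)
    {c R : ℝ} (hc : 0 < c) (hR : 0 ≤ R) :
    IsDualBody fun φ => c * F φ + (posSq (J φ - R) + spikeSum f φ) := by
  have hKc : ConvexOn ℝ univ fun φ => J φ - R := by
    refine ⟨convex_univ, fun φ _ ψ _ s t hs ht hst => ?_⟩
    have h1 := hJ.convex.2 (mem_univ φ) (mem_univ ψ) hs ht hst
    simp only [smul_eq_mul] at h1 ⊢
    linear_combination h1 + R * hst
  have hKcont : Continuous fun φ => J φ - R := hJ.continuous.sub continuous_const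
  have hKs : SecondDiffSmooth fun φ => J φ - R := by
    intro φ ε hε
    obtain ⟨δ, hδ, h⟩ := hJs φ ε hε
    exact ⟨δ, hδ, fun k hk => by linarith [h k hk]⟩
  have hGc : ConvexOn ℝ univ fun φ => posSq (J φ - R) + spikeSum f φ :=
    (convexOn_posSq_comp hKc).add (convexOn_spikeSum hC hf)
  exact
    { convex := (hFc.smul hc.le).add hGc
      continuous := (hFcont.const_mul c).add
        ((continuous_posSq.comp hKcont).add (continuous_spikeSum hC hf))
      strict := by
        intro φ ψ h
        refine hFs φ ψ (le_of_mul_le_mul_left ?_ hc)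
        have h1 := hGc.2 (mem_univ φ) (mem_univ ψ) (by norm_num : (0 : ℝ) ≤ 1 / 2)
          (by norm_num : (0 : ℝ) ≤ 1 / 2) (by norm_num)
        simp only [smul_eq_mul] at h1
        linarith
      smooth := (hFd.const_mul hc.le).add
        ((hKs.posSq_comp hKc hKcont).add (secondDiffSmooth_spikeSum hC hf))
      zero := by
        have h1 : J 0 ≤ 0 := by simpa using hJ.upper 0
        rw [hFz, posSq_of_nonpos (by linarith), spikeSum_eq_zero fun n => by simp]
        simp
      neg := fun φ => by rw [hFn, hJn, spikeSum_neg]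
      bounded := by
        refine ⟨(4 * (R + 2) + 1) / 2, fun φ hφ => ?_⟩
        have h1 : posSq (J φ - R) ≤ 1 := by
          have h2 := mul_nonneg hc.le (hF0 φ)
          have h3 := spikeSum_nonneg (f := f) φ
          linarith
        have h2 : J φ - R + 1 ≤ 1 + 1 := le_one_add_of_posSq_le zero_le_one (by
          rwa [add_sub_cancel_right, one_pow])
        have h3 := hJ.lower φ
        nlinarith [sq_nonneg (‖φ‖ - 1)] }

/-- Every infinite-dimensional reflexive space has an equivalent Gâteaux differentiable ALUR norm
that is not LUR. -/
theorem IsReflexiveSpace.exists_norm [CompleteSpace E] (hE : IsReflexiveSpace E)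
    (hinf : ¬ FiniteDimensional ℝ E) : ∃ p : Seminorm ℝ E,
      IsEquivalentNorm p ∧ IsGateauxNorm p ∧ IsALUR p ∧ ¬ IsLUR p := by
  obtain ⟨f, e, C, hfe⟩ := hE.exists_isNullSystem hinf
  obtain ⟨Γ, x₀, hx₀⟩ := hE.exists_isC0Family
  obtain ⟨w, hx, hsmall⟩ := hx₀.exists_smul hfe.dual_norm_le hfe.dual_tendsto
  obtain ⟨J, hJ, hJs, hJn⟩ := hE.exists_smooth_dual
  set D := dayFun fun γ => w γ • x₀ γ with hD
  obtain ⟨F, hFc, hFcont, hFs, hFd, hF0, hFD, hFn, hFp⟩ := exists_smooth_strictMidpoint hE.dual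
    hx.convexOn_dayFun (fun φ => daySum_nonneg _) hx.dayFun_le_sq hx.strictMidpoint_dayFun
    dayFun_neg (fun φ ψ t ht => hx.dayFun_add_le φ ψ ht) hJ hJs hJn
  have hC0 : 0 ≤ C := (norm_nonneg _).trans (hfe.norm_le 0)
  have hFz : F 0 = 0 := le_antisymm ((hFD 0).trans (by simpa using hx.dayFun_le_sq 0)) (hF0 0)
  -- a nonzero functional with `|a (f n)| ≤ 1 / 2` for all `n`
  set a : StrongDual ℝ E := (2 * C ^ 2 + 1)⁻¹ • e 0 with ha
  have ha0 : a ≠ 0 := by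
    intro h
    have h1 := congrArg (fun φ : StrongDual ℝ E => φ (f 0)) h
    simp only [ha, smul_apply, hfe.apply_self, smul_eq_mul, mul_one, zero_apply] at h1
    have h2 : (0 : ℝ) < (2 * C ^ 2 + 1)⁻¹ := by positivity
    exact h2.ne' h1
  have hahalf : ∀ n, |a (f n)| ≤ 1 / 2 := by
    intro n
    have h1 := ((e 0).le_opNorm (f n)).trans
      (mul_le_mul (hfe.dual_norm_le 0) (hfe.norm_le n) (norm_nonneg _) hC0)
    rw [ha, smul_apply, smul_eq_mul, abs_mul, abs_of_pos (by positivity),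
      inv_mul_le_iff₀ (by positivity)]
    rw [Real.norm_eq_abs] at h1
    nlinarith
  have hFa : 0 < F a := by
    refine lt_of_le_of_ne (hF0 a) fun h => ha0 (hFs a 0 ?_)
    rw [← h, hFz]
    linarith [hF0 ((1 / 2 : ℝ) • a + (1 / 2 : ℝ) • (0 : StrongDual ℝ E))]
  -- normalize so that `a` is on the boundary of the body; `R` keeps the bounding term inactive at
  -- the functionals `a + t • e n` with `0 ≤ t ≤ 1`
  set c : ℝ := (F a)⁻¹ with hc
  have hc0 : 0 < c := inv_pos.2 hFa
  have hcF : c * F a = 1 := inv_mul_cancel₀ hFa.ne'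
  set R : ℝ := (‖a‖ + C) ^ 2 with hR
  have hΦ := isDualBody_spike hfe.norm_le hfe.tendsto hFc hFcont hFs hFd hF0 hFz hFn hJ hJs hJn hc0
    (by positivity : 0 ≤ R)
  set Φ := fun φ => c * F φ + (posSq (J φ - R) + spikeSum f φ) with hΦdef
  refine ⟨hΦ.seminorm, hΦ.isEquivalentNorm, hΦ.isGateauxNorm hE, hΦ.isALUR hE, fun hlur => ?_⟩
  set p := hΦ.seminorm with hp
  -- where neither the bound nor the penalties are active
  have hΦF : ∀ φ, ‖φ‖ ≤ ‖a‖ + C → (∀ n, |φ (f n)| ≤ 1) → Φ φ = c * F φ := by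
    intro φ h1 h2
    have h3 : J φ ≤ R := (hJ.upper φ).trans (pow_le_pow_left₀ (norm_nonneg _) h1 2)
    rw [hΦdef]
    simp only
    rw [posSq_of_nonpos (by linarith), spikeSum_eq_zero h2, add_zero, add_zero]
  have hΦa : Φ a = 1 := by
    rw [hΦF a (by linarith) fun n => (hahalf n).trans (by norm_num), hcF]
  obtain ⟨x, hx1, hx2⟩ := hΦ.exists_seminorm_eq hE hΦa
  -- functionals reaching the constraints
  set t : ℕ → ℝ := fun n => 1 - |a (f n)| with ht
  have ht0 : ∀ n, 0 ≤ t n := fun n => sub_nonneg.2 ((hahalf n).trans (by norm_num))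
  have ht1 : ∀ n, t n ≤ 1 := fun n => sub_le_self _ (abs_nonneg _)
  set φ : ℕ → StrongDual ℝ E := fun n => a + t n • e n with hφ
  have hφapply : ∀ n y, φ n y = a y + t n * e n y := fun n y => rfl
  have hafn : Tendsto (fun n => a (f n)) atTop (𝓝 0) := hfe.tendsto a
  have htlim : Tendsto t atTop (𝓝 1) := by
    have := hafn.abs.const_sub 1
    rwa [abs_zero, sub_zero] at this
  have hφf : ∀ n m, |φ n (f m)| ≤ 1 := by
    intro n m
    rw [hφapply]
    by_cases hnm : n = m
    · subst hnm
      rw [hfe.apply_self, mul_one]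
      have h1 := abs_add_le (a (f n)) (t n)
      rw [abs_of_nonneg (ht0 n)] at h1
      have h2 : t n = 1 - |a (f n)| := rfl
      linarith
    · have h1 := abs_add_le (a (f m)) (t n * e n (f m))
      rw [abs_mul, abs_of_nonneg (ht0 n)] at h1
      have h2 := mul_le_mul (ht1 n) (hfe.apply_le n m hnm) (abs_nonneg _) zero_le_one
      linarith [hahalf m]
  have hφn : ∀ n, ‖φ n‖ ≤ ‖a‖ + C := by
    intro n
    refine (norm_add_le _ _).trans (add_le_add_right ?_ _)
    rw [norm_smul, Real.norm_of_nonneg (ht0 n)]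
    exact (mul_le_of_le_one_left (norm_nonneg _) (ht1 n)).trans (hfe.dual_norm_le n)
  have hΦφ : ∀ n, Φ (φ n) = c * F (φ n) := fun n => hΦF _ (hφn n) (hφf n)
  have hDlim : ∀ ε > 0, ∀ᶠ n in atTop, D (t n • e n) ≤ ε ^ 2 := by
    intro ε hε
    filter_upwards [hsmall ε hε] with n hn
    refine daySum_le fun γ => ?_
    rw [smul_apply, smul_eq_mul, abs_mul, abs_of_nonneg (ht0 n)]
    exact (mul_le_of_le_one_left (abs_nonneg _) (ht1 n)).trans (hn γ)
  -- the functionals `φ n` are asymptotically in the body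
  set s : ℕ → ℝ := fun n => max (Φ (φ n) - 1) 0 with hs
  have hs0 : ∀ n, 0 ≤ s n := fun n => le_max_right _ _
  have hΦs : ∀ n, Φ (φ n) ≤ 1 + s n := fun n => by
    have := le_max_left (Φ (φ n) - 1) 0
    linarith
  have hslim : Tendsto s atTop (𝓝 0) := by
    refine tendsto_order.2 ⟨fun b hb => Eventually.of_forall fun n => hb.trans_le (hs0 n),
      fun b hb => ?_⟩
    have h4 : 0 < c * (1 + (b / 2)⁻¹) := by positivity
    obtain ⟨ε, hε, hεb⟩ : ∃ ε > 0, c * (1 + (b / 2)⁻¹) * ε ^ 2 < b / 2 := by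
      have hcont : ContinuousAt (fun ε : ℝ => c * (1 + (b / 2)⁻¹) * ε ^ 2) 0 := by fun_prop
      have := hcont.eventually (gt_mem_nhds
        (show c * (1 + (b / 2)⁻¹) * (0 : ℝ) ^ 2 < b / 2 by simpa using hb))
      obtain ⟨ε, h1, h2⟩ := ((this.filter_mono nhdsWithin_le_nhds).and
        (self_mem_nhdsWithin (s := Ioi (0 : ℝ)))).exists
      exact ⟨ε, h2, h1⟩
    filter_upwards [hDlim ε hε] with n hn
    have h1 := hFp a (t n • e n) (b / 2) (by positivity)
    have h2 := mul_le_mul_of_nonneg_left h1 hc0.le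
    have h3 := mul_le_mul_of_nonneg_left hn h4.le
    refine max_lt ?_ hb
    rw [hΦφ]
    have h5 : c * ((1 + b / 2) * F a) = 1 + b / 2 := by linear_combination (1 + b / 2) * hcF
    change c * F (a + t n • e n) - 1 < b
    linarith
  have hφff : ∀ n, φ n (f n) = a (f n) + t n := fun n => by
    rw [hφapply, hfe.apply_self, mul_one]
  have hφffl : Tendsto (fun n => φ n (f n)) atTop (𝓝 1) := by
    simp only [hφff]
    simpa using hafn.add htlim
  -- the norms of the vectors `f n` tend to one
  have hpf : Tendsto (fun n => p (f n)) atTop (𝓝 1) := by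
    have hup : ∀ n : ℕ, p (f n) ≤ 1 + √(1 / ((n : ℝ) + 1)) := by
      intro n
      obtain ⟨ψ, hψ1, hψ2⟩ := hΦ.exists_eq hE (f n)
      rw [hp, ← hψ2]
      refine le_one_add_of_posSq_le (Real.sqrt_nonneg _) ?_
      rw [Real.sq_sqrt (by positivity), le_div_iff₀ (by positivity), mul_comm]
      have h1 := spike_le_spikeSum hfe.norm_le hfe.tendsto n ψ
      have h2 : c * F ψ + (posSq (J ψ - R) + spikeSum f ψ) ≤ 1 := hψ1
      have h3 := mul_nonneg hc0.le (hF0 ψ)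
      have h4 := posSq_nonneg (J ψ - R)
      have h5 : 0 ≤ ((n : ℝ) + 1) * posSq (-ψ (f n) - 1) :=
        mul_nonneg (by positivity) (posSq_nonneg _)
      rw [spike, mul_add] at h1
      linarith
    have hupl : Tendsto (fun n : ℕ => 1 + √(1 / ((n : ℝ) + 1))) atTop (𝓝 1) := by
      have := (tendsto_one_div_add_atTop_nhds_zero_nat (𝕜 := ℝ)).sqrt.const_add 1
      simpa using this
    have hlow : ∀ n, φ n (f n) / (1 + s n) ≤ p (f n) := by
      intro n
      have := hs0 n
      rw [div_le_iff₀' (by positivity)]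
      exact hΦ.le_mul_seminorm (hs0 n) (hΦs n) (f n)
    have hlowl : Tendsto (fun n => φ n (f n) / (1 + s n)) atTop (𝓝 1) := by
      have := hφffl.div (hslim.const_add 1) (by norm_num)
      rw [add_zero, div_one] at this
      exact this
    exact tendsto_of_tendsto_of_tendsto_of_le_of_le hlowl hupl hlow hup
  have hppos : ∀ n, 0 < p (f n) := by
    intro n
    obtain ⟨κ, hκ, K, -, h⟩ := hΦ.isEquivalentNorm
    refine (mul_pos hκ (norm_pos_iff.2 fun h0 => ?_)).trans_le (h (f n)).1
    have := hfe.apply_self n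
    rw [h0, map_zero] at this
    exact zero_ne_one this
  set v : ℕ → E := fun n => (p (f n))⁻¹ • f n with hv
  have hv1 : ∀ n, p (v n) = 1 := fun n => by
    rw [hv, map_smul_eq_mul, Real.norm_of_nonneg (inv_nonneg.2 (hppos n).le),
      inv_mul_cancel₀ (hppos n).ne']
  have hpinv : Tendsto (fun n => (p (f n))⁻¹) atTop (𝓝 1) := by
    simpa using hpf.inv₀ one_ne_zero
  have hpx : Tendsto (fun n => p (x + v n)) atTop (𝓝 2) := by
    have hlow : ∀ n, φ n (x + v n) / (1 + s n) ≤ p (x + v n) := by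
      intro n
      have := hs0 n
      rw [div_le_iff₀' (by positivity)]
      exact hΦ.le_mul_seminorm (hs0 n) (hΦs n) _
    have hφx : Tendsto (fun n => φ n x) atTop (𝓝 1) := by
      simp only [hφapply, hx2]
      simpa using (htlim.mul (hfe.dual_tendsto x)).const_add 1
    have hlowl : Tendsto (fun n => φ n (x + v n) / (1 + s n)) atTop (𝓝 2) := by
      have := (hφx.add (hpinv.mul hφffl)).div (hslim.const_add 1) (by norm_num)
      have h2 : (1 + 1 * 1 : ℝ) / (1 + 0) = 2 := by norm_num
      rw [h2] at this
      refine this.congr fun n => ?_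
      simp only [Pi.div_apply, hv, map_add, map_smul, smul_eq_mul]
    refine tendsto_of_tendsto_of_tendsto_of_le_of_le hlowl tendsto_const_nhds hlow fun n => ?_
    have := map_add_le_add p x (v n)
    rw [hx1, hv1] at this
    linarith
  have hlim := hlur x hx1 v hv1 hpx
  -- but `a` separates `x` from the weakly null sequence `v`
  have hav : Tendsto (fun n => a (x - v n)) atTop (𝓝 1) := by
    have := (hpinv.mul hafn).const_sub 1
    rw [mul_zero, sub_zero] at this
    refine this.congr fun n => ?_
    rw [map_sub, hx2, hv, map_smul, smul_eq_mul]
  have hle : (1 : ℝ) ≤ 0 := le_of_tendsto_of_tendsto' hav hlim fun n => by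
    rw [map_sub_rev p]
    exact hΦ.le_seminorm hΦa.le _
  exact absurd hle (by norm_num)

end Construction

/-! ### Squares of ALUR norms -/

section ALUR

variable {X : Type*} [NormedAddCommGroup X] [NormedSpace ℝ X] {p : Seminorm ℝ X}

theorem IsEquivalentNorm.continuous (hp : IsEquivalentNorm p) : Continuous p := by
  obtain ⟨κ, -, C, hC, h⟩ := hp
  refine (LipschitzWith.of_dist_le_mul (K := ⟨C, hC.le⟩) fun x y => ?_).continuous
  rw [Real.dist_eq, dist_eq_norm]
  exact (abs_sub_map_le_sub p x y).trans (h _).2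

theorem IsEquivalentNorm.pos (hp : IsEquivalentNorm p) {x : X} (hx : x ≠ 0) : 0 < p x := by
  obtain ⟨κ, hκ, C, -, h⟩ := hp
  exact (mul_pos hκ (norm_pos_iff.2 hx)).trans_le (h x).1

theorem IsEquivalentNorm.tendsto (hp : IsEquivalentNorm p) {ι : Type*} {l : Filter ι} {u : ι → X}
    {x : X} (h : Tendsto (fun n => p (u n - x)) l (𝓝 0)) : Tendsto u l (𝓝 x) := by
  obtain ⟨κ, hκ, C, -, hle⟩ := hp
  rw [tendsto_iff_norm_sub_tendsto_zero]
  refine squeeze_zero (fun _ => norm_nonneg _) (fun n => ?_) (by simpa using h.const_mul κ⁻¹)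
  rw [← div_eq_inv_mul, le_div_iff₀' hκ]
  exact (hle _).1

/-- A denting point of the unit ball is not in the interior of a segment contained in it. -/
theorem IsALUR.lt_one (hA : IsALUR p) {a b : X} (ha : p a ≤ 1) (hb : p b ≤ 1) (hab : 0 < p (a - b))
    {s t : ℝ} (hs : 0 < s) (ht : 0 < t) (hst : s + t = 1) : p (s • a + t • b) < 1 := by
  by_contra hn
  have hle : p (s • a + t • b) ≤ 1 := by
    refine (map_add_le_add p _ _).trans ?_
    rw [map_smul_eq_mul, map_smul_eq_mul, Real.norm_of_nonneg hs.le, Real.norm_of_nonneg ht.le]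
    nlinarith
  refine hA _ (le_antisymm hle (not_lt.1 hn)) (min s t * p (a - b))
    (mul_pos (lt_min hs ht) hab) (subset_closure ?_)
  have e1 : a - (s • a + t • b) = t • (a - b) := by
    have : s = 1 - t := by linarith
    subst this
    module
  have e2 : b - (s • a + t • b) = s • (b - a) := by
    have : t = 1 - s := by linarith
    subst this
    module
  have h1 : min s t * p (a - b) ≤ p (a - (s • a + t • b)) := by
    rw [e1, map_smul_eq_mul, Real.norm_of_nonneg ht.le]
    exact mul_le_mul_of_nonneg_right (min_le_right _ _) hab.le
  have h2 : min s t * p (a - b) ≤ p (b - (s • a + t • b)) := by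
    rw [e2, map_smul_eq_mul, Real.norm_of_nonneg hs.le, map_sub_rev p b a]
    exact mul_le_mul_of_nonneg_right (min_le_left _ _) hab.le
  have hc := convex_convexHull ℝ
    {y : X | p y ≤ 1 ∧ min s t * p (a - b) ≤ p (y - (s • a + t • b))}
  exact hc (subset_convexHull ℝ _ ⟨ha, h1⟩) (subset_convexHull ℝ _ ⟨hb, h2⟩) hs.le ht.le hst

theorem IsALUR.strictConvexOn_sq (hA : IsALUR p) (hp : IsEquivalentNorm p) {c : ℝ} (hc : 0 < c) :
    StrictConvexOn ℝ univ fun x => c * p x ^ 2 := by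
  refine ⟨convex_univ, fun x _ y _ hxy s t hs ht hst => ?_⟩
  simp only [smul_eq_mul]
  suffices h : p (s • x + t • y) ^ 2 < s * p x ^ 2 + t * p y ^ 2 by
    linarith [mul_lt_mul_of_pos_left h hc]
  have hle : p (s • x + t • y) ≤ s * p x + t * p y := by
    refine (map_add_le_add p _ _).trans ?_
    rw [map_smul_eq_mul, map_smul_eq_mul, Real.norm_of_nonneg hs.le, Real.norm_of_nonneg ht.le]
  have h0 := apply_nonneg p (s • x + t • y)
  have hsq : (s * p x + t * p y) ^ 2 = s * p x ^ 2 + t * p y ^ 2 - s * t * (p x - p y) ^ 2 := by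
    have : t = 1 - s := by linarith
    subst this
    ring
  by_cases hpq : p x = p y
  · have hr : 0 < p x := by
      by_contra hn
      have hx : x = 0 := by_contra fun h => hn (hp.pos h)
      have hy : y = 0 := by_contra fun h => hn (hpq ▸ hp.pos h)
      exact hxy (hx.trans hy.symm)
    have hinv : ‖(p x)⁻¹‖ = (p x)⁻¹ := Real.norm_of_nonneg (by positivity)
    have h1 := hA.lt_one (a := (p x)⁻¹ • x) (b := (p x)⁻¹ • y)
      (by rw [map_smul_eq_mul, hinv, inv_mul_cancel₀ hr.ne'])
      (by rw [map_smul_eq_mul, hinv, ← hpq, inv_mul_cancel₀ hr.ne'])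
      (by
        rw [← smul_sub, map_smul_eq_mul, hinv]
        exact mul_pos (inv_pos.2 hr) (hp.pos (sub_ne_zero.2 hxy))) hs ht hst
    rw [smul_comm s, smul_comm t, ← smul_add, map_smul_eq_mul, hinv, inv_mul_lt_iff₀ hr,
      mul_one] at h1
    have h2 : s * p x ^ 2 + t * p y ^ 2 = p x ^ 2 := by rw [← hpq, ← add_mul, hst, one_mul]
    rw [h2]
    exact pow_lt_pow_left₀ h1 h0 two_ne_zero
  · have h1 : 0 < s * t * (p x - p y) ^ 2 := by
      have := sub_ne_zero.2 hpq
      positivity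
    have h2 := pow_le_pow_left₀ h0 hle 2
    linarith

/-- An ALUR norm has the Kadec–Klee property: denting points are points of continuity of the
identity map from the weak to the norm topology. -/
theorem IsALUR.tendsto_of_weak (hA : IsALUR p) (hp : IsEquivalentNorm p) {ι : Type*} {l : Filter ι}
    [l.NeBot] {u : ι → X} {x : X}
    (hx : ∀ φ : StrongDual ℝ X, Tendsto (fun n => φ (u n)) l (𝓝 (φ x)))
    (hpu : Tendsto (fun n => p (u n)) l (𝓝 (p x))) : Tendsto (fun n => p (u n - x)) l (𝓝 0) := by
  by_cases hx0 : x = 0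
  · subst hx0
    simpa using hpu
  have hr := hp.pos hx0
  set v : ι → X := fun n => (p (u n))⁻¹ • u n with hv
  set y : X := (p x)⁻¹ • x with hy
  have hy1 : p y = 1 := by
    rw [hy, map_smul_eq_mul, Real.norm_of_nonneg (by positivity), inv_mul_cancel₀ hr.ne']
  have hv1 : ∀ n, p (v n) ≤ 1 := fun n => by
    rw [hv, map_smul_eq_mul, Real.norm_of_nonneg (inv_nonneg.2 (apply_nonneg p _))]
    exact inv_mul_le_one
  have hvy : ∀ φ : StrongDual ℝ X, Tendsto (fun n => φ (v n)) l (𝓝 (φ y)) := fun φ => by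
    simp only [hv, hy, map_smul, smul_eq_mul]
    exact (hpu.inv₀ hr.ne').mul (hx φ)
  have hvlim : Tendsto (fun n => p (v n - y)) l (𝓝 0) := by
    refine tendsto_order.2 ⟨fun b hb => Eventually.of_forall fun n =>
      hb.trans_le (apply_nonneg p _), fun b hb => ?_⟩
    by_contra hn
    refine hA y hy1 b hb (mem_of_weak_limit hvy (convex_convexHull ℝ _).closure isClosed_closure ?_)
    refine (not_eventually.1 hn).mono fun n h => subset_closure (subset_convexHull ℝ _ ?_)
    exact ⟨hv1 n, not_lt.1 h⟩
  have hbound : ∀ᶠ n in l, p (u n - x) ≤ p (u n) * p (v n - y) + |p (u n) - p x| := by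
    filter_upwards [hpu.eventually (lt_mem_nhds hr)] with n hn
    have e : u n - x = p (u n) • (v n - y) + (p (u n) - p x) • y := by
      have e1 : p (u n) • v n = u n := by rw [hv, smul_smul, mul_inv_cancel₀ hn.ne', one_smul]
      have e2 : p x • y = x := by rw [hy, smul_smul, mul_inv_cancel₀ hr.ne', one_smul]
      rw [smul_sub, sub_smul, e1, e2]
      abel
    rw [e]
    refine (map_add_le_add p _ _).trans ?_
    rw [map_smul_eq_mul, map_smul_eq_mul, Real.norm_of_nonneg hn.le, hy1, mul_one,
      Real.norm_eq_abs]
  refine squeeze_zero' (Eventually.of_forall fun n => apply_nonneg p _) hbound ?_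
  simpa using (hpu.mul hvlim).add (hpu.sub_const (p x)).abs

theorem IsALUR.isUFunction_sq (hA : IsALUR p) (hp : IsEquivalentNorm p) {c : ℝ} (hc : 0 < c) :
    IsUFunction fun x => c * p x ^ 2 where
  continuous := (hp.continuous.pow 2).const_mul c
  strictConvex := hA.strictConvexOn_sq hp hc
  bounded_on_bounded := by
    intro s hs
    obtain ⟨κ, -, C, hC, h⟩ := hp
    obtain ⟨R, hR⟩ := hs.exists_norm_le
    refine (Metric.isBounded_Icc (0 : ℝ) (c * (C * R) ^ 2)).subset ?_
    rintro _ ⟨x, hx, rfl⟩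
    have h1 : p x ≤ C * R := (h x).2.trans (mul_le_mul_of_nonneg_left (hR x hx) hC.le)
    exact ⟨by positivity, mul_le_mul_of_nonneg_left
      (pow_le_pow_left₀ (apply_nonneg p x) h1 2) hc.le⟩
  coercive := by
    intro M
    obtain ⟨κ, hκ, C, -, h⟩ := hp
    refine (Metric.isBounded_closedBall (x := (0 : X)) (r := (M / c + 1) / κ)).subset fun x hx => ?_
    rw [mem_closedBall_zero_iff, le_div_iff₀' hκ]
    have h1 : p x ^ 2 ≤ M / c := (le_div_iff₀' hc).2 hx
    have h2 := (h x).1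
    nlinarith [sq_nonneg (p x - 1)]

theorem IsGateauxNorm.gateauxDifferentiableAt_sq (hG : IsGateauxNorm p) (c : ℝ) (x : X) :
    GateauxDifferentiableAt (fun x => c * p x ^ 2) x := by
  by_cases hx : x = 0
  · subst hx
    refine ⟨0, fun v => ?_⟩
    have h : HasDerivAt (fun t : ℝ => c * (t ^ 2 * p v ^ 2)) (c * (2 * 0 * p v ^ 2)) 0 := by
      have := ((hasDerivAt_pow 2 (0 : ℝ)).mul_const (p v ^ 2)).const_mul c
      simpa using this
    have e : (fun t : ℝ => c * p (0 + t • v) ^ 2) = fun t => c * (t ^ 2 * p v ^ 2) := by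
      ext t
      rw [zero_add, map_smul_eq_mul, mul_pow, Real.norm_eq_abs, sq_abs]
    rw [HasLineDerivAt, e]
    exact h.congr_deriv (by simp)
  · obtain ⟨g, hg⟩ := hG x hx
    refine ⟨(c * (2 * p x)) • g, fun v => ?_⟩
    have h := ((hg v : HasDerivAt (fun t : ℝ => p (x + t • v)) (g v) 0).pow 2).const_mul c
    refine HasDerivAt.congr_deriv h ?_
    rw [smul_apply, smul_eq_mul, zero_smul, add_zero]
    push_cast
    ring

/-- A weak limit of a sequence as in the small diameter property is a point of contact of the graph
with the supporting hyperplane, so it is `x` by strict convexity. Then the values, hence the norms,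
converge too. -/
theorem IsALUR.hasSDP_sq (hX : IsReflexiveSpace X) (hA : IsALUR p) (hp : IsEquivalentNorm p)
    {c : ℝ} (hc : 0 < c) : HasSDP fun x => c * p x ^ 2 := by
  intro x g hg u hu
  have hU := hA.isUFunction_sq hp hc
  have hsub : ∀ y, c * p x ^ 2 + g (y - x) ≤ c * p y ^ 2 := hg
  refine ⟨x, hp.tendsto (tendsto_iff_ultrafilter _ _ _ |>.2 fun U hUtop => ?_)⟩
  have huU := hu.mono_left hUtop
  obtain ⟨R, hR⟩ : ∃ R : ℝ, ∀ᶠ n in (U : Filter ℕ), ‖u n‖ ≤ R := by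
    obtain ⟨κ, hκ, C, -, h⟩ := hp
    have hev := huU.eventually (lt_mem_nhds (sub_one_lt (g x - c * p x ^ 2)))
    set M := g x - c * p x ^ 2 - 1 with hM
    have hcκ : 0 < c * κ ^ 2 := by positivity
    refine ⟨(‖g‖ + |M|) / (c * κ ^ 2) + 1, hev.mono fun n hn => ?_⟩
    have h1 : c * (κ * ‖u n‖) ^ 2 ≤ c * p (u n) ^ 2 := mul_le_mul_of_nonneg_left
      (pow_le_pow_left₀ (by positivity) (h (u n)).1 2) hc.le
    have h2 := (le_abs_self _).trans (g.le_opNorm (u n))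
    have h3 := neg_abs_le M
    by_contra hlt
    push Not at hlt
    have h4 : 1 ≤ ‖u n‖ := by
      refine le_trans ?_ hlt.le
      have : 0 ≤ (‖g‖ + |M|) / (c * κ ^ 2) := by positivity
      linarith
    have h5 : ‖g‖ + |M| < ‖u n‖ * (c * κ ^ 2) := by
      rw [← div_lt_iff₀ hcκ]
      linarith
    nlinarith [abs_nonneg M]
  obtain ⟨v, hv⟩ := hX.exists_weak_limit U u hR
  have hval : c * p v ^ 2 ≤ c * p x ^ 2 + g (v - x) := by
    refine le_of_forall_pos_le_add fun ε hε => ?_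
    have h1 : Tendsto (fun n => g (u n) - (g (u n) - c * p (u n) ^ 2)) U
        (𝓝 (g v - (g x - c * p x ^ 2))) := (hv g).sub huU
    simp only [sub_sub_cancel] at h1
    refine le_of_weak_limit hv hU.strictConvex.convexOn hU.continuous
      (h1.eventually (ge_mem_nhds ?_)).frequently
    rw [map_sub]
    linarith
  have hvx : v = x := by
    by_contra hne
    have h1 := hU.strictConvex.2 (mem_univ v) (mem_univ x) hne (by norm_num : (0 : ℝ) < 1 / 2)
      (by norm_num : (0 : ℝ) < 1 / 2) (by norm_num)
    have h2 := hsub ((1 / 2 : ℝ) • v + (1 / 2 : ℝ) • x)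
    have e : (1 / 2 : ℝ) • v + (1 / 2 : ℝ) • x - x = (1 / 2 : ℝ) • (v - x) := by module
    rw [e, map_smul] at h2
    simp only [smul_eq_mul] at h1 h2
    linarith
  subst hvx
  refine hA.tendsto_of_weak hp hv ?_
  have h1 : Tendsto (fun n => c⁻¹ * (g (u n) - (g (u n) - c * p (u n) ^ 2))) U
      (𝓝 (c⁻¹ * (g v - (g v - c * p v ^ 2)))) := ((hv g).sub huU).const_mul _
  simp only [sub_sub_cancel, inv_mul_cancel_left₀ hc.ne'] at h1
  have h2 := h1.sqrt
  simpa only [Real.sqrt_sq (apply_nonneg p _)] using h2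

/-- Condition (b) for the square of a norm is even stronger than local uniform rotundity. -/
theorem ConditionB.isLUR (hp : IsEquivalentNorm p)
    (hB : ConditionB fun (_ : Unit) (x : X) => p x ^ 2) : IsLUR p := by
  obtain ⟨κ, hκ, K, hK, hle⟩ := hp
  obtain ⟨C, hC, q, hq, h⟩ := hB {x | p x ≤ 1} (by simpa using p.convexOn.convex_le 1)
    ((Metric.isBounded_closedBall (x := (0 : X)) (r := 1 / κ)).subset fun x hx => by
      rw [mem_closedBall_zero_iff, le_div_iff₀' hκ]
      exact (hle x).1.trans hx)
  intro x hx u hu hlim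
  have hq0 : q ≠ 0 := by linarith
  have h1 : ∀ n, ‖x - u n‖ ^ q ≤ C⁻¹ * (1 - (2⁻¹ * p (x + u n)) ^ 2) := by
    intro n
    have h2 := h x hx.le (u n) (hu n).le ()
    simp only [map_smul_eq_mul, hx, hu n] at h2
    rw [Real.norm_of_nonneg (by norm_num)] at h2
    rw [← div_eq_inv_mul, le_div_iff₀' hC]
    linarith
  have h2 : Tendsto (fun n => C⁻¹ * (1 - (2⁻¹ * p (x + u n)) ^ 2)) atTop (𝓝 0) := by
    have := (((hlim.const_mul 2⁻¹).pow 2).const_sub 1).const_mul C⁻¹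
    have e : C⁻¹ * (1 - ((2 : ℝ)⁻¹ * 2) ^ 2) = 0 := by norm_num
    rwa [e] at this
  have h3 : Tendsto (fun n => ‖x - u n‖ ^ q) atTop (𝓝 0) :=
    squeeze_zero (fun n => by positivity) h1 h2
  have h4 : Tendsto (fun n => ‖x - u n‖) atTop (𝓝 0) := by
    have h5 := h3.rpow_const (p := q⁻¹) (Or.inr (by positivity))
    rw [Real.zero_rpow (inv_ne_zero hq0)] at h5
    refine h5.congr fun n => ?_
    rw [Real.rpow_rpow_inv (norm_nonneg _) hq0]
  refine squeeze_zero (fun n => apply_nonneg p _) (fun n => (hle _).2) ?_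
  simp only [norm_sub_rev x] at h4
  simpa using h4.const_mul K

end ALUR

section Hilbert

theorem isReflexiveSpace_of_innerProductSpace {H : Type*} [NormedAddCommGroup H]
    [InnerProductSpace ℝ H] [CompleteSpace H] : IsReflexiveSpace H := by
  intro Λ
  let l : H →L[ℝ] ℝ := LinearMap.mkContinuous
    { toFun := fun y => Λ (InnerProductSpace.toDual ℝ H y)
      map_add' := fun y z => by simp
      map_smul' := fun r y => by simp } ‖Λ‖ fun y => by
        simpa using Λ.le_opNorm (InnerProductSpace.toDual ℝ H y)
  refine ⟨(InnerProductSpace.toDual ℝ H).symm l, ?_⟩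
  ext φ
  obtain ⟨y, rfl⟩ := (InnerProductSpace.toDual ℝ H).surjective φ
  rw [NormedSpace.dual_def, InnerProductSpace.toDual_apply_apply, real_inner_comm,
    InnerProductSpace.toDual_symm_apply]
  rfl

theorem not_finiteDimensional_lp {ι : Type*} [Infinite ι] :
    ¬ FiniteDimensional ℝ (lp (fun _ : ι => ℝ) 2) := by
  intro h
  let b : HilbertBasis ι ℝ (lp (fun _ : ι => ℝ) 2) := ⟨LinearIsometryEquiv.refl ℝ _⟩
  have := b.orthonormal.linearIndependent.finite
  exact not_finite ι

end Hilbert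

end UFun

theorem mainTheorem8 :
    -- in a reflexive Banach space, every norm of the described kind has the stated properties
    (∀ (X : Type u) [NormedAddCommGroup X] [NormedSpace ℝ X] [CompleteSpace X],
      UFun.IsReflexiveSpace X →
      ∀ p : Seminorm ℝ X, UFun.IsEquivalentNorm p → UFun.IsGateauxNorm p → UFun.IsALUR p →
        ¬ UFun.IsLUR p →
        UFun.IsUFunction (fun x => p x ^ 2) ∧
        (∀ x, UFun.GateauxDifferentiableAt (fun x => p x ^ 2) x) ∧
        UFun.HasSDP (fun x => p x ^ 2) ∧
        ¬ UFun.ConditionB (fun (_ : Unit) (x : X) => p x ^ 2)) ∧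
    -- every infinite-dimensional reflexive Banach space has such an equivalent norm
    (∀ (X : Type u) [NormedAddCommGroup X] [NormedSpace ℝ X] [CompleteSpace X],
      UFun.IsReflexiveSpace X → ¬ FiniteDimensional ℝ X →
      ∃ p : Seminorm ℝ X,
        UFun.IsEquivalentNorm p ∧ UFun.IsGateauxNorm p ∧ UFun.IsALUR p ∧ ¬ UFun.IsLUR p) ∧
    -- there are families to which the SDP theorem applies and the Enflo–Beauzamy theorem does not
    (∃ (X : Type u) (_ : NormedAddCommGroup X) (_ : NormedSpace ℝ X) (_ : CompleteSpace X)
        (_ : UniformConvexSpace X) (p : Seminorm ℝ X),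
      UFun.IsReflexiveSpace X ∧
      UFun.IsEquivalentNorm p ∧ UFun.IsGateauxNorm p ∧ UFun.IsALUR p ∧ ¬ UFun.IsLUR p ∧
      ∀ N : ℕ, 1 ≤ N → ∃ f : Fin N → X → ℝ, Function.Injective f ∧
        (∃ i, f i = fun x => p x ^ 2) ∧
        UFun.SDPHypotheses f ∧ ¬ UFun.ConditionB f ∧ ¬ UFun.EnfloBeauzamyHypotheses f) := by
  refine ⟨?_, fun X _ _ _ hX hinf => hX.exists_norm hinf, ?_⟩
  · intro X _ _ _ hX p hp hG hA hlur
    have h1 := hA.isUFunction_sq hp one_pos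
    have h2 := hG.gateauxDifferentiableAt_sq 1
    have h3 := hA.hasSDP_sq hX hp one_pos
    simp only [one_mul] at h1 h2 h3
    exact ⟨h1, h2, h3, fun hB => hlur (hB.isLUR hp)⟩
  · have hX : UFun.IsReflexiveSpace (lp (fun _ : ULift.{u} ℕ => ℝ) 2) :=
      UFun.isReflexiveSpace_of_innerProductSpace
    obtain ⟨p, hp, hG, hA, hlur⟩ := hX.exists_norm UFun.not_finiteDimensional_lp
    refine ⟨lp (fun _ : ULift.{u} ℕ => ℝ) 2, inferInstance, inferInstance, inferInstance,
      inferInstance, p, hX, hp, hG, hA, hlur, fun N hN => ?_⟩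
    have hpos : ∀ i : Fin N, (0 : ℝ) < (i : ℕ) + 1 := fun i => by positivity
    have hzero : (fun x => (((⟨0, hN⟩ : Fin N) : ℕ) + 1 : ℝ) * p x ^ 2) = fun x => p x ^ 2 := by
      simp
    have hB : ¬ UFun.ConditionB fun (i : Fin N) x => ((i : ℕ) + 1 : ℝ) * p x ^ 2 := by
      refine fun hB => hlur (UFun.ConditionB.isLUR hp fun D hD hDb => ?_)
      obtain ⟨C, hC, q, hq, h⟩ := hB D hD hDb
      refine ⟨C, hC, q, hq, fun x hx y hy _ => ?_⟩
      simpa using h x hx y hy ⟨0, hN⟩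
    refine ⟨fun i x => ((i : ℕ) + 1 : ℝ) * p x ^ 2, ?_, ⟨⟨0, hN⟩, hzero⟩, ?_, hB,
      fun h => hB h.conditionB⟩
    · -- the multiples differ wherever the norm equals one
      obtain ⟨x, hx⟩ : ∃ x, p x = 1 := by
        by_contra hn
        push Not at hn
        exact hlur fun x hx => absurd hx (hn x)
      intro i j hij
      have h1 := congrFun hij x
      simp only [hx, one_pow, mul_one, add_left_inj, Nat.cast_inj] at h1
      exact Fin.ext h1
    · exact
        { complete := inferInstance
          uniformConvex := inferInstance
          uFunction := fun i => hA.isUFunction_sq hp (hpos i)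
          gateaux := fun i => hG.gateauxDifferentiableAt_sq _
          sdp := fun i => hA.hasSDP_sq hX hp (hpos i) }
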